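/- There exist absolute constants $C,K>0$, a polynomial $p$ and a single randomized algorithm $\mathcal{A}$ such that the following holds for all integers $m\ge 2$ and $n\ge 1$, every finite universe $\mathcal{X}\subseteq[0,1]^m$ (given explicitly as a list of points), every privacy parameter $\rho>0$ and every error parameter $\alpha\in(0,1]$. On input $m,n,\mathcal{X},\rho,\alpha$ and a dataset $X$ of $n$ elements of $\mathcal{X}$ (a multiset, given as a list), the algorithm outputs a random vector $\mathcal{A}(X)\in\mathbb{R}^m$, and: 1. (Running time) $\mathcal{A}$ halts within $p(m,|\mathcal{X}|,n)$ steps in the idealized model of a real RAM that performs exact real arithmetic, comparisons, $\exp$, $\log$ and square roots, and draws independent uniform reals from $[0,1]$, at unit cost. 2. (Privacy) $\mathcal{A}$ is $\rho$-zCDP: for all datasets $X,X'$ of size $n$ such that $X'$ arises from $X$ by replacing one element, and all $\gamma>1$, the Rényi divergence of order $\gamma$ (in nats) satisfies $\mathrm{D}_\gamma(\mathcal{A}(X)\,\|\,\mathcal{A}(X'))\le\gamma\rho$. 3. (Error) If $$ n\;\ge\; K\cdot\frac{\log(m)\,\log(1/\alpha)^{5/2}}{\alpha^2\sqrt{\rho}}\cdot\sup\Bigl\{t^2\sqrt{\log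 \mathcal{P}_\infty(\mathcal{X},t)} \;:\; t\ge \alpha/C\Bigr\}, $$ then $\mathrm{err}^\infty(\mathcal{X},\mathcal{A},n)=\max_{X\in\mathcal{X}^n}\mathbb{E}\bigl\|\mathcal{A}(X)-\tfrac1n\sum_{x\in X}x\bigr\|_\infty\le\alpha$. Here $\mathcal{P}_\infty(\mathcal{X},t)$ is the largest cardinality of a set $T\subseteq\mathcal{X}$ such that $\|x-y\|_\infty>t$ for all distinct $x,y\in T$. -/

import Mathlib

open MeasureTheory
open scoped ENNReal NNReal

/-! ## Datasets, concentrated differential privacy, worst-case error -/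

/-- Two datasets of size `n` (multisets, listed in an arbitrary order) are neighboring if, up to
the order of the records, one arises from the other by replacing at most one record. -/
def Neighboring {U : Type*} {n : ℕ} (D D' : Fin n → U) : Prop :=
  ∃ (σ : Equiv.Perm (Fin n)) (i : Fin n), ∀ j, j ≠ i → D' (σ j) = D j

/-- The Rényi divergence of order `γ > 1`, in nats; it is `⊤` unless `P ≪ Q`. -/
noncomputable def renyiDiv {Y : Type*} [MeasurableSpace Y] (γ : ℝ) (P Q : Measure Y) : EReal :=
  open scoped Classical in
  if P ≪ Q then (((γ - 1)⁻¹ : ℝ) : EReal) * ENNReal.log (∫⁻ y, (P.rnDeriv Q y) ^ γ ∂Q) else ⊤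

/-- `ρ`-zero-concentrated differential privacy of a randomized algorithm, given by the law `A D`
of its output on each dataset `D`. -/
def IsZCDP {U Y : Type*} [MeasurableSpace Y] {n : ℕ} (ρ : ℝ) (A : (Fin n → U) → Measure Y) : Prop :=
  ∀ D D' : Fin n → U, Neighboring D D' →
    ∀ γ : ℝ, 1 < γ → renyiDiv γ (A D) (A D') ≤ ((γ * ρ : ℝ) : EReal)

/-- The mean of a dataset of points of `ℝ^m`. -/
noncomputable def dataMean {m n : ℕ} {X : Finset (Fin m → ℝ)} (D : Fin n → X) : Fin m → ℝ :=
  (n : ℝ)⁻¹ • ∑ i, (D i : Fin m → ℝ)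

/-- Worst-case error `max_D 𝔼 ‖A(D) - mean D‖_∞` over the datasets of size `n` (the norm on
`Fin m → ℝ` is the sup norm). -/
noncomputable def errInf {m n : ℕ} {X : Finset (Fin m → ℝ)}
    (A : (Fin n → X) → Measure (Fin m → ℝ)) : ℝ≥0∞ :=
  ⨆ D : Fin n → X, ∫⁻ y, ‖y - dataMean D‖ₑ ∂(A D)

/-- The `ℓ_∞` separation number: the largest number of points of `X` whose pairwise `ℓ_∞`
distances are all greater than `t`. -/
noncomputable def sepInf {m : ℕ} (X : Finset (Fin m → ℝ)) (t : ℝ) : ℕ :=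
  (Metric.packingNumber t.toNNReal (X : Set (Fin m → ℝ))).toNat

/-! ## Randomized real-RAM programs

A program works on finitely many named two-dimensional arrays of natural numbers and of real
numbers (all of unbounded extent), and can draw independent uniform reals from `[0,1]`.
Arithmetic on reals is exact. A program is a fixed finite object, which does not depend on the
input, and contains only natural and rational constants. -/

/-- The contents of the memory: `nat a i j` and `real a i j` are the entries at `(i, j)` of the
integer array and of the real array with name `a`, and `pos` counts the random draws made. -/
structure Memory where
  nat : ℕ → ℕ → ℕ → ℕ
  real : ℕ → ℕ → ℕ → ℝ
  pos : ℕ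

/-- Expressions for natural numbers (`sub` is truncated subtraction). -/
inductive NExp where
  | lit (k : ℕ)
  | get (a : ℕ) (i j : NExp)
  | add (x y : NExp)
  | sub (x y : NExp)

/-- Expressions for real numbers. -/
inductive RExp where
  | lit (q : ℚ)
  | get (a : ℕ) (i j : NExp)
  | cast (x : NExp)
  | add (x y : RExp)
  | sub (x y : RExp)
  | mul (x y : RExp)
  | div (x y : RExp)
  | exp (x : RExp)
  | log (x : RExp)
  | sqrt (x : RExp)

/-- Tests. -/
inductive BExp where
  | nle (x y : NExp)
  | rle (x y : RExp)
  | not (b : BExp)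
  | and (b c : BExp)

/-- Programs. -/
inductive Prog where
  | skip
  | setNat (a : ℕ) (i j : NExp) (x : NExp)
  | setReal (a : ℕ) (i j : NExp) (x : RExp)
  | draw (a : ℕ) (i j : NExp)
  | seq (c d : Prog)
  | ite (b : BExp) (c d : Prog)
  | loop (b : BExp) (c : Prog)

def NExp.eval (s : Memory) : NExp → ℕ
  | .lit k => k
  | .get a i j => s.nat a (i.eval s) (j.eval s)
  | .add x y => x.eval s + y.eval s
  | .sub x y => x.eval s - y.eval s

noncomputable def RExp.eval (s : Memory) : RExp → ℝ
  | .lit q => (q : ℝ)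
  | .get a i j => s.real a (i.eval s) (j.eval s)
  | .cast x => (x.eval s : ℝ)
  | .add x y => x.eval s + y.eval s
  | .sub x y => x.eval s - y.eval s
  | .mul x y => x.eval s * y.eval s
  | .div x y => x.eval s / y.eval s
  | .exp x => Real.exp (x.eval s)
  | .log x => Real.log (x.eval s)
  | .sqrt x => Real.sqrt (x.eval s)

def BExp.eval (s : Memory) : BExp → Prop
  | .nle x y => x.eval s ≤ y.eval s
  | .rle x y => x.eval s ≤ y.eval s
  | .not b => ¬ b.eval s
  | .and b c => b.eval s ∧ c.eval s

/-- Overwrite the entry at `(i, j)` of the array with name `a`. -/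
def writeEntry {V : Type*} (f : ℕ → ℕ → ℕ → V) (a i j : ℕ) (v : V) : ℕ → ℕ → ℕ → V :=
  fun a' i' j' => if a' = a ∧ i' = i ∧ j' = j then v else f a' i' j'

/-- `Exec ω c s t s'`: with `ω` as the sequence of random reals, the program `c` started in the
memory `s` halts after `t` steps in the memory `s'`. Each executed instruction and each test of
a condition is one step (its expressions are part of the program, so they take a bounded number
of arithmetic operations). -/
inductive Exec (ω : ℕ → unitInterval) : Prog → Memory → ℕ → Memory → Prop
  | skip (s : Memory) : Exec ω .skip s 1 s
  | setNat (s : Memory) (a : ℕ) (i j x : NExp) :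
      Exec ω (.setNat a i j x) s 1
        { s with nat := writeEntry s.nat a (i.eval s) (j.eval s) (x.eval s) }
  | setReal (s : Memory) (a : ℕ) (i j : NExp) (x : RExp) :
      Exec ω (.setReal a i j x) s 1
        { s with real := writeEntry s.real a (i.eval s) (j.eval s) (x.eval s) }
  | draw (s : Memory) (a : ℕ) (i j : NExp) :
      Exec ω (.draw a i j) s 1
        { s with
          real := writeEntry s.real a (i.eval s) (j.eval s) (ω s.pos : ℝ)
          pos := s.pos + 1 }
  | seq {c d : Prog} {s s' s'' : Memory} {t u : ℕ} :
      Exec ω c s t s' → Exec ω d s' u s'' → Exec ω (.seq c d) s (t + u) s''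
  | iteTrue {b : BExp} {c d : Prog} {s s' : Memory} {t : ℕ} :
      b.eval s → Exec ω c s t s' → Exec ω (.ite b c d) s (t + 1) s'
  | iteFalse {b : BExp} {c d : Prog} {s s' : Memory} {t : ℕ} :
      ¬ b.eval s → Exec ω d s t s' → Exec ω (.ite b c d) s (t + 1) s'
  | loopTrue {b : BExp} {c : Prog} {s s' s'' : Memory} {t u : ℕ} :
      b.eval s → Exec ω c s t s' → Exec ω (.loop b c) s' u s'' →
        Exec ω (.loop b c) s (t + u + 1) s''
  | loopFalse {b : BExp} {c : Prog} {s : Memory} :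
      ¬ b.eval s → Exec ω (.loop b c) s 1 s

/-- Once the random reals are fixed, the running time and the final memory are determined. -/
theorem Exec.det {ω : ℕ → unitInterval} {c : Prog} {s s₁ s₂ : Memory} {t₁ t₂ : ℕ}
    (h₁ : Exec ω c s t₁ s₁) (h₂ : Exec ω c s t₂ s₂) : t₁ = t₂ ∧ s₁ = s₂ := by
  induction h₁ generalizing t₂ s₂ with
  | skip | setNat | setReal | draw => cases h₂; exact ⟨rfl, rfl⟩
  | seq _ _ ih₁ ih₂ =>
    cases h₂ with
    | seq k₁ k₂ =>
      obtain ⟨rfl, rfl⟩ := ih₁ k₁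
      obtain ⟨rfl, rfl⟩ := ih₂ k₂
      exact ⟨rfl, rfl⟩
  | iteTrue hb _ ih =>
    cases h₂ with
    | iteTrue _ k => obtain ⟨rfl, rfl⟩ := ih k; exact ⟨rfl, rfl⟩
    | iteFalse hb' _ => exact absurd hb hb'
  | iteFalse hb _ ih =>
    cases h₂ with
    | iteFalse _ k => obtain ⟨rfl, rfl⟩ := ih k; exact ⟨rfl, rfl⟩
    | iteTrue hb' _ => exact absurd hb' hb
  | loopTrue hb _ _ ih₁ ih₂ =>
    cases h₂ with
    | loopTrue _ k₁ k₂ =>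
      obtain ⟨rfl, rfl⟩ := ih₁ k₁
      obtain ⟨rfl, rfl⟩ := ih₂ k₂
      exact ⟨rfl, rfl⟩
    | loopFalse hb' => exact absurd hb hb'
  | loopFalse hb =>
    cases h₂ with
    | loopTrue hb' _ _ => exact absurd hb' hb
    | loopFalse _ => exact ⟨rfl, rfl⟩

/-- The program halts within `T` steps. -/
def HaltsWithin (ω : ℕ → unitInterval) (c : Prog) (s : Memory) (T : ℕ) : Prop :=
  ∃ t, t ≤ T ∧ ∃ s', Exec ω c s t s'

/-- The final memory of a run (the initial memory if the program does not halt). -/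
noncomputable def finalMemory (ω : ℕ → unitInterval) (c : Prog) (s : Memory) : Memory :=
  open scoped Classical in
  if h : ∃ s' t, Exec ω c s t s' then h.choose else s

theorem Exec.finalMemory_eq {ω : ℕ → unitInterval} {c : Prog} {s s' : Memory} {t : ℕ}
    (h : Exec ω c s t s') : finalMemory ω c s = s' := by
  have hex : ∃ s' t, Exec ω c s t s' := ⟨s', t, h⟩
  rw [finalMemory, dif_pos hex]
  obtain ⟨u, hu⟩ := hex.choose_spec
  exact (hu.det h).2

/-! ## Programs as mechanisms for the mean point problem -/

/-- The input: integer array `0` holds `m`, `|X|`, `n`; integer array `1` holds the dataset, each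
record being given by its position in the list `e` of the universe; real array `0` holds `ρ`
and `α`; real array `1` holds the list of the points of the universe, one per row. All other
entries are `0`. -/
noncomputable def inputMemory {m n : ℕ} {X : Finset (Fin m → ℝ)} (e : Fin X.card ≃ X) (ρ α : ℝ)
    (D : Fin n → X) : Memory where
  nat a i j :=
    if a = 0 ∧ i = 0 then (if j = 0 then m else if j = 1 then X.card else if j = 2 then n else 0)
    else if h : a = 1 ∧ i = 0 ∧ j < n then (e.symm (D ⟨j, h.2.2⟩) : ℕ)
    else 0
  real a i j :=
    if a = 0 ∧ i = 0 then (if j = 0 then ρ else if j = 1 then α else 0)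
    else if h : a = 1 ∧ i < X.card ∧ j < m then (e ⟨i, h.2.1⟩ : Fin m → ℝ) ⟨j, h.2.2⟩
    else 0
  pos := 0

/-- The output vector, read from row `0` of the real array `2`, as a function of the random
reals. -/
noncomputable def answer (c : Prog) {m n : ℕ} {X : Finset (Fin m → ℝ)} (e : Fin X.card ≃ X)
    (ρ α : ℝ) (D : Fin n → X) (ω : ℕ → unitInterval) : Fin m → ℝ :=
  fun j => (finalMemory ω c (inputMemory e ρ α D)).real 2 0 j

/-- The law of the output vector when the random reals are independent and uniform on `[0,1]`. -/
noncomputable def answerLaw (c : Prog) {m n : ℕ} {X : Finset (Fin m → ℝ)} (e : Fin X.card ≃ X)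
    (ρ α : ℝ) (D : Fin n → X) : Measure (Fin m → ℝ) :=
  (Measure.infinitePi fun _ : ℕ => (volume : Measure unitInterval)).map (answer c e ρ α D)

/-! The algorithm is chaining over greedy nets, with a private multiplicative-weights game at every
scale. Put s_l = (α/2)·2^l and round every point successively to the centers of nets of scale s_0,
s_1, …, until the first point of the universe is the only center. The mean of the data telescopes
into that first point, plus the average displacements between consecutive levels, plus an error of
at most α/2 from the first rounding (`Chain.Valid.avg_sub_le`). At level l the displacement is a
function on N_l centers, bounded by s_{l+1} in every coordinate, and N_l is at most the separation
number at s_l, because the centers of a greedy net are separated (`numCenters_le_sepInf`).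

Each average displacement is learned by a game. Multiplicative weights keeps a distribution on the
N_l centers; the exponential mechanism picks, among the 2m signed coordinates, one whose average is
underestimated most, and this coordinate supplies the next gains. By the regret bound `mw_regret`
the error in the selected coordinates is small on average over the rounds, and by
`sum_softmax_mul_gap_le` a selection misses the maximal error by at most log(2m)/λ in expectation.
Hence the average of the estimates is accurate in all coordinates at once. If d bounds the number of
levels, then about d²·s_{l+1}²·log(N_l)/α² rounds bring each of these two errors below α/(4d), so
that together with the rounding the error is at most α.

The data enter only through the selections. Logits that move by at most δ cost Rényi divergence
γδ²/2 (`sum_softmax_rpow_le`, two applications of Hoeffding's lemma), and these costs add up over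
adaptive selections (`isZCDP_of_selections`). A budget of ρ/d per level fixes λ; the requirement
log(2m)/λ ≤ α/(4d) then becomes the assumed lower bound on n, with d^(5/2) as the source of
log(1/α)^(5/2).

The number of rounds grows with 1/α, so chaining is polynomial only if the radius of the universe is
less than α|X|. If it is larger, the mean of a noisy histogram already has error α under the same
lower bound on n. If α ≥ 1/2, where the lower bound may be void since log(1/α) may vanish, the
center of the cube is good enough.

The program is verified by loop invariants that carry step counts. They identify its output with a
function of the finite history of selections, so its law is a finite mixture of point masses whose
weights are products of softmax probabilities (`answer_law_of_selections`). -/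

/-! ## Sampling an index proportionally to given weights -/

/-- The index selected by the inverse-transform method from the weights `w 0, …, w (R - 1)`. -/
noncomputable def selectIndex (w : ℕ → ℝ) (R : ℕ) (u : ℝ) : ℕ :=
  sInf {k | R ≤ k + 1 ∨ u * ∑ i ∈ Finset.range R, w i ≤ ∑ i ∈ Finset.range (k + 1), w i}

/-- Partial sums of nonnegative weights increase, so the set in `selectIndex` is upward closed and
its infimum is at most `k` exactly when `k` belongs to it. -/
theorem selectIndex_le_iff {w : ℕ → ℝ} (hw : ∀ i, 0 ≤ w i) {R : ℕ} {u : ℝ} {k : ℕ} :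
    selectIndex w R u ≤ k ↔
      R ≤ k + 1 ∨ u * ∑ i ∈ Finset.range R, w i ≤ ∑ i ∈ Finset.range (k + 1), w i := by
  constructor
  · intro h
    have hne : {k | R ≤ k + 1 ∨ u * ∑ i ∈ Finset.range R, w i ≤
        ∑ i ∈ Finset.range (k + 1), w i}.Nonempty := ⟨R, Or.inl (Nat.le_succ R)⟩
    rcases Nat.sInf_mem hne with h1 | h1
    · exact Or.inl (h1.trans (Nat.succ_le_succ h))
    · refine Or.inr (h1.trans (Finset.sum_le_sum_of_subset_of_nonneg ?_ fun i _ _ => hw i))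
      exact Finset.range_mono (Nat.succ_le_succ h)
  · exact fun h => Nat.sInf_le h

/-- The form needed for the sampling loop: the loop condition holds at every `j < k` and fails at
`k`. -/
theorem selectIndex_eq_iff {w : ℕ → ℝ} (hw : ∀ i, 0 ≤ w i) {R : ℕ} {u : ℝ} {k : ℕ} :
    selectIndex w R u = k ↔
      (R ≤ k + 1 ∨ u * ∑ i ∈ Finset.range R, w i ≤ ∑ i ∈ Finset.range (k + 1), w i) ∧
      (∀ j < k, j + 1 < R ∧
        ∑ i ∈ Finset.range (j + 1), w i < u * ∑ i ∈ Finset.range R, w i) := by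
  rw [← selectIndex_le_iff hw]
  constructor
  · rintro rfl
    refine ⟨le_rfl, fun j hj => ?_⟩
    have h := mt (selectIndex_le_iff (R := R) (u := u) (k := j) hw).2 (not_le.2 hj)
    push Not at h
    exact h
  · rintro ⟨h1, h2⟩
    refine le_antisymm h1 (not_lt.1 fun hlt => ?_)
    have h := h2 _ hlt
    rcases (selectIndex_le_iff hw (R := R) (u := u)).1 le_rfl with h3 | h3
    · omega
    · exact absurd h.2 (not_lt.2 h3)

theorem selectIndex_lt {w : ℕ → ℝ} (hw : ∀ i, 0 ≤ w i) {R : ℕ} (hR : 0 < R) (u : ℝ) :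
    selectIndex w R u < R := by
  have := (selectIndex_le_iff (R := R) (u := u) (k := R - 1) hw).2 (Or.inl (by omega))
  omega

/-- The event is an initial segment of the unit interval, ending at the normalized partial sum. At
the last index this end point is `1`, in agreement with the clause `R ≤ k + 1`. -/
theorem volume_selectIndex_le {w : ℕ → ℝ} (hw : ∀ i, 0 < w i) {R k : ℕ} (hk : k < R) :
    MeasurableSet {u : unitInterval | selectIndex w R u ≤ k} ∧
    (volume : Measure unitInterval) {u | selectIndex w R u ≤ k} =
      ENNReal.ofReal ((∑ i ∈ Finset.range (k + 1), w i) / ∑ i ∈ Finset.range R, w i) := by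
  have hS : 0 < ∑ i ∈ Finset.range R, w i :=
    Finset.sum_pos (fun i _ => hw i) ⟨k, Finset.mem_range.2 hk⟩
  have hC : 0 ≤ ∑ i ∈ Finset.range (k + 1), w i := Finset.sum_nonneg fun i _ => (hw i).le
  have hCS : ∑ i ∈ Finset.range (k + 1), w i ≤ ∑ i ∈ Finset.range R, w i :=
    Finset.sum_le_sum_of_subset_of_nonneg (Finset.range_mono hk) fun i _ _ => (hw i).le
  have hmem : (∑ i ∈ Finset.range (k + 1), w i) / ∑ i ∈ Finset.range R, w i ∈ Set.Icc (0 : ℝ) 1 :=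
    ⟨div_nonneg hC hS.le, (div_le_one hS).2 hCS⟩
  have hset : {u : unitInterval | selectIndex w R u ≤ k} = Set.Iic ⟨_, hmem⟩ := by
    ext u
    rw [Set.mem_ofPred_eq, selectIndex_le_iff fun i => (hw i).le, Set.mem_Iic,
      ← Subtype.coe_le_coe]
    change _ ↔ (u : ℝ) ≤ _ / _
    rw [le_div_iff₀ hS]
    constructor
    · rintro (h | h)
      · have : k + 1 = R := by omega
        subst this
        exact mul_le_of_le_one_left hS.le u.2.2
      · exact h
    · exact Or.inr
  rw [hset]
  exact ⟨measurableSet_Iic, unitInterval.volume_Iic _⟩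

theorem volume_selectIndex_eq {w : ℕ → ℝ} (hw : ∀ i, 0 < w i) {R k : ℕ} (hk : k < R) :
    MeasurableSet {u : unitInterval | selectIndex w R u = k} ∧
    (volume : Measure unitInterval) {u | selectIndex w R u = k} =
      ENNReal.ofReal (w k / ∑ i ∈ Finset.range R, w i) := by
  have hS : 0 < ∑ i ∈ Finset.range R, w i :=
    Finset.sum_pos (fun i _ => hw i) ⟨k, Finset.mem_range.2 hk⟩
  rcases k with _ | k
  · have h := volume_selectIndex_le hw hk
    simpa using h
  · have h1 := volume_selectIndex_le hw hk
    have h0 := volume_selectIndex_le hw (Nat.lt_of_succ_lt hk)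
    have hset : {u : unitInterval | selectIndex w R u = k + 1} =
        {u : unitInterval | selectIndex w R u ≤ k + 1} \ {u | selectIndex w R u ≤ k} := by
      ext u
      simp only [Set.mem_ofPred_eq, Set.mem_sdiff]
      omega
    rw [hset]
    refine ⟨h1.1.diff h0.1, ?_⟩
    have hsub : {u : unitInterval | selectIndex w R u ≤ k} ⊆ {u | selectIndex w R u ≤ k + 1} :=
      fun u (hu : _ ≤ k) => hu.trans (Nat.le_succ k)
    rw [measure_sdiff hsub h0.1.nullMeasurableSet
      (measure_ne_top _ _), h1.2, h0.2, ← ENNReal.ofReal_sub _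
      (div_nonneg (Finset.sum_nonneg fun i _ => (hw i).le) hS.le), ← sub_div,
      Finset.sum_range_succ _ (k + 1), add_sub_cancel_left]

/-! ## Sequences of adaptive selections -/

/-- A family of functions of a history is adapted if the `t`-th one depends only on the first `t`
entries of the history. -/
def AdaptedTo {V : Type*} (W : (ℕ → ℕ) → ℕ → V) : Prop :=
  ∀ h h' t, (∀ i < t, h i = h' i) → W h t = W h' t

/-- The exponential mechanism: the probability of selecting `k` among `R` options with
logits `a`. -/
noncomputable def softmax (a : ℕ → ℝ) (R k : ℕ) : ℝ :=
  Real.exp (a k) / ∑ i ∈ Finset.range R, Real.exp (a i)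

theorem softmax_denom_pos (a : ℕ → ℝ) {R : ℕ} (hR : 0 < R) :
    0 < ∑ i ∈ Finset.range R, Real.exp (a i) :=
  Finset.sum_pos (fun _ _ => Real.exp_pos _) ⟨0, Finset.mem_range.2 hR⟩

theorem softmax_pos (a : ℕ → ℝ) {R : ℕ} (hR : 0 < R) (k : ℕ) : 0 < softmax a R k :=
  div_pos (Real.exp_pos _) (softmax_denom_pos a hR)

theorem sum_softmax (a : ℕ → ℝ) {R : ℕ} (hR : 0 < R) :
    ∑ k ∈ Finset.range R, softmax a R k = 1 := by
  simp only [softmax]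
  rw [← Finset.sum_div, div_self (softmax_denom_pos a hR).ne']

/-- The first `T` selections, made with the logits `W` and the random reals `ω`
(continued by zeros). -/
noncomputable def selections (W : (ℕ → ℕ) → ℕ → ℕ → ℝ) (R : ℕ) (ω : ℕ → unitInterval) :
    ℕ → ℕ → ℕ
  | 0 => fun _ => 0
  | t + 1 => Function.update (selections W R ω t) t
      (selectIndex (fun k => Real.exp (W (selections W R ω t) t k)) R (ω t))

/-- The infinite sequence of selections. -/
noncomputable def selectionSeq (W : (ℕ → ℕ) → ℕ → ℕ → ℝ) (R : ℕ) (ω : ℕ → unitInterval)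
    (t : ℕ) : ℕ :=
  selections W R ω (t + 1) t

theorem selections_apply_of_lt (W : (ℕ → ℕ) → ℕ → ℕ → ℝ) (R : ℕ) (ω : ℕ → unitInterval)
    {t i : ℕ} (h : i < t) : selections W R ω t i = selectionSeq W R ω i := by
  induction t with
  | zero => omega
  | succ t ih =>
    rcases Nat.lt_succ_iff_lt_or_eq.1 h with h' | rfl
    · rw [selections, Function.update_of_ne h'.ne, ih h']
    · rfl

theorem selectionSeq_eq {W : (ℕ → ℕ) → ℕ → ℕ → ℝ} (hW : AdaptedTo W) (R : ℕ)
    (ω : ℕ → unitInterval) (t : ℕ) :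
    selectionSeq W R ω t =
      selectIndex (fun k => Real.exp (W (selectionSeq W R ω) t k)) R (ω t) := by
  rw [selectionSeq, selections, Function.update_self,
    hW _ (selectionSeq W R ω) t fun i hi => selections_apply_of_lt W R ω hi]

/-- The sequences of `T` selections among `R` options, continued by zeros. -/
noncomputable def paths (R : ℕ) : ℕ → Finset (ℕ → ℕ)
  | 0 => {fun _ => 0}
  | T + 1 => open scoped Classical in
    (paths R T ×ˢ Finset.range R).image fun p => Function.update p.1 T p.2

theorem paths_zero_of_le {R T : ℕ} {h : ℕ → ℕ} (hh : h ∈ paths R T) {t : ℕ} (ht : T ≤ t) :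
    h t = 0 := by
  induction T generalizing h with
  | zero => simp only [paths, Finset.mem_singleton] at hh; rw [hh]
  | succ T ih =>
    simp only [paths, Finset.mem_image, Finset.mem_product] at hh
    obtain ⟨p, ⟨hp, -⟩, rfl⟩ := hh
    rw [Function.update_of_ne (by omega), ih hp (by omega)]

theorem paths_lt {R T : ℕ} {h : ℕ → ℕ} (hh : h ∈ paths R T) {t : ℕ} (ht : t < T) :
    h t < R := by
  induction T generalizing h with
  | zero => omega
  | succ T ih =>
    simp only [paths, Finset.mem_image, Finset.mem_product, Finset.mem_range] at hh
    obtain ⟨p, ⟨hp, hk⟩, rfl⟩ := hh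
    rcases Nat.lt_succ_iff_lt_or_eq.1 ht with h' | rfl
    · rw [Function.update_of_ne h'.ne]
      exact ih hp h'
    · rwa [Function.update_self]

theorem sum_paths_succ {M : Type*} [AddCommMonoid M] (R T : ℕ) (F : (ℕ → ℕ) → M) :
    ∑ h ∈ paths R (T + 1), F h =
      ∑ h ∈ paths R T, ∑ k ∈ Finset.range R, F (Function.update h T k) := by
  classical
  rw [← Finset.sum_product', paths]
  convert Finset.sum_image ?_
  -- Extending a path is injective: a path of length `T` vanishes at position `T`, so nothing is
  -- lost when that entry is overwritten.
  · rintro ⟨h, k⟩ hp ⟨h', k'⟩ hp' heq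
    simp only [Finset.coe_product, Set.mem_prod, Finset.mem_coe] at hp hp'
    simp only at heq
    have hk : k = k' := by simpa using congrFun heq T
    have hh : h = h' := by
      ext i
      rcases eq_or_ne i T with rfl | hi
      · rw [paths_zero_of_le hp.1 le_rfl, paths_zero_of_le hp'.1 le_rfl]
      · simpa [Function.update_of_ne hi] using congrFun heq i
    rw [hk, hh]

theorem selections_mem_paths (W : (ℕ → ℕ) → ℕ → ℕ → ℝ) {R : ℕ} (hR : 0 < R)
    (ω : ℕ → unitInterval) (T : ℕ) : selections W R ω T ∈ paths R T := by
  induction T with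
  | zero => simp [selections, paths]
  | succ T ih =>
    simp only [paths, Finset.mem_image, Finset.mem_product, Finset.mem_range]
    exact ⟨(_, _), ⟨ih, selectIndex_lt (fun i => (Real.exp_pos _).le) hR _⟩, rfl⟩

/-- The product over the first `T` steps of the values of `f` along the history `h`. -/
noncomputable def pathWeight (f : (ℕ → ℕ) → ℕ → ℕ → ℝ) (T : ℕ) (h : ℕ → ℕ) : ℝ :=
  ∏ t ∈ Finset.range T, f h t (h t)

/-- The factors up to time `T` depend only on entries before `T`, so overwriting entry `T` changes
none of them and only appends one factor. -/
theorem pathWeight_update {f : (ℕ → ℕ) → ℕ → ℕ → ℝ} (hf : AdaptedTo f) (T : ℕ) (h : ℕ → ℕ)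
    (k : ℕ) : pathWeight f (T + 1) (Function.update h T k) = pathWeight f T h * f h T k := by
  rw [pathWeight, Finset.prod_range_succ, Function.update_self, pathWeight]
  congr 1
  · refine Finset.prod_congr rfl fun t ht => ?_
    have ht' : t ≠ T := (Finset.mem_range.1 ht).ne
    rw [Function.update_of_ne ht', hf _ h t]
    intro i hi
    exact Function.update_of_ne (hi.trans (Finset.mem_range.1 ht)).ne _ _
  · rw [hf _ h T]
    intro i hi
    exact Function.update_of_ne hi.ne _ _

theorem sum_pathWeight_succ {f : (ℕ → ℕ) → ℕ → ℕ → ℝ} (hf : AdaptedTo f) (R T : ℕ)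
    (F : (ℕ → ℕ) → ℝ) :
    ∑ h ∈ paths R (T + 1), pathWeight f (T + 1) h * F h =
      ∑ h ∈ paths R T, pathWeight f T h *
        ∑ k ∈ Finset.range R, f h T k * F (Function.update h T k) := by
  rw [sum_paths_succ]
  refine Finset.sum_congr rfl fun h _ => ?_
  rw [Finset.mul_sum]
  refine Finset.sum_congr rfl fun k _ => ?_
  rw [pathWeight_update hf, mul_assoc]

theorem pathWeight_nonneg {f : (ℕ → ℕ) → ℕ → ℕ → ℝ} (hf : ∀ h t k, 0 ≤ f h t k) (T : ℕ)
    (h : ℕ → ℕ) : 0 ≤ pathWeight f T h :=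
  Finset.prod_nonneg fun _ _ => hf _ _ _

/-- The core of adaptive composition: the last choice is summed first and bounded uniformly in the
history. The factors need not be probabilities; for privacy they are the terms p^γ·q^(1-γ). -/
theorem sum_pathWeight_le {f : (ℕ → ℕ) → ℕ → ℕ → ℝ} (hf : AdaptedTo f)
    (hf0 : ∀ h t k, 0 ≤ f h t k) {R T : ℕ} {B : ℕ → ℝ}
    (hB : ∀ h, ∀ t < T, ∑ k ∈ Finset.range R, f h t k ≤ B t) :
    ∑ h ∈ paths R T, pathWeight f T h ≤ ∏ t ∈ Finset.range T, B t := by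
  induction T with
  | zero => simp [paths, pathWeight]
  | succ T ih =>
    have h1 := sum_pathWeight_succ hf R T fun _ => 1
    simp only [mul_one] at h1
    have hS : 0 ≤ B T := (Finset.sum_nonneg fun k _ => hf0 _ _ k).trans
      (hB (fun _ => 0) T (Nat.lt_succ_self T))
    rw [h1, Finset.prod_range_succ]
    calc _ ≤ ∑ h ∈ paths R T, pathWeight f T h * B T :=
          Finset.sum_le_sum fun h _ => mul_le_mul_of_nonneg_left (hB h T (Nat.lt_succ_self T))
            (pathWeight_nonneg hf0 T h)
      _ = (∑ h ∈ paths R T, pathWeight f T h) * B T := (Finset.sum_mul _ _ _).symm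
      _ ≤ _ := mul_le_mul_of_nonneg_right (ih fun h t ht => hB h t (ht.trans (Nat.lt_succ_self T)))
          hS

theorem sum_pathWeight_eq_one {f : (ℕ → ℕ) → ℕ → ℕ → ℝ} (hf : AdaptedTo f) {R : ℕ}
    (h1 : ∀ h t, ∑ k ∈ Finset.range R, f h t k = 1) (T : ℕ) :
    ∑ h ∈ paths R T, pathWeight f T h = 1 := by
  induction T with
  | zero => simp [paths, pathWeight]
  | succ T ih =>
    have h2 := sum_pathWeight_succ hf R T fun _ => 1
    simp only [mul_one, h1] at h2
    rw [h2, ih]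

/-- An upper bound on the expectation of a sum of one-step costs. -/
theorem sum_pathWeight_mul_sum_le {f : (ℕ → ℕ) → ℕ → ℕ → ℝ} (hf : AdaptedTo f)
    (hf0 : ∀ h t k, 0 ≤ f h t k) {R T : ℕ} (h1 : ∀ h t, ∑ k ∈ Finset.range R, f h t k = 1)
    {g : (ℕ → ℕ) → ℕ → ℕ → ℝ} (hg : AdaptedTo g) {B : ℕ → ℝ}
    (hB : ∀ h, ∀ t < T, ∑ k ∈ Finset.range R, f h t k * g h t k ≤ B t) :
    ∑ h ∈ paths R T, pathWeight f T h * ∑ t ∈ Finset.range T, g h t (h t) ≤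
      ∑ t ∈ Finset.range T, B t := by
  induction T with
  | zero => simp [paths, pathWeight]
  | succ T ih =>
    rw [sum_pathWeight_succ hf R T fun h => ∑ t ∈ Finset.range (T + 1), g h t (h t)]
    have hstep : ∀ h, ∑ k ∈ Finset.range R, f h T k *
          ∑ t ∈ Finset.range (T + 1), g (Function.update h T k) t (Function.update h T k t) =
        ∑ t ∈ Finset.range T, g h t (h t) + ∑ k ∈ Finset.range R, f h T k * g h T k := by
      intro h
      have hin : ∀ k, ∑ t ∈ Finset.range (T + 1),
          g (Function.update h T k) t (Function.update h T k t) =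
          ∑ t ∈ Finset.range T, g h t (h t) + g h T k := by
        intro k
        rw [Finset.sum_range_succ, Function.update_self]
        congr 1
        · refine Finset.sum_congr rfl fun t ht => ?_
          have ht' := Finset.mem_range.1 ht
          rw [Function.update_of_ne ht'.ne, hg _ h t]
          intro i hi
          exact Function.update_of_ne (hi.trans ht').ne _ _
        · rw [hg _ h T]
          intro i hi
          exact Function.update_of_ne hi.ne _ _
      simp only [hin, mul_add, Finset.sum_add_distrib, ← Finset.sum_mul, h1, one_mul]
    simp only [hstep, mul_add, Finset.sum_add_distrib]
    rw [Finset.sum_range_succ]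
    refine add_le_add (ih fun h t ht => hB h t (ht.trans (Nat.lt_succ_self T))) ?_
    calc _ ≤ ∑ h ∈ paths R T, pathWeight f T h * B T :=
          Finset.sum_le_sum fun h _ => mul_le_mul_of_nonneg_left (hB h T (Nat.lt_succ_self T))
            (pathWeight_nonneg hf0 T h)
      _ = B T := by rw [← Finset.sum_mul, sum_pathWeight_eq_one hf h1, one_mul]

/-- The conditional probabilities of the selections. -/
noncomputable def selectionProb (W : (ℕ → ℕ) → ℕ → ℕ → ℝ) (R : ℕ) (h : ℕ → ℕ) (t k : ℕ) : ℝ :=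
  softmax (W h t) R k

theorem AdaptedTo.selectionProb {W : (ℕ → ℕ) → ℕ → ℕ → ℝ} (hW : AdaptedTo W) (R : ℕ) :
    AdaptedTo (selectionProb W R) := by
  intro h h' t hh
  ext k
  rw [_root_.selectionProb, _root_.selectionProb, hW h h' t hh]

/-- Along a fixed path the logits are fixed, so following that path is a separate condition on each
uniform real. This turns an adaptive event into a box, to which independence applies. -/
theorem selections_eq_iff {W : (ℕ → ℕ) → ℕ → ℕ → ℝ} (hW : AdaptedTo W) {R T : ℕ} {h : ℕ → ℕ}
    (hh : h ∈ paths R T) (ω : ℕ → unitInterval) :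
    selections W R ω T = h ↔
      ∀ t ∈ Finset.range T, selectIndex (fun k => Real.exp (W h t k)) R (ω t) = h t := by
  induction T generalizing h with
  | zero =>
    simp only [paths, Finset.mem_singleton] at hh
    simp [selections, hh]
  | succ T ih =>
    simp only [paths, Finset.mem_image, Finset.mem_product, Finset.mem_range] at hh
    obtain ⟨⟨p, k⟩, ⟨hp, hk⟩, rfl⟩ := hh
    have hcongr : ∀ t ≤ T, W (Function.update p T k) t = W p t := fun t ht =>
      hW _ _ _ fun i hi => Function.update_of_ne (by omega) _ _
    rw [Finset.range_add_one, Finset.forall_mem_insert, hcongr T le_rfl]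
    simp only [Function.update_self]
    have hrest : (∀ t ∈ Finset.range T,
        selectIndex (fun k_1 => Real.exp (W (Function.update p T k) t k_1)) R (ω t) =
          Function.update p T k t) ↔ selections W R ω T = p := by
      rw [ih hp]
      refine forall₂_congr fun t ht => ?_
      have ht' := Finset.mem_range.1 ht
      rw [hcongr t ht'.le, Function.update_of_ne ht'.ne]
    rw [hrest, selections]
    constructor
    · intro heq
      have hpe : selections W R ω T = p := by
        ext i
        rcases eq_or_ne i T with rfl | hi
        · rw [paths_zero_of_le (h := p) hp le_rfl]
          rcases Nat.eq_zero_or_pos R with rfl | hR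
          · omega
          · exact paths_zero_of_le (selections_mem_paths W hR ω i) le_rfl
        · simpa [Function.update_of_ne hi] using congrFun heq i
      refine ⟨?_, hpe⟩
      have := congrFun heq T
      simpa [hpe] using this
    · rintro ⟨h1, h2⟩
      rw [h2, h1]

theorem measure_selections_eq {W : (ℕ → ℕ) → ℕ → ℕ → ℝ} (hW : AdaptedTo W) {R T : ℕ}
    {h : ℕ → ℕ} (hh : h ∈ paths R T) :
    MeasurableSet {ω : ℕ → unitInterval | selections W R ω T = h} ∧
    (Measure.infinitePi fun _ : ℕ => (volume : Measure unitInterval))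
        {ω | selections W R ω T = h} =
      ENNReal.ofReal (pathWeight (selectionProb W R) T h) := by
  have hset : {ω : ℕ → unitInterval | selections W R ω T = h} =
      Set.pi (Finset.range T : Set ℕ) fun t =>
        {u : unitInterval | selectIndex (fun k => Real.exp (W h t k)) R u = h t} := by
    ext ω
    rw [Set.mem_ofPred_eq, selections_eq_iff hW hh]
    simp [Set.mem_pi]
  have hm : ∀ t ∈ Finset.range T, MeasurableSet
      {u : unitInterval | selectIndex (fun k => Real.exp (W h t k)) R u = h t} := fun t ht =>
    (volume_selectIndex_eq (fun _ => Real.exp_pos _) (paths_lt hh (Finset.mem_range.1 ht))).1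
  rw [hset]
  refine ⟨MeasurableSet.pi (Finset.countable_toSet _) hm, ?_⟩
  rw [Measure.infinitePi_pi _ hm, pathWeight, ENNReal.ofReal_prod_of_nonneg]
  · refine Finset.prod_congr rfl fun t ht => ?_
    exact (volume_selectIndex_eq (fun _ => Real.exp_pos _)
      (paths_lt hh (Finset.mem_range.1 ht))).2
  · intro t ht
    have hR : 0 < R := (Nat.zero_le _).trans_lt (paths_lt hh (Finset.mem_range.1 ht))
    exact (softmax_pos _ hR _).le

/-- The intermediate type `H` carries no σ-algebra; measurability is asked only of the finitely many
level sets of `π`. -/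
theorem map_eq_sum_dirac {Ω H Y : Type*} [MeasurableSpace Ω] [MeasurableSpace Y] (μ : Measure Ω)
    (π : Ω → H) (G : H → Y) (P : Finset H) (hP : ∀ ω, π ω ∈ P)
    (hm : ∀ h ∈ P, MeasurableSet {ω | π ω = h}) :
    Measurable (fun ω => G (π ω)) ∧
    μ.map (fun ω => G (π ω)) = ∑ h ∈ P, μ {ω | π ω = h} • Measure.dirac (G h) := by
  classical
  have hpre : ∀ A : Set Y, (fun ω => G (π ω)) ⁻¹' A =
      ⋃ h ∈ P.filter fun h => G h ∈ A, {ω | π ω = h} := by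
    intro A
    ext ω
    simp only [Set.mem_preimage, Finset.mem_filter, Set.mem_iUnion, Set.mem_ofPred_eq]
    constructor
    · exact fun h => ⟨π ω, ⟨hP ω, h⟩, rfl⟩
    · rintro ⟨h, ⟨-, h2⟩, rfl⟩
      exact h2
  have hmeas : Measurable (fun ω => G (π ω)) := by
    intro A _
    rw [hpre]
    exact Finset.measurableSet_biUnion _ fun h hh => hm h (Finset.mem_filter.1 hh).1
  refine ⟨hmeas, ?_⟩
  ext A hA
  rw [Measure.map_apply hmeas hA, hpre, measure_biUnion_finset]
  · rw [Measure.finsetSum_apply, Finset.sum_filter]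
    refine Finset.sum_congr rfl fun h _ => ?_
    rw [Measure.smul_apply, Measure.dirac_apply' _ hA, smul_eq_mul, Set.indicator_apply]
    split_ifs <;> simp
  · intro h _ h' _ hne
    refine Set.disjoint_left.2 fun ω h1 h2 => hne ?_
    rw [← show π ω = h from h1, ← show π ω = h' from h2]
  · exact fun h hh => hm h (Finset.mem_filter.1 hh).1

/-! ## Rényi divergence of the exponential mechanism -/

/-- Hoeffding's lemma for a finite distribution: the values lie in an interval of length 2δ, which
gives the variance proxy δ². It serves both privacy and the regret bound. -/
theorem sum_mul_exp_le {R : ℕ} {p g : ℕ → ℝ} (hp : ∀ k, 0 ≤ p k)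
    (h1 : ∑ k ∈ Finset.range R, p k = 1) {δ : ℝ} (hg : ∀ k < R, |g k| ≤ δ) (s : ℝ) :
    ∑ k ∈ Finset.range R, p k * Real.exp (s * g k) ≤
      Real.exp (s * ∑ k ∈ Finset.range R, p k * g k + s ^ 2 * δ ^ 2 / 2) := by
  classical
  set μ : Measure (Fin R) := ∑ k : Fin R, ENNReal.ofReal (p k) • Measure.dirac k with hμ
  have hprob : IsProbabilityMeasure μ := by
    refine ⟨?_⟩
    rw [hμ, Measure.finsetSum_apply]
    simp only [Measure.smul_apply, measure_univ, smul_eq_mul, mul_one]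
    rw [← ENNReal.ofReal_sum_of_nonneg fun (k : Fin R) _ => hp k, Fin.sum_univ_eq_sum_range p, h1,
      ENNReal.ofReal_one]
  have hint : ∀ f : Fin R → ℝ, ∫ k, f k ∂μ = ∑ k : Fin R, p k * f k := by
    intro f
    rw [hμ, integral_finsetSum_measure fun k _ =>
      (Integrable.of_finite (μ := Measure.dirac k)).smul_measure ENNReal.ofReal_ne_top]
    refine Finset.sum_congr rfl fun k _ => ?_
    rw [integral_smul_measure, integral_dirac, ENNReal.toReal_ofReal (hp k), smul_eq_mul]
  have hsub := ProbabilityTheory.hasSubgaussianMGF_of_mem_Icc (μ := μ) (X := fun k : Fin R => g k)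
    (a := -δ) (b := δ) (measurable_of_finite _).aemeasurable
    (ae_of_all _ fun k => abs_le.1 (hg k k.2))
  have h := hsub.mgf_le s
  rw [ProbabilityTheory.mgf, hint, hint] at h
  have hδ : (((‖δ - -δ‖₊ / 2) ^ 2 : ℝ≥0) : ℝ) = δ ^ 2 := by
    push_cast
    rw [Real.norm_eq_abs, div_pow, sq_abs]
    ring
  rw [hδ, Fin.sum_univ_eq_sum_range (fun k => p k * g k)] at h
  rw [Fin.sum_univ_eq_sum_range (fun k => p k *
    Real.exp (s * (g k - ∑ i ∈ Finset.range R, p i * g i)))] at h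
  have hfac : ∑ k ∈ Finset.range R, p k * Real.exp (s * g k) =
      Real.exp (s * ∑ k ∈ Finset.range R, p k * g k) * ∑ k ∈ Finset.range R, p k *
        Real.exp (s * (g k - ∑ i ∈ Finset.range R, p i * g i)) := by
    rw [Finset.mul_sum]
    refine Finset.sum_congr rfl fun k _ => ?_
    rw [mul_left_comm, ← Real.exp_add]
    congr 2
    ring
  rw [hfac, Real.exp_add]
  refine mul_le_mul_of_nonneg_left (h.trans_eq ?_) (Real.exp_pos _).le
  congr 1
  ring

/-- With p and q the two softmax distributions, p/q = exp(a - b)·Z where Z is the p-mean of exp(-(a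
- b)). The sum is therefore Z^(γ-1) times the p-mean of exp((γ-1)(a - b)). Hoeffding bounds both
factors; the means cancel, and (γ-1) + (γ-1)² = γ(γ-1). -/
theorem sum_softmax_rpow_le {R : ℕ} (hR : 0 < R) {a b : ℕ → ℝ} {δ : ℝ}
    (hab : ∀ k < R, |a k - b k| ≤ δ) {γ : ℝ} (hγ : 1 < γ) :
    ∑ k ∈ Finset.range R, softmax a R k ^ γ * softmax b R k ^ (1 - γ) ≤
      Real.exp (γ * (γ - 1) * (δ ^ 2 / 2)) := by
  set p := softmax a R with hp
  have hp0 : ∀ k, 0 < p k := fun k => softmax_pos a hR k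
  set Z := ∑ k ∈ Finset.range R, p k * Real.exp (-1 * (a k - b k)) with hZ
  have hZ0 : 0 < Z := Finset.sum_pos (fun k _ => mul_pos (hp0 k) (Real.exp_pos _))
    ⟨0, Finset.mem_range.2 hR⟩
  set E := ∑ k ∈ Finset.range R, p k * (a k - b k) with hE
  have hSa := softmax_denom_pos a hR
  have hZeq : Z =
      (∑ i ∈ Finset.range R, Real.exp (b i)) / ∑ i ∈ Finset.range R, Real.exp (a i) := by
    rw [hZ, Finset.sum_div]
    refine Finset.sum_congr rfl fun k _ => ?_
    rw [hp, softmax, div_mul_eq_mul_div, ← Real.exp_add]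
    congr 2
    ring
  have hterm : ∀ k, p k ^ γ * softmax b R k ^ (1 - γ) =
      Z ^ (γ - 1) * (p k * Real.exp ((γ - 1) * (a k - b k))) := by
    intro k
    have hq : softmax b R k = p k * (Real.exp (a k - b k) * Z)⁻¹ := by
      rw [hZeq, hp, softmax, softmax, Real.exp_sub]
      have := softmax_denom_pos b hR
      have := Real.exp_pos (a k)
      have := Real.exp_pos (b k)
      field_simp
    have hpos : 0 < Real.exp (a k - b k) * Z := mul_pos (Real.exp_pos _) hZ0
    rw [hq, Real.mul_rpow (hp0 k).le (inv_nonneg.2 hpos.le), ← mul_assoc,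
      ← Real.rpow_add (hp0 k), Real.inv_rpow hpos.le, ← Real.rpow_neg hpos.le,
      Real.mul_rpow (Real.exp_pos _).le hZ0.le, ← Real.exp_mul]
    have h1 : γ + (1 - γ) = 1 := by ring
    have h2 : -(1 - γ) = γ - 1 := by ring
    rw [h1, h2, Real.rpow_one, mul_comm (a k - b k)]
    ring
  simp only [hterm]
  rw [← Finset.mul_sum]
  have h1 := sum_mul_exp_le (fun k => (hp0 k).le) (sum_softmax a hR) hab (γ - 1)
  have h2 := sum_mul_exp_le (fun k => (hp0 k).le) (sum_softmax a hR) hab (-1)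
  -- Raised to the power γ - 1, the mean -E in the bound for Z cancels the mean (γ-1)E in `h1`.
  have h3 : Z ^ (γ - 1) ≤ Real.exp ((-E + δ ^ 2 / 2) * (γ - 1)) := by
    rw [Real.exp_mul]
    refine Real.rpow_le_rpow hZ0.le (h2.trans_eq ?_) (by linarith)
    congr 1
    ring
  refine (mul_le_mul h3 h1 (Finset.sum_nonneg fun k _ =>
    mul_nonneg (hp0 k).le (Real.exp_pos _).le) (Real.exp_pos _).le).trans_eq ?_
  rw [← Real.exp_add]
  congr 1
  ring

/-- The Rényi divergence of two finite mixtures of point masses is at most that of the mixing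
distributions. -/
theorem lintegral_rnDeriv_rpow_le {H Y : Type*} [MeasurableSpace Y] [MeasurableSingletonClass Y]
    {P Q : Measure Y} [IsFiniteMeasure Q] (S : Finset H) (G : H → Y) (p q : H → ℝ≥0∞)
    (hq0 : ∀ h, q h ≠ 0) (hqt : ∀ h, q h ≠ ⊤)
    (hP : P = ∑ h ∈ S, p h • Measure.dirac (G h)) (hQ : Q = ∑ h ∈ S, q h • Measure.dirac (G h))
    {γ : ℝ} (hγ : 1 < γ) :
    P ≪ Q ∧ ∫⁻ y, (P.rnDeriv Q y) ^ γ ∂Q ≤ ∑ h ∈ S, q h * (p h / q h) ^ γ := by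
  classical
  set Py : Y → ℝ≥0∞ := fun y => ∑ h ∈ S with G h = y, p h with hPy
  set Qy : Y → ℝ≥0∞ := fun y => ∑ h ∈ S with G h = y, q h with hQy
  set f : Y → ℝ≥0∞ := fun y => Py y / Qy y with hf
  have hfm : Measurable f := by
    -- Away from the finitely many atoms both masses vanish and 0/0 = 0, so the density differs from
    -- a constant only on a countable set.
    refine Measurable.measurable_of_countable_ne (measurable_const (a := (0 : ℝ≥0∞))) ?_
    refine Set.Countable.mono ?_ (S.image G).countable_toSet
    intro y hy
    by_contra hcon
    apply hy
    have : S.filter (fun h => G h = y) = ∅ := by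
      rw [Finset.filter_eq_empty_iff]
      intro h hh heq
      exact hcon (Finset.mem_coe.2 (Finset.mem_image.2 ⟨h, hh, heq⟩))
    simp [f, Py, this]
  have hQ0 : ∀ h ∈ S, Qy (G h) ≠ 0 := by
    intro h hh h0
    rw [hQy, Finset.sum_eq_zero_iff] at h0
    exact hq0 h (h0 h (Finset.mem_filter.2 ⟨hh, rfl⟩))
  have hQt : ∀ y, Qy y ≠ ⊤ := fun y => ENNReal.sum_ne_top.2 fun h _ => hqt h
  have hlint : ∀ g : Y → ℝ≥0∞, Measurable g → ∫⁻ y, g y ∂Q = ∑ h ∈ S, q h * g (G h) := by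
    intro g hg
    rw [hQ, lintegral_finsetSum_measure]
    refine Finset.sum_congr rfl fun h _ => ?_
    rw [lintegral_smul_measure, lintegral_dirac' _ hg, smul_eq_mul]
  have hfib : ∀ g : Y → ℝ≥0∞, ∀ r : H → ℝ≥0∞, ∑ h ∈ S, r h * g (G h) =
      ∑ y ∈ S.image G, (∑ h ∈ S with G h = y, r h) * g y := by
    intro g r
    rw [← Finset.sum_fiberwise_of_maps_to (fun h hh => Finset.mem_image_of_mem G hh)]
    refine Finset.sum_congr rfl fun y _ => ?_
    rw [Finset.sum_mul]
    refine Finset.sum_congr rfl fun h hh => ?_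
    rw [(Finset.mem_filter.1 hh).2]
  have hQf : ∀ y ∈ S.image G, Qy y * f y = Py y := by
    intro y hy
    obtain ⟨h, hh, rfl⟩ := Finset.mem_image.1 hy
    exact ENNReal.mul_div_cancel (hQ0 h hh) (hQt _)
  have hPQ : P = Q.withDensity f := by
    ext A hA
    rw [withDensity_apply _ hA, ← lintegral_indicator hA, hlint _ (hfm.indicator hA), hP,
      Measure.finsetSum_apply]
    have h1 : ∀ h, (p h • Measure.dirac (G h)) A = p h * A.indicator 1 (G h) := by
      intro h
      rw [Measure.smul_apply, Measure.dirac_apply' _ hA, smul_eq_mul]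
    simp only [h1]
    rw [hfib (A.indicator 1) p, hfib (A.indicator f) q]
    refine Finset.sum_congr rfl fun y hy => ?_
    by_cases hyA : y ∈ A
    · simp only [Set.indicator_of_mem hyA, Pi.one_apply, mul_one]
      exact (hQf y hy).symm
    · simp [Set.indicator_of_notMem hyA]
  refine ⟨hPQ ▸ withDensity_absolutelyContinuous Q f, ?_⟩
  have hae : ∫⁻ y, (P.rnDeriv Q y) ^ γ ∂Q = ∫⁻ y, (f y) ^ γ ∂Q := by
    refine lintegral_congr_ae ?_
    have := Measure.rnDeriv_withDensity Q hfm
    rw [← hPQ] at this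
    filter_upwards [this] with y hy
    rw [hy]
  rw [hae, hlint _ (hfm.pow_const γ), hfib (fun y => f y ^ γ) q,
    ← Finset.sum_fiberwise_of_maps_to (fun h hh => Finset.mem_image_of_mem G hh)]
  refine Finset.sum_le_sum fun y hy => ?_
  have hy0 : Qy y ≠ 0 := by
    obtain ⟨h, hh, rfl⟩ := Finset.mem_image.1 hy
    exact hQ0 h hh
  have hw1 : ∑ h ∈ S with G h = y, q h / Qy y = 1 := by
    simp only [div_eq_mul_inv]
    rw [← Finset.sum_mul]
    exact ENNReal.mul_inv_cancel hy0 (hQt y)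
  -- Several histories may give the same output. On a fiber of `G` the output density is the average
  -- of the ratios `p h / q h` with weights `q h / Qy y`, and convexity of the power γ compares the
  -- two sides.
  have hj := ENNReal.rpow_arith_mean_le_arith_mean_rpow (S.filter fun h => G h = y)
    (fun h => q h / Qy y) (fun h => p h / q h) hw1 hγ.le
  have hmean : ∑ h ∈ S with G h = y, q h / Qy y * (p h / q h) = f y := by
    simp only [hf, hPy, div_eq_mul_inv]
    rw [Finset.sum_mul]
    refine Finset.sum_congr rfl fun h _ => ?_
    calc q h * (Qy y)⁻¹ * (p h * (q h)⁻¹) = q h * (q h)⁻¹ * (p h * (Qy y)⁻¹) := by ring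
      _ = _ := by rw [ENNReal.mul_inv_cancel (hq0 h) (hqt h), one_mul]
  rw [hmean] at hj
  calc Qy y * f y ^ γ ≤ Qy y * ∑ h ∈ S with G h = y, q h / Qy y * (p h / q h) ^ γ :=
        mul_le_mul_right hj _
    _ = ∑ h ∈ S with G h = y, q h * (p h / q h) ^ γ := by
        rw [Finset.mul_sum]
        refine Finset.sum_congr rfl fun h _ => ?_
        rw [← mul_assoc, ENNReal.mul_div_cancel hy0 (hQt y)]

theorem renyiDiv_le_of_sum_le {H Y : Type*} [MeasurableSpace Y] [MeasurableSingletonClass Y]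
    {P Q : Measure Y} [IsFiniteMeasure Q] (S : Finset H) (G : H → Y) (p q : H → ℝ)
    (hp : ∀ h, 0 ≤ p h) (hq : ∀ h, 0 < q h)
    (hP : P = ∑ h ∈ S, ENNReal.ofReal (p h) • Measure.dirac (G h))
    (hQ : Q = ∑ h ∈ S, ENNReal.ofReal (q h) • Measure.dirac (G h))
    {γ ρ : ℝ} (hγ : 1 < γ)
    (hsum : ∑ h ∈ S, p h ^ γ * q h ^ (1 - γ) ≤ Real.exp (γ * (γ - 1) * ρ)) :
    renyiDiv γ P Q ≤ ((γ * ρ : ℝ) : EReal) := by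
  obtain ⟨hac, hle⟩ := lintegral_rnDeriv_rpow_le S G (fun h => ENNReal.ofReal (p h))
    (fun h => ENNReal.ofReal (q h)) (fun h => (ENNReal.ofReal_pos.2 (hq h)).ne')
    (fun h => ENNReal.ofReal_ne_top) hP hQ hγ
  have hbound : ∫⁻ y, (P.rnDeriv Q y) ^ γ ∂Q ≤ ENNReal.ofReal (Real.exp (γ * (γ - 1) * ρ)) := by
    refine hle.trans (le_trans (le_of_eq ?_) (ENNReal.ofReal_le_ofReal hsum))
    rw [ENNReal.ofReal_sum_of_nonneg fun h _ =>
      mul_nonneg (Real.rpow_nonneg (hp h) _) (Real.rpow_nonneg (hq h).le _)]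
    refine Finset.sum_congr rfl fun h _ => ?_
    rw [← ENNReal.ofReal_div_of_pos (hq h),
      ENNReal.ofReal_rpow_of_nonneg (div_nonneg (hp h) (hq h).le) (by linarith),
      ← ENNReal.ofReal_mul (hq h).le]
    congr 1
    rw [Real.div_rpow (hp h) (hq h).le, Real.rpow_sub (hq h), Real.rpow_one]
    ring
  rw [renyiDiv, if_pos hac]
  have hlog : ENNReal.log (∫⁻ y, (P.rnDeriv Q y) ^ γ ∂Q) ≤ ((γ * (γ - 1) * ρ : ℝ) : EReal) := by
    refine (ENNReal.log_monotone hbound).trans (le_of_eq ?_)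
    rw [ENNReal.log_ofReal_of_pos (Real.exp_pos _), Real.log_exp]
  have hγ1 : (0 : ℝ) < γ - 1 := by linarith
  calc _ ≤ (((γ - 1)⁻¹ : ℝ) : EReal) * ((γ * (γ - 1) * ρ : ℝ) : EReal) :=
        mul_le_mul_of_nonneg_left hlog (EReal.coe_nonneg.2 (inv_nonneg.2 hγ1.le))
    _ = ((γ * ρ : ℝ) : EReal) := by
        rw [← EReal.coe_mul]
        congr 1
        field_simp

/-! ## The expected loss of the exponential mechanism -/

/-- By Jensen for the logarithm, λ·E[M - u] ≤ log E[exp(λ(M - u))], and this expectation equals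
R·exp(λM) / Σ exp(λu). The denominator contains the term exp(λM), since `M` is attained, so the
quotient is at most R. -/
theorem sum_softmax_mul_gap_le {R : ℕ} (hR : 0 < R) {u : ℕ → ℝ} {lam M : ℝ} (hlam : 0 < lam)
    (hM : ∃ k < R, u k = M) :
    ∑ k ∈ Finset.range R, softmax (fun k => lam * u k) R k * (M - u k) ≤ Real.log R / lam := by
  set p := softmax (fun k => lam * u k) R with hp
  have hp0 : ∀ k, 0 < p k := fun k => softmax_pos _ hR k
  have hS := softmax_denom_pos (fun k => lam * u k) hR
  have hj := strictConcaveOn_log_Ioi.concaveOn.le_map_sum (t := Finset.range R) (w := p)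
    (p := fun k => Real.exp (lam * (M - u k))) (fun k _ => (hp0 k).le) (sum_softmax _ hR)
    (fun k _ => Real.exp_pos _)
  simp only [smul_eq_mul, Real.log_exp] at hj
  have hsum : ∑ k ∈ Finset.range R, p k * Real.exp (lam * (M - u k)) =
      R * Real.exp (lam * M) / ∑ i ∈ Finset.range R, Real.exp (lam * u i) := by
    have : ∀ k, p k * Real.exp (lam * (M - u k)) =
        Real.exp (lam * M) / ∑ i ∈ Finset.range R, Real.exp (lam * u i) := by
      intro k
      rw [hp, softmax, div_mul_eq_mul_div, ← Real.exp_add]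
      congr 2
      ring
    rw [Finset.sum_congr rfl fun k _ => this k, Finset.sum_const, Finset.card_range, nsmul_eq_mul]
    ring
  obtain ⟨k₀, hk₀, hk₀M⟩ := hM
  have hle : R * Real.exp (lam * M) / ∑ i ∈ Finset.range R, Real.exp (lam * u i) ≤ R := by
    rw [div_le_iff₀ hS]
    refine mul_le_mul_of_nonneg_left ?_ (Nat.cast_nonneg R)
    rw [← hk₀M]
    exact Finset.single_le_sum (f := fun i => Real.exp (lam * u i))
      (fun i _ => (Real.exp_pos _).le) (Finset.mem_range.2 hk₀)
  rw [hsum] at hj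
  have hR' : (0 : ℝ) < R := Nat.cast_pos.2 hR
  have h2 := hj.trans (Real.log_le_log (div_pos (mul_pos hR' (Real.exp_pos _)) hS) hle)
  rw [le_div_iff₀ hlam, Finset.sum_mul]
  refine le_trans (le_of_eq (Finset.sum_congr rfl fun k _ => ?_)) h2
  ring

/-! ## Programs whose output is determined by a sequence of adaptive selections -/

section Mechanism

variable {m n : ℕ} {X : Finset (Fin m → ℝ)} {e : Fin X.card ≃ X} {ρ α : ℝ} {c : Prog}
  {R T : ℕ} {W : (Fin n → X) → (ℕ → ℕ) → ℕ → ℕ → ℝ} {G : (ℕ → ℕ) → Fin m → ℝ}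

theorem answer_law_of_selections (hR : 0 < R) {D : Fin n → X} (hW : AdaptedTo (W D))
    (hans : ∀ ω, answer c e ρ α D ω = G (selections (W D) R ω T)) :
    Measurable (answer c e ρ α D) ∧
    answerLaw c e ρ α D = ∑ h ∈ paths R T,
      ENNReal.ofReal (pathWeight (selectionProb (W D) R) T h) • Measure.dirac (G h) := by
  obtain ⟨h1, h2⟩ := map_eq_sum_dirac
    (Measure.infinitePi fun _ : ℕ => (volume : Measure unitInterval))
    (fun ω => selections (W D) R ω T) G (paths R T)
    (fun ω => selections_mem_paths (W D) hR ω T) fun h hh => (measure_selections_eq hW hh).1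
  have heq : answer c e ρ α D = fun ω => G (selections (W D) R ω T) := funext hans
  refine ⟨heq ▸ h1, ?_⟩
  rw [answerLaw, heq, h2]
  exact Finset.sum_congr rfl fun h hh => by rw [(measure_selections_eq hW hh).2]

/-- The sensitivities `δ` may depend on the pair of neighbors but not on the history. The first
freedom matters for histograms, where only the two affected counts cost anything. -/
theorem isZCDP_of_selections (hR : 0 < R) (hW : ∀ D, AdaptedTo (W D))
    (hans : ∀ D ω, answer c e ρ α D ω = G (selections (W D) R ω T))
    (hpriv : ∀ D D' : Fin n → X, Neighboring D D' → ∃ δ : ℕ → ℝ,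
      (∀ h, ∀ t < T, ∀ k < R, |W D h t k - W D' h t k| ≤ δ t) ∧
      ∑ t ∈ Finset.range T, δ t ^ 2 / 2 ≤ ρ) :
    IsZCDP ρ (answerLaw c (n := n) e ρ α) := by
  intro D D' hDD' γ hγ
  obtain ⟨δ, hδ, hsum⟩ := hpriv D D' hDD'
  have hprob : IsFiniteMeasure (answerLaw c e ρ α D') := by
    rw [answerLaw]
    infer_instance
  have hpos : ∀ D h, 0 < pathWeight (selectionProb (W D) R) T h := fun D h =>
    Finset.prod_pos fun t _ => softmax_pos _ hR _
  refine renyiDiv_le_of_sum_le (paths R T) G _ _ (fun h => (hpos D h).le) (hpos D')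
    (answer_law_of_selections hR (hW D) (hans D)).2
    (answer_law_of_selections hR (hW D') (hans D')).2 hγ ?_
  set f : (ℕ → ℕ) → ℕ → ℕ → ℝ := fun h t k =>
    selectionProb (W D) R h t k ^ γ * selectionProb (W D') R h t k ^ (1 - γ) with hf
  have hfW : AdaptedTo f := by
    intro h h' t hh
    simp only [hf, (hW D).selectionProb R h h' t hh, (hW D').selectionProb R h h' t hh]
  have hf0 : ∀ h t k, 0 ≤ f h t k := fun h t k =>
    mul_nonneg (Real.rpow_nonneg (softmax_pos _ hR _).le _)
      (Real.rpow_nonneg (softmax_pos _ hR _).le _)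
  have hs0 : ∀ D h t k, 0 ≤ selectionProb (W D) R h t k := fun D h t k => (softmax_pos _ hR _).le
  -- The Rényi summand of a path factors into the summands of its steps, so the composition bound
  -- for path weights applies to it.
  have hterm : ∀ h, pathWeight (selectionProb (W D) R) T h ^ γ *
      pathWeight (selectionProb (W D') R) T h ^ (1 - γ) = pathWeight f T h := by
    intro h
    rw [pathWeight, pathWeight, ← Real.finsetProd_rpow _ _ (fun t _ => hs0 D h t (h t)),
      ← Real.finsetProd_rpow _ _ (fun t _ => hs0 D' h t (h t)), ← Finset.prod_mul_distrib]
    rfl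
  simp only [hterm]
  refine (sum_pathWeight_le hfW hf0
    (B := fun t => Real.exp (γ * (γ - 1) * (δ t ^ 2 / 2))) fun h t ht =>
      sum_softmax_rpow_le hR (hδ h t ht) hγ).trans ?_
  rw [← Real.exp_sum, ← Finset.mul_sum]
  exact Real.exp_le_exp.2 (mul_le_mul_of_nonneg_left hsum (by nlinarith))

/-- A deterministic error bound along each history becomes a bound on the expected error, provided
the conditional expectation of every one-step cost is bounded uniformly in the history. -/
theorem lintegral_error_le_of_selections (hR : 0 < R) {D : Fin n → X} (hW : AdaptedTo (W D))
    (hans : ∀ ω, answer c e ρ α D ω = G (selections (W D) R ω T)) {a : ℝ}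
    {g : (ℕ → ℕ) → ℕ → ℕ → ℝ} (hg : AdaptedTo g)
    (herr : ∀ h, (∀ t < T, h t < R) →
      ‖G h - dataMean D‖ ≤ a + ∑ t ∈ Finset.range T, g h t (h t))
    {B : ℕ → ℝ}
    (hB : ∀ h, ∀ t < T, ∑ k ∈ Finset.range R, softmax (W D h t) R k * g h t k ≤ B t) :
    ∫⁻ y, ‖y - dataMean D‖ₑ ∂(answerLaw c e ρ α D) ≤
      ENNReal.ofReal (a + ∑ t ∈ Finset.range T, B t) := by
  have hf0 : ∀ h t k, 0 ≤ selectionProb (W D) R h t k := fun h t k => (softmax_pos _ hR _).le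
  have hf1 : ∀ h t, ∑ k ∈ Finset.range R, selectionProb (W D) R h t k = 1 := fun h t =>
    sum_softmax _ hR
  rw [(answer_law_of_selections hR hW hans).2, lintegral_finsetSum_measure]
  have hm : Measurable fun y : Fin m → ℝ => ‖y - dataMean D‖ₑ := by fun_prop
  have hterm : ∀ h ∈ paths R T, ∫⁻ y, ‖y - dataMean D‖ₑ
      ∂(ENNReal.ofReal (pathWeight (selectionProb (W D) R) T h) • Measure.dirac (G h)) =
      ENNReal.ofReal (pathWeight (selectionProb (W D) R) T h * ‖G h - dataMean D‖) := by
    intro h _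
    rw [lintegral_smul_measure, lintegral_dirac' _ hm, smul_eq_mul,
      ENNReal.ofReal_mul (pathWeight_nonneg hf0 T h), ofReal_norm]
  rw [Finset.sum_congr rfl hterm, ← ENNReal.ofReal_sum_of_nonneg fun h _ =>
    mul_nonneg (pathWeight_nonneg hf0 T h) (norm_nonneg _)]
  refine ENNReal.ofReal_le_ofReal ?_
  calc _ ≤ ∑ h ∈ paths R T, pathWeight (selectionProb (W D) R) T h *
          (a + ∑ t ∈ Finset.range T, g h t (h t)) :=
        Finset.sum_le_sum fun h hh => mul_le_mul_of_nonneg_left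
          (herr h fun t ht => paths_lt hh ht) (pathWeight_nonneg hf0 T h)
    _ = a + ∑ h ∈ paths R T, pathWeight (selectionProb (W D) R) T h *
          ∑ t ∈ Finset.range T, g h t (h t) := by
        simp only [mul_add, Finset.sum_add_distrib]
        rw [← Finset.sum_mul, sum_pathWeight_eq_one (hW.selectionProb R) hf1, one_mul]
    _ ≤ _ := add_le_add_right (sum_pathWeight_mul_sum_le (hW.selectionProb R) hf0 hf1 hg hB) a

end Mechanism

/-! ## Greedy nets -/

/-- The maximum of `0` and the first `k` values of `f`. -/
noncomputable def runMax (f : ℕ → ℝ) : ℕ → ℝ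
  | 0 => 0
  | k + 1 => max (runMax f k) (f k)

theorem le_runMax (f : ℕ → ℝ) {k K : ℕ} (h : k < K) : f k ≤ runMax f K := by
  induction K with
  | zero => omega
  | succ K ih =>
    rcases Nat.lt_succ_iff_lt_or_eq.1 h with h' | rfl
    · exact (ih h').trans (le_max_left _ _)
    · exact le_max_right _ _

theorem runMax_le {f : ℕ → ℝ} {K : ℕ} {B : ℝ} (hB : 0 ≤ B) (h : ∀ k < K, f k ≤ B) :
    runMax f K ≤ B := by
  induction K with
  | zero => exact hB
  | succ K ih =>
    exact max_le (ih fun k hk => h k (hk.trans (Nat.lt_succ_self K))) (h K (Nat.lt_succ_self K))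

theorem runMax_nonneg (f : ℕ → ℝ) (K : ℕ) : 0 ≤ runMax f K := by
  induction K with
  | zero => exact le_rfl
  | succ K ih => exact ih.trans (le_max_left _ _)

/-- The distance of the rows `i` and `l` of a table with `M` columns. -/
noncomputable def rowDist (z : ℕ → ℕ → ℝ) (M i l : ℕ) : ℝ :=
  runMax (fun k => z i k - z l k) M

theorem rowDist_self (z : ℕ → ℕ → ℝ) (M i : ℕ) : rowDist z M i i = 0 :=
  le_antisymm (runMax_le le_rfl fun k _ => by simp) (runMax_nonneg _ _)

/-- The last index `l < k` that is a fixed point of `c` and is within distance `t` of `i`, and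
`i` if there is none. -/
noncomputable def scanCenters (δ : ℕ → ℕ → ℝ) (t : ℝ) (c : ℕ → ℕ) (i : ℕ) : ℕ → ℕ
  | 0 => i
  | l + 1 => open scoped Classical in if c l = l ∧ δ i l ≤ t then l else scanCenters δ t c i l

/-- The first `i` values of the map to the centers of a greedy net of scale `t`. -/
noncomputable def netPrefix (δ : ℕ → ℕ → ℝ) (t : ℝ) : ℕ → ℕ → ℕ
  | 0 => fun i => i
  | i + 1 => Function.update (netPrefix δ t i) i (scanCenters δ t (netPrefix δ t i) i i)

/-- The map to the centers of a greedy net of scale `t`. -/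
noncomputable def netMap (δ : ℕ → ℕ → ℝ) (t : ℝ) (i : ℕ) : ℕ := netPrefix δ t (i + 1) i

theorem scanCenters_congr {δ : ℕ → ℕ → ℝ} {t : ℝ} {c c' : ℕ → ℕ} {i k : ℕ}
    (h : ∀ l < k, c l = c' l) : scanCenters δ t c i k = scanCenters δ t c' i k := by
  induction k with
  | zero => rfl
  | succ k ih =>
    rw [scanCenters, scanCenters, h k (Nat.lt_succ_self k),
      ih fun l hl => h l (hl.trans (Nat.lt_succ_self k))]

theorem netPrefix_apply_of_lt (δ : ℕ → ℕ → ℝ) (t : ℝ) {k i : ℕ} (h : i < k) :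
    netPrefix δ t k i = netMap δ t i := by
  induction k with
  | zero => omega
  | succ k ih =>
    rcases Nat.lt_succ_iff_lt_or_eq.1 h with h' | rfl
    · rw [netPrefix, Function.update_of_ne h'.ne, ih h']
    · rfl

theorem netMap_eq (δ : ℕ → ℕ → ℝ) (t : ℝ) (i : ℕ) :
    netMap δ t i = scanCenters δ t (netMap δ t) i i := by
  rw [netMap, netPrefix, Function.update_self]
  exact scanCenters_congr fun l hl => netPrefix_apply_of_lt δ t hl

theorem scanCenters_spec (δ : ℕ → ℕ → ℝ) (t : ℝ) (c : ℕ → ℕ) (i k : ℕ) :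
    (scanCenters δ t c i k = i ∧ ∀ l < k, c l = l → t < δ i l) ∨
    (scanCenters δ t c i k < k ∧ c (scanCenters δ t c i k) = scanCenters δ t c i k ∧
      δ i (scanCenters δ t c i k) ≤ t) := by
  induction k with
  | zero => exact Or.inl ⟨rfl, by omega⟩
  | succ k ih =>
    rw [scanCenters]
    split_ifs with h
    · exact Or.inr ⟨Nat.lt_succ_self k, h⟩
    · rcases ih with ⟨h1, h2⟩ | ⟨h1, h2⟩
      · refine Or.inl ⟨h1, fun l hl hc => ?_⟩
        rcases Nat.lt_succ_iff_lt_or_eq.1 hl with h' | rfl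
        · exact h2 l h' hc
        · exact not_le.1 fun hle => h ⟨hc, hle⟩
      · exact Or.inr ⟨h1.trans (Nat.lt_succ_self k), h2⟩

section Net

variable {δ : ℕ → ℕ → ℝ} {t : ℝ}

/-- The greedy dichotomy: an index either opens a new center, being farther than `t` from all
earlier centers, or joins an earlier center within distance `t`. -/
theorem netMap_spec (δ : ℕ → ℕ → ℝ) (t : ℝ) (i : ℕ) :
    (netMap δ t i = i ∧ ∀ l < i, netMap δ t l = l → t < δ i l) ∨
    (netMap δ t i < i ∧ netMap δ t (netMap δ t i) = netMap δ t i ∧ δ i (netMap δ t i) ≤ t) := by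
  have h := scanCenters_spec δ t (netMap δ t) i i
  rwa [← netMap_eq] at h

theorem netMap_le (δ : ℕ → ℕ → ℝ) (t : ℝ) (i : ℕ) : netMap δ t i ≤ i := by
  rcases netMap_spec δ t i with h | h
  · exact h.1.le
  · exact h.1.le

theorem netMap_idem (δ : ℕ → ℕ → ℝ) (t : ℝ) (i : ℕ) :
    netMap δ t (netMap δ t i) = netMap δ t i := by
  rcases netMap_spec δ t i with h | h
  · rw [h.1, h.1]
  · exact h.2.1

theorem dist_netMap_le (hδ : ∀ i, δ i i ≤ t) (i : ℕ) : δ i (netMap δ t i) ≤ t := by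
  rcases netMap_spec δ t i with h | h
  · rw [h.1]
    exact hδ i
  · exact h.2.2

theorem lt_dist_of_centers {i l : ℕ} (hi : netMap δ t i = i) (hl : netMap δ t l = l)
    (h : l < i) : t < δ i l := by
  rcases netMap_spec δ t i with h' | h'
  · exact h'.2 l h hl
  · omega

theorem netMap_zero (δ : ℕ → ℕ → ℝ) (t : ℝ) : netMap δ t 0 = 0 :=
  Nat.le_zero.1 (netMap_le δ t 0)

/-- Index 0 is always a center, and another one would have to be farther than `t` from it. This is
how the chain of nets ends in a single point. -/
theorem netMap_eq_zero {N : ℕ} (h : ∀ i < N, δ i 0 ≤ t) {i : ℕ} (hi : i < N) :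
    netMap δ t i = 0 := by
  by_contra hne
  have h1 := lt_dist_of_centers (netMap_idem δ t i) (netMap_zero δ t) (Nat.pos_of_ne_zero hne)
  exact absurd (h _ ((netMap_le δ t i).trans_lt hi)) (not_le.2 h1)

end Net

/-! ## Multiplicative weights -/

/-- The sum of the weights of multiplicative-weights update with prior `b` and gains `g`. -/
noncomputable def mwTotal (N : ℕ) (b : ℕ → ℝ) (η : ℝ) (g : ℕ → ℝ) : ℝ :=
  ∑ i ∈ Finset.range N, b i * Real.exp (η * g i)

/-- The mean of column `k` of `V` under the distribution of multiplicative-weights update. -/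
noncomputable def mwMean (N : ℕ) (b : ℕ → ℝ) (V : ℕ → ℕ → ℝ) (η : ℝ) (g : ℕ → ℝ) (k : ℕ) : ℝ :=
  (∑ i ∈ Finset.range N, b i * Real.exp (η * g i) * V i k) / mwTotal N b η g

/-- The total of the first `s` columns chosen by `h`, row by row. -/
noncomputable def gain (V : ℕ → ℕ → ℝ) (h : ℕ → ℕ) (s i : ℕ) : ℝ :=
  ∑ s' ∈ Finset.range s, V i (h s')

theorem mwTotal_pos {N : ℕ} {b : ℕ → ℝ} (hb : ∀ i, 0 ≤ b i) (hb0 : 0 < b 0) (hN : 0 < N) (η : ℝ)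
    (g : ℕ → ℝ) : 0 < mwTotal N b η g :=
  Finset.sum_pos' (fun i _ => mul_nonneg (hb i) (Real.exp_pos _).le)
    ⟨0, Finset.mem_range.2 hN, mul_pos hb0 (Real.exp_pos _)⟩

/-- Each round multiplies the total weight by the mean of exp(ηV) under the current distribution,
and Hoeffding bounds the logarithm of this factor by η times the mean plus η²B²/2. -/
theorem log_mwTotal_gain_le {N : ℕ} {b : ℕ → ℝ} (hb : ∀ i, 0 ≤ b i) (hb0 : 0 < b 0) (hN : 0 < N)
    {V : ℕ → ℕ → ℝ} {B : ℝ} {η : ℝ} {h : ℕ → ℕ} {T : ℕ}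
    (hV : ∀ s < T, ∀ i < N, |V i (h s)| ≤ B) :
    Real.log (mwTotal N b η (gain V h T)) ≤ Real.log (∑ i ∈ Finset.range N, b i) +
      ∑ s ∈ Finset.range T, (η * mwMean N b V η (gain V h s) (h s) + η ^ 2 * B ^ 2 / 2) := by
  induction T with
  | zero => simp [mwTotal, gain]
  | succ T ih =>
    have hZ := mwTotal_pos hb hb0 hN η (gain V h T)
    have hZ' := mwTotal_pos hb hb0 hN η (gain V h (T + 1))
    rw [Finset.sum_range_succ, ← add_assoc]
    refine le_trans ?_ (add_le_add_left (ih fun s hs => hV s (hs.trans (Nat.lt_succ_self T))) _)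
    set p : ℕ → ℝ := fun i => b i * Real.exp (η * gain V h T i) / mwTotal N b η (gain V h T)
      with hp
    have hp1 : ∑ i ∈ Finset.range N, p i = 1 := by
      rw [hp, ← Finset.sum_div]
      exact div_self hZ.ne'
    have hh := sum_mul_exp_le (p := p) (g := fun i => V i (h T)) (R := N)
      (fun i => div_nonneg (mul_nonneg (hb i) (Real.exp_pos _).le) hZ.le) hp1
      (hV T (Nat.lt_succ_self T)) η
    have hmean : ∑ i ∈ Finset.range N, p i * V i (h T) =
        mwMean N b V η (gain V h T) (h T) := by
      rw [mwMean, Finset.sum_div]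
      exact Finset.sum_congr rfl fun i _ => by rw [hp]; ring
    have hsum : ∑ i ∈ Finset.range N, p i * Real.exp (η * V i (h T)) =
        mwTotal N b η (gain V h (T + 1)) / mwTotal N b η (gain V h T) := by
      rw [mwTotal.eq_def N b η (gain V h (T + 1)), Finset.sum_div]
      refine Finset.sum_congr rfl fun i _ => ?_
      rw [hp, gain.eq_def V h (T + 1), Finset.sum_range_succ, ← gain, mul_add, Real.exp_add]
      ring
    rw [hmean, hsum] at hh
    have hl := Real.log_le_log (div_pos hZ' hZ) hh
    rw [Real.log_exp, Real.log_div hZ'.ne' hZ.ne'] at hl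
    linarith

/-- The regret bound of multiplicative-weights update against an average of rows. -/
theorem mw_regret {N : ℕ} {b : ℕ → ℝ} (hb : ∀ i, 0 ≤ b i) (hb0 : 0 < b 0) (hN : 0 < N)
    {V : ℕ → ℕ → ℝ} {B : ℝ} {η : ℝ} (hη : 0 < η) {h : ℕ → ℕ} {T : ℕ}
    (hV : ∀ s < T, ∀ i < N, |V i (h s)| ≤ B) {n : ℕ} (hn : 0 < n) {a : ℕ → ℕ}
    (ha : ∀ d < n, a d < N ∧ b (a d) = 1) :
    ∑ s ∈ Finset.range T, ((∑ d ∈ Finset.range n, V (a d) (h s)) / n -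
        mwMean N b V η (gain V h s) (h s)) ≤
      Real.log (∑ i ∈ Finset.range N, b i) / η + T * (η * B ^ 2 / 2) := by
  have hlog := log_mwTotal_gain_le (η := η) hb hb0 hN hV
  -- The prior is not normalized: each comparison row has weight 1, so its own exponential is one
  -- term of the total, and the initial total contributes the logarithm of the sum of the prior.
  -- Averaging over `d` gives the comparison with the mean of the rows.
  have hone : ∀ d ∈ Finset.range n, η * gain V h T (a d) ≤
      Real.log (∑ i ∈ Finset.range N, b i) +
      ∑ s ∈ Finset.range T, (η * mwMean N b V η (gain V h s) (h s) + η ^ 2 * B ^ 2 / 2) := by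
    intro d hd
    obtain ⟨h1, h2⟩ := ha d (Finset.mem_range.1 hd)
    refine le_trans ?_ hlog
    rw [Real.le_log_iff_exp_le (mwTotal_pos hb hb0 hN _ _), mwTotal]
    have := Finset.single_le_sum (f := fun i => b i * Real.exp (η * gain V h T i))
      (fun i _ => mul_nonneg (hb i) (Real.exp_pos _).le) (Finset.mem_range.2 h1)
    simpa [h2] using this
  have hsum := Finset.sum_le_sum hone
  rw [Finset.sum_const, Finset.card_range, nsmul_eq_mul, ← Finset.mul_sum] at hsum
  have hn' : (0 : ℝ) < n := Nat.cast_pos.2 hn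
  have hswap : ∑ d ∈ Finset.range n, gain V h T (a d) =
      ∑ s ∈ Finset.range T, ∑ d ∈ Finset.range n, V (a d) (h s) := Finset.sum_comm
  rw [Finset.sum_add_distrib, ← Finset.mul_sum, Finset.sum_const, Finset.card_range,
    nsmul_eq_mul, hswap] at hsum
  rw [Finset.sum_sub_distrib, ← Finset.sum_div]
  set S := ∑ s ∈ Finset.range T, ∑ d ∈ Finset.range n, V (a d) (h s)
  set Y := ∑ s ∈ Finset.range T, mwMean N b V η (gain V h s) (h s)
  set F := Real.log (∑ i ∈ Finset.range N, b i)
  have h1 : η * (S / n) ≤ F + (η * Y + T * (η ^ 2 * B ^ 2 / 2)) := by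
    rw [← mul_div_assoc, div_le_iff₀ hn']
    linarith
  have h2 : F / η * η = F := div_mul_cancel₀ F hη.ne'
  refine le_of_mul_le_mul_right ?_ hη
  nlinarith [h1, h2]

/-! ## Chaining -/

/-- An instance of the mean point problem: `N` points with `M` coordinates, the number of records,
the target error and the privacy parameter. -/
structure Chain where
  N : ℕ
  M : ℕ
  n : ℕ
  z : ℕ → ℕ → ℝ
  α : ℝ
  ρ : ℝ

namespace Chain

variable (P : Chain)

/-- The largest distance from point `0`. -/
noncomputable def radius : ℝ := runMax (fun i => rowDist P.z P.M i 0) P.N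

/-- The scale of level `l`. -/
noncomputable def scale (l : ℕ) : ℝ := P.α / 2 * 2 ^ l

/-- The map to the centers of the net of level `l`. -/
noncomputable def center (l : ℕ) : ℕ → ℕ := netMap (rowDist P.z P.M) (P.scale l)

/-- The indicator of the centers of level `l`. -/
noncomputable def isCenter (l i : ℕ) : ℝ :=
  open scoped Classical in if P.center l i = i then 1 else 0

/-- The number of centers of level `l`. -/
noncomputable def numCenters (l : ℕ) : ℝ := ∑ i ∈ Finset.range P.N, P.isCenter l i

/-- The displacement of point `i` when it is rounded to level `l + 1`. -/
noncomputable def disp (l i k : ℕ) : ℝ := P.z i k - P.z (P.center (l + 1) i) k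

/-- An upper bound on the number of levels. -/
noncomputable def depth : ℝ := 2 + 2 * Real.log (2 * P.radius / P.α)

/-- The number of rounds of level `l` before rounding up. -/
noncomputable def roundsBound (l : ℕ) : ℝ :=
  64 * (P.depth * P.depth) * (P.scale (l + 1) * P.scale (l + 1)) * Real.log (P.numCenters l) /
    (P.α * P.α)

/-- The number of rounds of level `l`. -/
noncomputable def rounds (l : ℕ) : ℕ := ⌈P.roundsBound l⌉₊

/-- The learning rate of level `l`. -/
noncomputable def rate (l : ℕ) : ℝ := P.α / (8 * P.depth * (P.scale (l + 1) * P.scale (l + 1)))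

/-- The inverse temperature of the selections of level `l`. -/
noncomputable def invTemp (l : ℕ) : ℝ :=
  P.n * √(P.ρ / (P.depth * P.roundsBound l)) / (2 * P.scale (l + 1))

/-- The successive rounding of the points up to level `l`. -/
noncomputable def rounding : ℕ → ℕ → ℕ
  | 0 => P.center 0
  | l + 1 => fun i => P.center (l + 1) (rounding l i)

/-- The average displacement of the records at level `l`. -/
noncomputable def avgDisp (u : ℕ → ℕ) (l k : ℕ) : ℝ :=
  (∑ d ∈ Finset.range P.n, P.disp l (P.rounding l (u d)) k) / P.n

/-- The number of rounds before level `l`. -/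
noncomputable def offset (l : ℕ) : ℕ := ∑ l' ∈ Finset.range l, P.rounds l'

/-- The level of round number `τ`. -/
noncomputable def levelOf (τ : ℕ) : ℕ := sInf {l | τ < P.offset (l + 1)}

/-- The estimate of the average displacement in round `s` of level `l`. -/
noncomputable def estimate (h : ℕ → ℕ) (l s k : ℕ) : ℝ :=
  mwMean P.N (P.isCenter l) (P.disp l) (P.rate l)
    (gain (P.disp l) (fun s' => h (P.offset l + s')) s) k

/-- The logits of the selections. -/
noncomputable def logit (u : ℕ → ℕ) (h : ℕ → ℕ) (τ k : ℕ) : ℝ :=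
  P.invTemp (P.levelOf τ) * (P.avgDisp u (P.levelOf τ) k -
    P.estimate h (P.levelOf τ) (τ - P.offset (P.levelOf τ)) k)

/-- The estimate of the mean after `L` levels. -/
noncomputable def output (L : ℕ) (h : ℕ → ℕ) (k : ℕ) : ℝ :=
  P.z 0 k + ∑ l ∈ Finset.range L, (∑ s ∈ Finset.range (P.rounds l), P.estimate h l s k) / P.rounds l

/-- The number of levels. -/
noncomputable def levels : ℕ := sInf {l | P.radius ≤ P.scale l}

/-! ### Indexing of the rounds -/

theorem offset_succ (l : ℕ) : P.offset (l + 1) = P.offset l + P.rounds l :=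
  Finset.sum_range_succ _ _

theorem offset_mono : Monotone P.offset :=
  monotone_nat_of_le_succ fun l => by rw [offset_succ]; exact Nat.le_add_right _ _

/-- Offsets are monotone, so no earlier level ends after this round. -/
theorem levelOf_offset_add {l s : ℕ} (hs : s < P.rounds l) : P.levelOf (P.offset l + s) = l := by
  have hmem : l ∈ {l' | P.offset l + s < P.offset (l' + 1)} := by
    change P.offset l + s < P.offset (l + 1)
    rw [offset_succ]
    omega
  refine le_antisymm (Nat.sInf_le hmem) (not_lt.1 fun hlt => ?_)
  have h1 : P.offset l + s < P.offset (P.levelOf (P.offset l + s) + 1) := Nat.sInf_mem ⟨l, hmem⟩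
  have h2 := P.offset_mono (Nat.succ_le_of_lt hlt)
  rw [Nat.succ_eq_add_one] at h2
  omega

theorem exists_eq_offset_add {L τ : ℕ} (h : τ < P.offset L) :
    ∃ l < L, ∃ s < P.rounds l, τ = P.offset l + s := by
  induction L with
  | zero => simp [offset] at h
  | succ L ih =>
    rcases lt_or_ge τ (P.offset L) with h' | h'
    · obtain ⟨l, hl, h2⟩ := ih h'
      exact ⟨l, hl.trans (Nat.lt_succ_self L), h2⟩
    · rw [offset_succ] at h
      exact ⟨L, Nat.lt_succ_self L, τ - P.offset L, by omega, by omega⟩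

theorem sum_offset {A : Type*} [AddCommMonoid A] (f : ℕ → A) (L : ℕ) :
    ∑ τ ∈ Finset.range (P.offset L), f τ =
      ∑ l ∈ Finset.range L, ∑ s ∈ Finset.range (P.rounds l), f (P.offset l + s) := by
  induction L with
  | zero => simp [offset]
  | succ L ih => rw [offset_succ, Finset.sum_range_add, ih, Finset.sum_range_succ]

theorem estimate_congr {h h' : ℕ → ℕ} {l s : ℕ}
    (hh : ∀ i < s, h (P.offset l + i) = h' (P.offset l + i)) (k : ℕ) :
    P.estimate h l s k = P.estimate h' l s k := by
  have : gain (P.disp l) (fun s' => h (P.offset l + s')) s =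
      gain (P.disp l) (fun s' => h' (P.offset l + s')) s := by
    ext i
    refine Finset.sum_congr rfl fun s' hs' => ?_
    simp only [hh s' (Finset.mem_range.1 hs')]
  rw [estimate, estimate, this]

/-- The estimate in a round uses only the earlier selections of the same level. -/
theorem logit_adapted (u : ℕ → ℕ) : AdaptedTo (P.logit u) := by
  intro h h' τ hh
  ext k
  rw [logit, logit, P.estimate_congr (h := h) (h' := h')]
  intro i hi
  exact hh _ (by omega)

theorem output_congr {L : ℕ} {h h' : ℕ → ℕ} (hh : ∀ i < P.offset L, h i = h' i) (k : ℕ) :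
    P.output L h k = P.output L h' k := by
  rw [output, output]
  congr 1
  refine Finset.sum_congr rfl fun l hl => ?_
  congr 1
  refine Finset.sum_congr rfl fun s hs => P.estimate_congr (fun i hi => hh _ ?_) k
  have h1 := P.offset_mono (Nat.succ_le_of_lt (Finset.mem_range.1 hl))
  rw [Nat.succ_eq_add_one, offset_succ] at h1
  have := Finset.mem_range.1 hs
  omega

/-! ### Parameters of a level -/

/-- The points are given with their negatives, and the parameters are positive. -/
structure Valid : Prop where
  N_pos : 0 < P.N
  M_pos : 0 < P.M
  n_pos : 0 < P.n
  α_pos : 0 < P.α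
  ρ_pos : 0 < P.ρ
  neg : ∀ k < P.M, ∃ k' < P.M, ∀ i, P.z i k' = -P.z i k

variable {P}

theorem Valid.scale_pos (hP : P.Valid) (l : ℕ) : 0 < P.scale l := by
  have := hP.α_pos
  rw [scale]
  positivity

theorem scale_succ (P : Chain) (l : ℕ) : P.scale (l + 1) = 2 * P.scale l := by
  rw [scale, scale, pow_succ]
  ring

theorem Valid.scale_ge (hP : P.Valid) (l : ℕ) : P.α / 2 ≤ P.scale l :=
  le_mul_of_one_le_right (half_pos hP.α_pos).le (one_le_pow₀ one_le_two)

theorem Valid.radius_le_scale_levels (hP : P.Valid) : P.radius ≤ P.scale P.levels := by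
  refine Nat.sInf_mem (s := {l | P.radius ≤ P.scale l}) ?_
  obtain ⟨l, hl⟩ := pow_unbounded_of_one_lt (P.radius / (P.α / 2)) one_lt_two
  refine ⟨l, ?_⟩
  have := (div_lt_iff₀ (half_pos hP.α_pos)).1 hl
  change P.radius ≤ P.α / 2 * 2 ^ l
  linarith

theorem scale_lt_radius {l : ℕ} (hl : l < P.levels) : P.scale l < P.radius :=
  not_le.1 fun h => Nat.notMem_of_lt_sInf hl h

/-- The right-hand side is the test of the outer loop of the chaining program. -/
theorem Valid.lt_levels_iff (hP : P.Valid) (l : ℕ) : l < P.levels ↔ P.scale l < P.radius := by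
  refine ⟨scale_lt_radius, fun h => not_le.1 fun hle => ?_⟩
  have h1 : P.scale P.levels ≤ P.scale l :=
    mul_le_mul_of_nonneg_left (pow_le_pow_right₀ one_le_two hle) (half_pos hP.α_pos).le
  linarith [hP.radius_le_scale_levels]

theorem center_zero (P : Chain) (l : ℕ) : P.center l 0 = 0 := netMap_zero _ _

theorem center_le (P : Chain) (l i : ℕ) : P.center l i ≤ i := netMap_le _ _ _

theorem isCenter_nonneg (P : Chain) (l i : ℕ) : 0 ≤ P.isCenter l i := by
  rw [isCenter]
  split_ifs <;> norm_num

theorem isCenter_zero (P : Chain) (l : ℕ) : P.isCenter l 0 = 1 := by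
  rw [isCenter, if_pos (P.center_zero l)]

theorem isCenter_center (P : Chain) (l i : ℕ) : P.isCenter l (P.center l i) = 1 :=
  if_pos (netMap_idem _ _ _)

theorem Valid.dist_center_le (hP : P.Valid) (l i : ℕ) :
    rowDist P.z P.M i (P.center l i) ≤ P.scale l :=
  dist_netMap_le (fun i => by rw [rowDist_self]; exact (hP.scale_pos l).le) i

/-- `rowDist` takes a maximum of one-sided differences; since every column occurs together with its
negative, absolute values are controlled too. -/
theorem Valid.abs_sub_le_rowDist (hP : P.Valid) (i l : ℕ) {k : ℕ} (hk : k < P.M) :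
    |P.z i k - P.z l k| ≤ rowDist P.z P.M i l := by
  rw [abs_le]
  obtain ⟨k', hk', hneg⟩ := hP.neg k hk
  have h1 := le_runMax (fun k => P.z i k - P.z l k) hk
  have h2 := le_runMax (fun k => P.z i k - P.z l k) hk'
  simp only [hneg] at h2
  exact ⟨by rw [rowDist]; linarith, h1⟩

theorem Valid.abs_disp_le (hP : P.Valid) (l i : ℕ) {k : ℕ} (hk : k < P.M) :
    |P.disp l i k| ≤ P.scale (l + 1) :=
  (hP.abs_sub_le_rowDist i _ hk).trans (hP.dist_center_le (l + 1) i)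

/-- If point 0 were the only center, all points would lie within `P.scale l` of it and the radius
would not exceed this scale. The bound keeps the logarithm of the number of centers away from zero.
-/
theorem Valid.two_le_numCenters (hP : P.Valid) {l : ℕ} (hl : l < P.levels) :
    2 ≤ P.numCenters l := by
  by_contra hlt
  have hall : ∀ i < P.N, P.center l i = 0 := by
    intro i hi
    by_contra hne
    apply hlt
    have hsub : {0, P.center l i} ⊆ Finset.range P.N := by
      intro x hx
      simp only [Finset.mem_insert, Finset.mem_singleton] at hx
      rw [Finset.mem_range]
      rcases hx with rfl | rfl
      · exact hP.N_pos
      · exact (P.center_le l i).trans_lt hi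
    have h1 := Finset.sum_le_sum_of_subset_of_nonneg hsub
      fun i _ _ => P.isCenter_nonneg l i
    rw [Finset.sum_pair (Ne.symm hne), isCenter_zero, isCenter_center] at h1
    rw [numCenters]
    linarith
  have hr : P.radius ≤ P.scale l := by
    refine runMax_le (hP.scale_pos l).le fun i hi => ?_
    have := hP.dist_center_le l i
    rwa [hall i hi] at this
  exact absurd (scale_lt_radius hl) (not_lt.2 hr)

theorem Valid.half_le_log_numCenters (hP : P.Valid) {l : ℕ} (hl : l < P.levels) :
    1 / 2 ≤ Real.log (P.numCenters l) := by
  have h1 := Real.log_le_log two_pos (hP.two_le_numCenters hl)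
  linarith [Real.log_two_gt_d9]

/-- From 2^l ≤ 2·radius/α, by taking logarithms and using 2·log 2 > 1. `depth` replaces the number
of levels in all parameters because a single logarithm computes it before the first level starts. -/
theorem Valid.levels_le_depth (hP : P.Valid) {l : ℕ} (hl : l < P.levels) :
    (l : ℝ) + 1 ≤ P.depth := by
  have hα := hP.α_pos
  have h1 := scale_lt_radius hl
  have h2 : (2 : ℝ) ^ l ≤ 2 * P.radius / P.α := by
    rw [le_div_iff₀ hα]
    rw [scale] at h1
    linarith
  have h3 := Real.log_le_log (by positivity) h2
  rw [Real.log_pow] at h3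
  rw [depth]
  nlinarith [Real.log_two_gt_d9, (Nat.cast_nonneg l : (0 : ℝ) ≤ l)]

theorem Valid.two_le_depth (hP : P.Valid) {l : ℕ} (hl : l < P.levels) : 2 ≤ P.depth := by
  have hα := hP.α_pos
  have h1 := scale_lt_radius (P := P) hl
  have h2 := hP.scale_ge l
  have h3 : 0 ≤ Real.log (2 * P.radius / P.α) := by
    refine Real.log_nonneg ?_
    rw [le_div_iff₀ hα]
    linarith
  rw [depth]
  linarith

theorem Valid.levels_cast_le_depth (hP : P.Valid) (h : 0 < P.levels) :
    (P.levels : ℝ) ≤ P.depth := by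
  have h1 := hP.levels_le_depth (l := P.levels - 1) (by omega)
  rwa [Nat.cast_sub h, Nat.cast_one, sub_add_cancel] at h1

theorem Valid.levels_mul_le (hP : P.Valid) : P.levels * (P.α / (4 * P.depth)) ≤ P.α / 4 := by
  rcases Nat.eq_zero_or_pos P.levels with h0 | h0
  · rw [h0, Nat.cast_zero, zero_mul]
    exact (div_pos hP.α_pos four_pos).le
  · have hd : 0 < P.depth := two_pos.trans_le (hP.two_le_depth h0)
    have := hP.levels_cast_le_depth h0
    rw [← mul_div_assoc, div_le_div_iff₀ (by positivity) four_pos]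
    nlinarith [hP.α_pos]

theorem Valid.alpha_le_scale_succ (hP : P.Valid) (l : ℕ) : P.α ≤ P.scale (l + 1) := by
  rw [scale_succ]
  linarith [hP.scale_ge l]

theorem Valid.one_le_roundsBound (hP : P.Valid) {l : ℕ} (hl : l < P.levels) :
    1 ≤ P.roundsBound l := by
  have hα := hP.α_pos
  have h1 := hP.two_le_depth hl
  have h2 := hP.half_le_log_numCenters hl
  have h3 := hP.alpha_le_scale_succ l
  rw [roundsBound, le_div_iff₀ (mul_pos hα hα), one_mul]
  have h4 : P.α * P.α ≤ P.scale (l + 1) * P.scale (l + 1) := mul_self_le_mul_self hα.le h3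
  have h5 : 4 ≤ P.depth * P.depth := by nlinarith
  have h6 : 0 < P.scale (l + 1) * P.scale (l + 1) := mul_pos (hP.scale_pos _) (hP.scale_pos _)
  calc P.α * P.α ≤ 1 * (P.scale (l + 1) * P.scale (l + 1)) := by linarith
    _ ≤ (64 * 4) * (P.scale (l + 1) * P.scale (l + 1)) * (1 / 2) := by linarith
    _ ≤ _ := by gcongr

/-- Rounding up at most doubles a number that is at least 1. The lower bound serves accuracy, the
upper bound privacy. -/
theorem Valid.rounds_bounds (hP : P.Valid) {l : ℕ} (hl : l < P.levels) :
    P.roundsBound l ≤ P.rounds l ∧ (P.rounds l : ℝ) ≤ 2 * P.roundsBound l := by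
  have h1 := hP.one_le_roundsBound hl
  refine ⟨Nat.le_ceil _, ?_⟩
  have := (Nat.ceil_lt_add_one (zero_le_one.trans h1)).le
  rw [rounds]
  linarith

/-! ### Privacy -/

/-- A round of level `l` costs ρ/(2·depth·`roundsBound l`), and there are at most 2·`roundsBound l`
of them, so a level costs at most ρ/depth; the number of levels is at most the depth. -/
theorem Valid.sum_sq_le (hP : P.Valid) :
    ∑ τ ∈ Finset.range (P.offset P.levels),
      √(P.ρ / (P.depth * P.roundsBound (P.levelOf τ))) ^ 2 / 2 ≤ P.ρ := by
  rw [P.sum_offset]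
  rcases Nat.eq_zero_or_pos P.levels with h0 | h0
  · simp [h0, hP.ρ_pos.le]
  have hd : 0 < P.depth := two_pos.trans_le (hP.two_le_depth h0)
  calc _ ≤ ∑ l ∈ Finset.range P.levels, P.ρ / P.depth := by
        refine Finset.sum_le_sum fun l hl => ?_
        have hl' := Finset.mem_range.1 hl
        have hA := zero_lt_one.trans_le (hP.one_le_roundsBound hl')
        have hterm : ∀ s ∈ Finset.range (P.rounds l),
            √(P.ρ / (P.depth * P.roundsBound (P.levelOf (P.offset l + s)))) ^ 2 / 2 =
            P.ρ / P.depth / (2 * P.roundsBound l) := by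
          intro s hs
          rw [P.levelOf_offset_add (Finset.mem_range.1 hs), Real.sq_sqrt
            (div_nonneg hP.ρ_pos.le (mul_pos hd hA).le)]
          field_simp
        rw [Finset.sum_congr rfl hterm, Finset.sum_const, Finset.card_range, nsmul_eq_mul,
          ← mul_div_assoc, div_le_iff₀ (by positivity), mul_comm]
        exact mul_le_mul_of_nonneg_left (hP.rounds_bounds hl').2 (div_pos hP.ρ_pos hd).le
    _ = P.levels * (P.ρ / P.depth) := by
        rw [Finset.sum_const, Finset.card_range, nsmul_eq_mul]
    _ ≤ P.depth * (P.ρ / P.depth) :=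
        mul_le_mul_of_nonneg_right (hP.levels_cast_le_depth h0) (div_pos hP.ρ_pos hd).le
    _ = P.ρ := mul_div_cancel₀ _ hd.ne'

/-- For a fixed history the estimate does not involve the data and cancels. Replacing one record
moves an average displacement by at most 2·`scale (l + 1)`/n, which the definition of `invTemp`
normalizes. -/
theorem Valid.abs_logit_sub_le (hP : P.Valid) {u u' : ℕ → ℕ}
    (huu' : ∃ i i', ∀ φ : ℕ → ℝ, ∑ d ∈ Finset.range P.n, φ (u d) -
      ∑ d ∈ Finset.range P.n, φ (u' d) = φ i - φ i') (h : ℕ → ℕ)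
    (τ : ℕ) {k : ℕ} (hk : k < P.M) :
    |P.logit u h τ k - P.logit u' h τ k| ≤
      √(P.ρ / (P.depth * P.roundsBound (P.levelOf τ))) := by
  set l := P.levelOf τ with hl
  have hn : (0 : ℝ) < P.n := Nat.cast_pos.2 hP.n_pos
  have hs := hP.scale_pos (l + 1)
  obtain ⟨i, i', hii'⟩ := huu'
  replace hii' := hii' fun i => P.disp l (P.rounding l i) k
  have hq : |P.avgDisp u l k - P.avgDisp u' l k| ≤ 2 * P.scale (l + 1) / P.n := by
    rw [avgDisp, avgDisp, ← sub_div, hii', abs_div, Nat.abs_cast]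
    refine div_le_div_of_nonneg_right ?_ hn.le
    refine (abs_sub _ _).trans ?_
    linarith [hP.abs_disp_le l (P.rounding l i) hk, hP.abs_disp_le l (P.rounding l i') hk]
  have heq : P.logit u h τ k - P.logit u' h τ k =
      P.invTemp l * (P.avgDisp u l k - P.avgDisp u' l k) := by
    rw [logit, logit, ← hl]
    ring
  have hinv : 0 ≤ P.invTemp l := by
    rw [invTemp]
    positivity
  rw [heq, abs_mul, abs_of_nonneg hinv]
  refine (mul_le_mul_of_nonneg_left hq hinv).trans_eq ?_
  rw [invTemp]
  field_simp

/-! ### Accuracy -/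

/-- The largest coordinate of the error in round `s` of level `l`. -/
noncomputable def maxErr (P : Chain) (u h : ℕ → ℕ) (l s : ℕ) : ℝ :=
  sSup ((fun k => P.avgDisp u l k - P.estimate h l s k) '' Set.Iio P.M)

theorem le_maxErr (P : Chain) (u h : ℕ → ℕ) (l s : ℕ) {k : ℕ} (hk : k < P.M) :
    P.avgDisp u l k - P.estimate h l s k ≤ P.maxErr u h l s :=
  le_csSup ((Set.finite_Iio P.M).image _).bddAbove ⟨k, hk, rfl⟩

theorem Valid.exists_eq_maxErr (hP : P.Valid) (u h : ℕ → ℕ) (l s : ℕ) :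
    ∃ k < P.M, P.avgDisp u l k - P.estimate h l s k = P.maxErr u h l s := by
  have hne : ((fun k => P.avgDisp u l k - P.estimate h l s k) '' Set.Iio P.M).Nonempty :=
    ⟨_, 0, hP.M_pos, rfl⟩
  obtain ⟨k, hk, hk'⟩ := hne.csSup_mem ((Set.finite_Iio P.M).image _)
  exact ⟨k, hk, hk'⟩

/-- The loss of selecting `k` in round number `τ`, relative to the number of rounds. -/
noncomputable def gap (P : Chain) (u h : ℕ → ℕ) (τ k : ℕ) : ℝ :=
  (P.maxErr u h (P.levelOf τ) (τ - P.offset (P.levelOf τ)) - (P.avgDisp u (P.levelOf τ) k -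
    P.estimate h (P.levelOf τ) (τ - P.offset (P.levelOf τ)) k)) / P.rounds (P.levelOf τ)

theorem gap_adapted (P : Chain) (u : ℕ → ℕ) : AdaptedTo (P.gap u) := by
  intro h h' τ hh
  have he : P.estimate h (P.levelOf τ) (τ - P.offset (P.levelOf τ)) =
      P.estimate h' (P.levelOf τ) (τ - P.offset (P.levelOf τ)) := by
    ext k
    refine P.estimate_congr (fun i hi => hh _ (by omega)) k
  ext k
  rw [gap, gap, maxErr, maxErr, he]

theorem rounding_spec (P : Chain) (l : ℕ) {i : ℕ} (hi : i < P.N) :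
    P.rounding l i < P.N ∧ P.isCenter l (P.rounding l i) = 1 := by
  induction l with
  | zero =>
    refine ⟨(P.center_le 0 i).trans_lt hi, ?_⟩
    exact P.isCenter_center 0 i
  | succ l ih =>
    refine ⟨(P.center_le (l + 1) _).trans_lt ih.1, ?_⟩
    exact P.isCenter_center (l + 1) _

/-- In every round the error in coordinate `k` is at most the maximal error, which is the selection
gap plus the error in the selected coordinate. The regret bound controls the average of the latter
over the rounds. -/
theorem Valid.level_error_le (hP : P.Valid) {u h : ℕ → ℕ} (hu : ∀ d < P.n, u d < P.N) {l : ℕ}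
    (hl : l < P.levels) (hh : ∀ s < P.rounds l, h (P.offset l + s) < P.M) {k : ℕ} (hk : k < P.M) :
    P.avgDisp u l k - (∑ s ∈ Finset.range (P.rounds l), P.estimate h l s k) / P.rounds l ≤
      P.α / (4 * P.depth) +
        ∑ s ∈ Finset.range (P.rounds l), P.gap u h (P.offset l + s) (h (P.offset l + s)) := by
  have hα := hP.α_pos
  have hd : 0 < P.depth := two_pos.trans_le (hP.two_le_depth hl)
  have hR := hP.scale_pos (l + 1)
  have hF : 0 < Real.log (P.numCenters l) :=
    (by norm_num : (0 : ℝ) < 1 / 2).trans_le (hP.half_le_log_numCenters hl)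
  have hA := zero_lt_one.trans_le (hP.one_le_roundsBound hl)
  obtain ⟨hT1, hT2⟩ := hP.rounds_bounds hl
  have hT : (0 : ℝ) < P.rounds l := hA.trans_le hT1
  have hη : 0 < P.rate l := by
    rw [rate]
    positivity
  have hreg := mw_regret (h := fun s => h (P.offset l + s)) (T := P.rounds l)
    (P.isCenter_nonneg l) (by rw [isCenter_zero]; exact one_pos) hP.N_pos
    (V := P.disp l) (B := P.scale (l + 1)) hη (fun s hs i _ => hP.abs_disp_le l i (hh s hs))
    hP.n_pos (a := fun d => P.rounding l (u d)) fun d hd => P.rounding_spec l (hu d hd)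
  have hgap : ∀ s ∈ Finset.range (P.rounds l),
      (P.avgDisp u l k - P.estimate h l s k) / P.rounds l ≤
      P.gap u h (P.offset l + s) (h (P.offset l + s)) +
        (P.avgDisp u l (h (P.offset l + s)) - P.estimate h l s (h (P.offset l + s))) /
          P.rounds l := by
    intro s hs
    rw [gap, P.levelOf_offset_add (Finset.mem_range.1 hs), Nat.add_sub_cancel_left, ← add_div,
      sub_add_cancel]
    exact div_le_div_of_nonneg_right (P.le_maxErr u h l s hk) hT.le
  have hsum := Finset.sum_le_sum hgap
  rw [Finset.sum_add_distrib, ← Finset.sum_div, ← Finset.sum_div, Finset.sum_sub_distrib,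
    Finset.sum_const, Finset.card_range, nsmul_eq_mul, sub_div,
    mul_div_cancel_left₀ _ hT.ne'] at hsum
  have hreg' : (∑ s ∈ Finset.range (P.rounds l), (P.avgDisp u l (h (P.offset l + s)) -
      P.estimate h l s (h (P.offset l + s)))) / P.rounds l ≤ P.α / (4 * P.depth) := by
    rw [div_le_iff₀ hT]
    refine hreg.trans ?_
    have h1 : Real.log (P.numCenters l) / P.rate l = P.roundsBound l * (P.α / (8 * P.depth)) := by
      rw [rate, roundsBound]
      field_simp
      ring
    have h2 : P.rate l * P.scale (l + 1) ^ 2 / 2 = P.α / (16 * P.depth) := by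
      rw [rate]
      field_simp
      ring
    rw [← numCenters, h1, h2]
    have h3 : P.roundsBound l * (P.α / (8 * P.depth)) ≤ P.rounds l * (P.α / (8 * P.depth)) :=
      mul_le_mul_of_nonneg_right hT1 (by positivity)
    refine (add_le_add_left h3 _).trans ?_
    rw [← mul_add, mul_comm]
    refine mul_le_mul_of_nonneg_right ?_ hT.le
    -- The first summand is the logarithmic term of the regret and the second its quadratic term;
    -- together they make 3/16 of α/depth, within the allowance of 1/4.
    have h4 : P.α / (8 * P.depth) + P.α / (16 * P.depth) = 3 / 16 * (P.α / P.depth) := by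
      field_simp
      norm_num
    have h5 : P.α / (4 * P.depth) = 4 / 16 * (P.α / P.depth) := by
      field_simp
      norm_num
    rw [h4, h5]
    exact mul_le_mul_of_nonneg_right (by norm_num) (div_pos hα hd).le
  linarith

/-- The displacements telescope from the first rounding to the last. The first is within α/2 of the
record, and the last is point 0 because the top scale reaches the radius. -/
theorem Valid.avg_sub_le (hP : P.Valid) {u : ℕ → ℕ} (hu : ∀ d < P.n, u d < P.N) {k : ℕ}
    (hk : k < P.M) :
    (∑ d ∈ Finset.range P.n, P.z (u d) k) / P.n ≤
      P.α / 2 + P.z 0 k + ∑ l ∈ Finset.range P.levels, P.avgDisp u l k := by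
  have hn : (0 : ℝ) < P.n := Nat.cast_pos.2 hP.n_pos
  have htel : ∀ L, ∑ l ∈ Finset.range L, P.avgDisp u l k =
      (∑ d ∈ Finset.range P.n, (P.z (P.rounding 0 (u d)) k - P.z (P.rounding L (u d)) k)) /
        P.n := by
    intro L
    induction L with
    | zero => simp
    | succ L ih =>
      rw [Finset.sum_range_succ, ih, avgDisp, ← add_div, ← Finset.sum_add_distrib]
      congr 1
      refine Finset.sum_congr rfl fun d _ => ?_
      rw [disp, show P.rounding (L + 1) (u d) = P.center (L + 1) (P.rounding L (u d)) from rfl]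
      ring
  have hlast : ∀ d < P.n, P.rounding P.levels (u d) = 0 := by
    intro d hd
    have hz : ∀ i < P.N, P.center P.levels i = 0 := fun i hi =>
      netMap_eq_zero (fun i hi => (le_runMax (fun i => rowDist P.z P.M i 0) hi).trans
        hP.radius_le_scale_levels) hi
    rcases hL : P.levels with _ | L
    · rw [hL] at hz
      exact hz _ (hu d hd)
    · rw [hL] at hz
      exact hz _ (P.rounding_spec L (hu d hd)).1
  rw [htel, div_le_iff₀ hn, add_mul, div_mul_cancel₀ _ hn.ne']
  have hconst : (P.α / 2 + P.z 0 k) * P.n = ∑ d ∈ Finset.range P.n, (P.α / 2 + P.z 0 k) := by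
    rw [Finset.sum_const, Finset.card_range, nsmul_eq_mul, mul_comm]
  rw [hconst, ← Finset.sum_add_distrib]
  refine Finset.sum_le_sum fun d hd => ?_
  rw [hlast d (Finset.mem_range.1 hd)]
  have h1 := (le_abs_self _).trans ((hP.abs_sub_le_rowDist (u d) _ hk).trans
    (hP.dist_center_le 0 (u d)))
  have h2 : P.scale 0 = P.α / 2 := by simp [scale]
  rw [rounding]
  linarith

/-- Estimates are linear in the columns, so one-sided error bounds for all columns, applied to a
column and its negative, give two-sided ones. -/
theorem estimate_neg {k k' : ℕ} (h : ∀ i, P.z i k' = -P.z i k) (hist : ℕ → ℕ) (l s : ℕ) :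
    P.estimate hist l s k' = -P.estimate hist l s k := by
  rw [estimate, estimate, mwMean, mwMean, ← neg_div, ← Finset.sum_neg_distrib]
  congr 1
  refine Finset.sum_congr rfl fun i _ => ?_
  rw [disp, disp, h, h]
  ring

theorem output_neg {k k' : ℕ} (h : ∀ i, P.z i k' = -P.z i k) (L : ℕ) (hist : ℕ → ℕ) :
    P.output L hist k' = -P.output L hist k := by
  rw [output, output, h, neg_add, ← Finset.sum_neg_distrib]
  congr 1
  refine Finset.sum_congr rfl fun l _ => ?_
  rw [← neg_div, ← Finset.sum_neg_distrib]
  congr 1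
  exact Finset.sum_congr rfl fun s _ => estimate_neg h hist l s

theorem Valid.abs_output_sub_le (hP : P.Valid) {u h : ℕ → ℕ} (hu : ∀ d < P.n, u d < P.N)
    (hh : ∀ τ < P.offset P.levels, h τ < P.M) {k : ℕ} (hk : k < P.M) :
    |P.output P.levels h k - (∑ d ∈ Finset.range P.n, P.z (u d) k) / P.n| ≤
      3 / 4 * P.α + ∑ τ ∈ Finset.range (P.offset P.levels), P.gap u h τ (h τ) := by
  have hone : ∀ k < P.M, (∑ d ∈ Finset.range P.n, P.z (u d) k) / P.n - P.output P.levels h k ≤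
      3 / 4 * P.α + ∑ τ ∈ Finset.range (P.offset P.levels), P.gap u h τ (h τ) := by
    intro k hk
    have h1 := hP.avg_sub_le hu hk
    have h2 : ∑ l ∈ Finset.range P.levels, (P.avgDisp u l k -
        (∑ s ∈ Finset.range (P.rounds l), P.estimate h l s k) / P.rounds l) ≤
        ∑ l ∈ Finset.range P.levels, (P.α / (4 * P.depth) + ∑ s ∈ Finset.range (P.rounds l),
          P.gap u h (P.offset l + s) (h (P.offset l + s))) := by
      refine Finset.sum_le_sum fun l hl => ?_
      have hl' := Finset.mem_range.1 hl
      refine hP.level_error_le hu hl' (fun s hs => hh _ ?_) hk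
      have := P.offset_mono (Nat.succ_le_of_lt hl')
      rw [Nat.succ_eq_add_one, offset_succ] at this
      omega
    rw [Finset.sum_sub_distrib, Finset.sum_add_distrib, ← P.sum_offset fun τ => P.gap u h τ (h τ),
      Finset.sum_const, Finset.card_range, nsmul_eq_mul] at h2
    have h3 := hP.levels_mul_le
    rw [output]
    linarith
  rw [abs_le]
  constructor
  · linarith [hone k hk]
  · obtain ⟨k', hk', hneg⟩ := hP.neg k hk
    have h1 := hone k' hk'
    rw [output_neg hneg] at h1
    simp only [hneg, Finset.sum_neg_distrib, neg_div] at h1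
    linarith

/-- The hypothesis `hn` is the inequality log M / `invTemp l` ≤ α/(4·depth) with the definitions of
`invTemp` and `roundsBound` inserted and denominators cleared. -/
theorem Valid.expected_gap_le (hP : P.Valid) (u h : ℕ → ℕ) {l : ℕ} (hl : l < P.levels) {s : ℕ}
    (hs : s < P.rounds l)
    (hn : 64 * (P.scale (l + 1)) ^ 2 * Real.log P.M * P.depth ^ 2 *
      (√P.depth * √(Real.log (P.numCenters l))) ≤ P.n * (P.α ^ 2 * √P.ρ)) :
    ∑ k ∈ Finset.range P.M, softmax (P.logit u h (P.offset l + s)) P.M k *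
      P.gap u h (P.offset l + s) k ≤ P.α / (4 * P.depth) / P.rounds l := by
  have hα := hP.α_pos
  have hρ := hP.ρ_pos
  have hd : 0 < P.depth := two_pos.trans_le (hP.two_le_depth hl)
  have hR := hP.scale_pos (l + 1)
  have hF : 0 < Real.log (P.numCenters l) :=
    (by norm_num : (0 : ℝ) < 1 / 2).trans_le (hP.half_le_log_numCenters hl)
  have hA := zero_lt_one.trans_le (hP.one_le_roundsBound hl)
  have hT : (0 : ℝ) < P.rounds l := hA.trans_le (hP.rounds_bounds hl).1
  have hnpos : (0 : ℝ) < P.n := Nat.cast_pos.2 hP.n_pos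
  have hlam : 0 < P.invTemp l := by
    rw [invTemp]
    have := Real.sqrt_pos.2 (div_pos hρ (mul_pos hd hA))
    positivity
  have hlogit : P.logit u h (P.offset l + s) =
      fun k => P.invTemp l * (P.avgDisp u l k - P.estimate h l s k) := by
    ext k
    rw [logit, P.levelOf_offset_add hs, Nat.add_sub_cancel_left]
  have hgap : ∀ k, P.gap u h (P.offset l + s) k =
      (P.maxErr u h l s - (P.avgDisp u l k - P.estimate h l s k)) / P.rounds l := by
    intro k
    rw [gap, P.levelOf_offset_add hs, Nat.add_sub_cancel_left]
  rw [hlogit]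
  simp only [hgap, ← mul_div_assoc]
  rw [← Finset.sum_div]
  refine div_le_div_of_nonneg_right ?_ hT.le
  refine (sum_softmax_mul_gap_le hP.M_pos hlam (hP.exists_eq_maxErr u h l s)).trans ?_
  rw [div_le_div_iff₀ hlam (by positivity)]
  have hsq : √(P.ρ / (P.depth * P.roundsBound l)) =
      √P.ρ * P.α / (8 * P.depth * P.scale (l + 1) * (√P.depth * √(Real.log (P.numCenters l)))) := by
    have hB : P.depth * P.roundsBound l = (8 * P.depth * P.scale (l + 1) / P.α) ^ 2 *
        (P.depth * Real.log (P.numCenters l)) := by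
      rw [roundsBound]
      field_simp
      norm_num
    rw [Real.sqrt_div hρ.le, hB, Real.sqrt_mul (sq_nonneg _), Real.sqrt_sq (by positivity),
      Real.sqrt_mul hd.le]
    have := Real.sqrt_pos.2 hd
    have := Real.sqrt_pos.2 hF
    field_simp
  rw [invTemp, hsq]
  have h1 := Real.sqrt_pos.2 hd
  have h2 := Real.sqrt_pos.2 hF
  rw [← mul_div_assoc, le_div_iff₀ (by positivity), ← mul_div_assoc, ← mul_div_assoc,
    le_div_iff₀ (by positivity)]
  linarith [hn]

end Chain

/-! ## Noisy histograms -/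

/-- Summation by parts: the hypothesis gives a·q^(j+1) ≤ q^j - q^(j+1), and these inequalities are
added with weights j + 1. -/
theorem mul_sum_mul_pow_le {q a : ℝ} (hq : 0 ≤ q) (hqa : q * (1 + a) ≤ 1) (J : ℕ) :
    a * ∑ j ∈ Finset.range (J + 1), j * q ^ j ≤
      ∑ j ∈ Finset.range (J + 1), q ^ j - (J + 1) * q ^ J := by
  induction J with
  | zero => simp
  | succ J ih =>
    rw [Finset.sum_range_succ, mul_add, Finset.sum_range_succ _ (J + 1)]
    have h1 : a * q ^ (J + 1) ≤ q ^ J - q ^ (J + 1) := by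
      have := mul_le_mul_of_nonneg_left hqa (pow_nonneg hq J)
      rw [pow_succ]
      linarith
    have h2 := mul_le_mul_of_nonneg_left h1 (Nat.cast_nonneg (α := ℝ) (J + 1))
    push_cast at h2 ⊢
    linarith

/-- The weights decay geometrically, with ratio q = exp(-a), on both sides of `c`, and q(1 + a) ≤ 1.
Each side contributes at most 1/a times the total weight, wherever the range is cut off. -/
theorem sum_softmax_mul_abs_le {n c : ℕ} (hc : c ≤ n) {a : ℝ} (ha : 0 < a) :
    ∑ k ∈ Finset.range (n + 1), softmax (fun k => -(a * |(k : ℝ) - c|)) (n + 1) k *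
      |(k : ℝ) - c| ≤ 2 / a := by
  set q := Real.exp (-a) with hq
  have hq0 : 0 < q := Real.exp_pos _
  have hqa : q * (1 + a) ≤ 1 := by
    have h1 := Real.add_one_le_exp a
    have h2 : q * Real.exp a = 1 := by rw [hq, ← Real.exp_add]; simp
    nlinarith
  set w : ℕ → ℝ := fun k => Real.exp (-(a * |(k : ℝ) - c|)) with hw
  have hwpos : ∀ k, 0 < w k := fun k => Real.exp_pos _
  have hup : ∀ j : ℕ, |((c + j : ℕ) : ℝ) - c| = j := fun j => by
    push_cast
    rw [add_sub_cancel_left, Nat.abs_cast]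
  have hwup : ∀ j, w (c + j) = q ^ j := by
    intro j
    simp only [hw]
    rw [hup, hq, ← Real.exp_nat_mul]
    congr 1
    ring
  have hdown : ∀ j ≤ c, |((c - j : ℕ) : ℝ) - c| = j := fun j hj => by
    rw [Nat.cast_sub hj, sub_sub_cancel_left, abs_neg, Nat.abs_cast]
  have hwdown : ∀ j ≤ c, w (c - j) = q ^ j := by
    intro j hj
    simp only [hw]
    rw [hdown j hj, hq, ← Real.exp_nat_mul]
    congr 1
    ring
  have hrefl : ∀ f : ℕ → ℝ, ∑ k ∈ Finset.range (c + 1), f k =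
      ∑ j ∈ Finset.range (c + 1), f (c - j) := fun f => by
    rw [← Finset.sum_range_reflect]
    rfl
  have hS : 0 < ∑ i ∈ Finset.range (n + 1), w i :=
    Finset.sum_pos (fun i _ => hwpos i) ⟨0, Finset.mem_range.2 (Nat.succ_pos n)⟩
  have hgeom : ∀ J : ℕ, a * ∑ j ∈ Finset.range (J + 1), j * q ^ j ≤
      ∑ j ∈ Finset.range (J + 1), q ^ j := fun J => by
    have h1 := mul_sum_mul_pow_le hq0.le hqa J
    have h2 : 0 ≤ ((J : ℝ) + 1) * q ^ J := by positivity
    linarith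
  have hlow : a * ∑ k ∈ Finset.range (c + 1), w k * |(k : ℝ) - c| ≤
      ∑ i ∈ Finset.range (n + 1), w i := by
    have h1 : ∑ k ∈ Finset.range (c + 1), w k * |(k : ℝ) - c| =
        ∑ j ∈ Finset.range (c + 1), j * q ^ j := by
      rw [hrefl]
      refine Finset.sum_congr rfl fun j hj => ?_
      have hj' := Nat.lt_succ_iff.1 (Finset.mem_range.1 hj)
      rw [hwdown j hj', hdown j hj', mul_comm]
    have h2 : ∑ k ∈ Finset.range (c + 1), w k = ∑ j ∈ Finset.range (c + 1), q ^ j := by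
      rw [hrefl]
      exact Finset.sum_congr rfl fun j hj =>
        hwdown j (Nat.lt_succ_iff.1 (Finset.mem_range.1 hj))
    rw [h1]
    refine (hgeom c).trans ?_
    rw [← h2]
    exact Finset.sum_le_sum_of_subset_of_nonneg (Finset.range_mono (by omega))
      fun i _ _ => (hwpos i).le
  have hhigh : a * ∑ j ∈ Finset.range (n - c + 1), w (c + j) * |((c + j : ℕ) : ℝ) - c| ≤
      ∑ i ∈ Finset.range (n + 1), w i := by
    have h1 : ∑ j ∈ Finset.range (n - c + 1), w (c + j) * |((c + j : ℕ) : ℝ) - c| =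
        ∑ j ∈ Finset.range (n - c + 1), j * q ^ j :=
      Finset.sum_congr rfl fun j _ => by rw [hwup, hup, mul_comm]
    rw [h1]
    refine (hgeom (n - c)).trans ?_
    have h3 : n + 1 = c + (n - c + 1) := by omega
    rw [h3, Finset.sum_range_add w]
    simp only [hwup]
    have : 0 ≤ ∑ k ∈ Finset.range c, w k := Finset.sum_nonneg fun i _ => (hwpos i).le
    linarith
  have htot : ∑ k ∈ Finset.range (n + 1), w k * |(k : ℝ) - c| ≤
      ∑ k ∈ Finset.range (c + 1), w k * |(k : ℝ) - c| +
        ∑ j ∈ Finset.range (n - c + 1), w (c + j) * |((c + j : ℕ) : ℝ) - c| := by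
    have h3 : n + 1 = c + (n - c + 1) := by omega
    rw [h3, Finset.sum_range_add (fun k : ℕ => w k * |(k : ℝ) - c|)]
    refine add_le_add_left (Finset.sum_le_sum_of_subset_of_nonneg (Finset.range_mono (by omega))
      fun i _ _ => mul_nonneg (hwpos i).le (abs_nonneg _)) _
  have hsum : ∑ k ∈ Finset.range (n + 1), softmax (fun k => -(a * |(k : ℝ) - c|)) (n + 1) k *
      |(k : ℝ) - c| = (∑ k ∈ Finset.range (n + 1), w k * |(k : ℝ) - c|) /
        ∑ i ∈ Finset.range (n + 1), w i := by
    rw [Finset.sum_div]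
    exact Finset.sum_congr rfl fun k _ => by rw [softmax]; ring
  rw [hsum, div_le_div_iff₀ hS ha]
  nlinarith [mul_le_mul_of_nonneg_left htot ha.le]

/-! ### Privacy and accuracy of noisy histograms. -/

namespace Chain

variable (P : Chain)

/-- The number of records equal to point `i`. -/
def count (u : ℕ → ℕ) (i : ℕ) : ℕ := ∑ d ∈ Finset.range P.n, if u d = i then 1 else 0

/-- The logits of the noisy counts. -/
noncomputable def histLogit (u : ℕ → ℕ) (_ : ℕ → ℕ) (i k : ℕ) : ℝ :=
  -(√P.ρ * |(k : ℝ) - P.count u i|)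

/-- The estimate of the mean from the first `L` noisy counts. -/
noncomputable def histOutput (L : ℕ) (h : ℕ → ℕ) (k : ℕ) : ℝ :=
  P.z 0 k + ∑ i ∈ Finset.range L, (h i : ℝ) / P.n * (P.z i k - P.z 0 k)

theorem histLogit_adapted (u : ℕ → ℕ) : AdaptedTo (P.histLogit u) := fun _ _ _ _ => rfl

theorem count_le (u : ℕ → ℕ) (i : ℕ) : P.count u i ≤ P.n := by
  refine (Finset.sum_le_card_nsmul _ _ 1 fun d _ => ?_).trans (by simp)
  split_ifs <;> simp

theorem count_cast (u : ℕ → ℕ) (i : ℕ) :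
    (P.count u i : ℝ) = ∑ d ∈ Finset.range P.n, if u d = i then 1 else 0 := by
  simp [count]

variable {P}

/-- Replacing a record changes at most two counts, each by one, and each such change costs ρ/2. -/
theorem hist_privacy (hρ : 0 ≤ P.ρ) {u u' : ℕ → ℕ}
    (huu' : ∃ i i', ∀ φ : ℕ → ℝ, ∑ d ∈ Finset.range P.n, φ (u d) -
      ∑ d ∈ Finset.range P.n, φ (u' d) = φ i - φ i') :
    (∀ h t k, |P.histLogit u h t k - P.histLogit u' h t k| ≤
      √P.ρ * |(P.count u t : ℝ) - P.count u' t|) ∧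
    ∑ t ∈ Finset.range P.N, (√P.ρ * |(P.count u t : ℝ) - P.count u' t|) ^ 2 / 2 ≤ P.ρ := by
  constructor
  · intro h t k
    rw [histLogit, histLogit, neg_sub_neg, ← mul_sub, abs_mul, abs_of_nonneg (Real.sqrt_nonneg _)]
    refine mul_le_mul_of_nonneg_left ?_ (Real.sqrt_nonneg _)
    refine (abs_abs_sub_abs_le_abs_sub _ _).trans_eq ?_
    congr 1
    ring
  · obtain ⟨i, i', hii'⟩ := huu'
    have hc : ∀ t, (√P.ρ * |(P.count u t : ℝ) - P.count u' t|) ^ 2 / 2 ≤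
        P.ρ / 2 * ((if i = t then 1 else 0) + if i' = t then 1 else 0) := by
      intro t
      rw [mul_pow, Real.sq_sqrt hρ, sq_abs, count_cast, count_cast,
        hii' fun x => if x = t then 1 else 0]
      split_ifs <;> norm_num
      linarith
    have hone : ∀ j : ℕ, ∑ t ∈ Finset.range P.N, (if j = t then (1 : ℝ) else 0) ≤ 1 := by
      intro j
      rw [Finset.sum_ite_eq]
      split_ifs <;> norm_num
    refine (Finset.sum_le_sum fun t _ => hc t).trans ?_
    rw [← Finset.mul_sum, Finset.sum_add_distrib]
    nlinarith [hone i, hone i']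

/-- Noisy counts need not sum to n. Measuring all points from point 0 makes this harmless and
weights each count error by at most radius/n. -/
theorem Valid.abs_histOutput_sub_le (hP : P.Valid) {u : ℕ → ℕ} (hu : ∀ d < P.n, u d < P.N)
    (h : ℕ → ℕ) {k : ℕ} (hk : k < P.M) :
    |P.histOutput P.N h k - (∑ d ∈ Finset.range P.n, P.z (u d) k) / P.n| ≤
      0 + ∑ i ∈ Finset.range P.N, P.radius / P.n * |(h i : ℝ) - P.count u i| := by
  have hn : (0 : ℝ) < P.n := Nat.cast_pos.2 hP.n_pos
  have hfib : ∀ φ : ℕ → ℝ, ∑ d ∈ Finset.range P.n, φ (u d) =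
      ∑ i ∈ Finset.range P.N, P.count u i * φ i := by
    intro φ
    simp only [count_cast, Finset.sum_mul]
    rw [Finset.sum_comm]
    refine Finset.sum_congr rfl fun d hd => ?_
    simp [hu d (Finset.mem_range.1 hd)]
  have hmean : (∑ d ∈ Finset.range P.n, P.z (u d) k) / P.n =
      P.z 0 k + ∑ i ∈ Finset.range P.N, (P.count u i : ℝ) / P.n * (P.z i k - P.z 0 k) := by
    have h1 : ∑ d ∈ Finset.range P.n, P.z (u d) k =
        P.n * P.z 0 k + ∑ d ∈ Finset.range P.n, (P.z (u d) k - P.z 0 k) := by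
      rw [Finset.sum_sub_distrib, Finset.sum_const, Finset.card_range, nsmul_eq_mul]
      ring
    rw [h1, hfib fun i => P.z i k - P.z 0 k, add_div, mul_div_cancel_left₀ _ hn.ne',
      Finset.sum_div]
    congr 1
    exact Finset.sum_congr rfl fun i _ => by ring
  rw [hmean, histOutput, zero_add, add_sub_add_left_eq_sub, ← Finset.sum_sub_distrib]
  refine (Finset.abs_sum_le_sum_abs _ _).trans (Finset.sum_le_sum fun i hi => ?_)
  have h2 : (h i : ℝ) / P.n * (P.z i k - P.z 0 k) -
      (P.count u i : ℝ) / P.n * (P.z i k - P.z 0 k) =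
      (P.z i k - P.z 0 k) / P.n * ((h i : ℝ) - P.count u i) := by ring
  rw [h2, abs_mul, abs_div, Nat.abs_cast]
  refine mul_le_mul_of_nonneg_right (div_le_div_of_nonneg_right ?_ hn.le) (abs_nonneg _)
  exact (hP.abs_sub_le_rowDist i 0 hk).trans
    (le_runMax (fun i => rowDist P.z P.M i 0) (Finset.mem_range.1 hi))

theorem Valid.expected_count_error_le (hP : P.Valid) (u h : ℕ → ℕ) (i : ℕ) :
    ∑ k ∈ Finset.range (P.n + 1), softmax (P.histLogit u h i) (P.n + 1) k *
      (P.radius / P.n * |(k : ℝ) - P.count u i|) ≤ P.radius / P.n * (2 / √P.ρ) := by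
  have h1 := sum_softmax_mul_abs_le (P.count_le u i) (Real.sqrt_pos.2 hP.ρ_pos)
  have hr : 0 ≤ P.radius / P.n := div_nonneg (runMax_nonneg _ _) (Nat.cast_nonneg _)
  refine le_trans (le_of_eq ?_) (mul_le_mul_of_nonneg_left h1 hr)
  rw [Finset.mul_sum]
  refine Finset.sum_congr rfl fun k _ => ?_
  rw [mul_left_comm]
  rfl

end Chain

/-! ## Reasoning about programs -/

/-- Does the program write to the integer array `a`? -/
def Prog.writesNat : Prog → ℕ → Bool
  | .skip, _ => false
  | .setNat b _ _ _, a => a == b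
  | .setReal _ _ _ _, _ => false
  | .draw _ _ _, _ => false
  | .seq c d, a => c.writesNat a || d.writesNat a
  | .ite _ c d, a => c.writesNat a || d.writesNat a
  | .loop _ c, a => c.writesNat a

/-- Does the program write to the real array `a`? -/
def Prog.writesReal : Prog → ℕ → Bool
  | .skip, _ => false
  | .setNat _ _ _ _, _ => false
  | .setReal b _ _ _, a => a == b
  | .draw b _ _, a => a == b
  | .seq c d, a => c.writesReal a || d.writesReal a
  | .ite _ c d, a => c.writesReal a || d.writesReal a
  | .loop _ c, a => c.writesReal a

/-- Does the program draw random reals? -/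
def Prog.draws : Prog → Bool
  | .draw _ _ _ => true
  | .seq c d => c.draws || d.draws
  | .ite _ c d => c.draws || d.draws
  | .loop _ c => c.draws
  | _ => false

/-- The memory `s'` agrees with `s` except on the arrays that `c` writes to. -/
structure Frame (c : Prog) (s s' : Memory) : Prop where
  nat : ∀ a, c.writesNat a = false → s'.nat a = s.nat a
  real : ∀ a, c.writesReal a = false → s'.real a = s.real a
  pos : c.draws = false → s'.pos = s.pos

theorem Frame.refl (c : Prog) (s : Memory) : Frame c s s :=
  ⟨fun _ _ => rfl, fun _ _ => rfl, fun _ => rfl⟩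

theorem Frame.trans {c : Prog} {s s' s'' : Memory} (h : Frame c s s') (h' : Frame c s' s'') :
    Frame c s s'' :=
  ⟨fun a ha => (h'.nat a ha).trans (h.nat a ha), fun a ha => (h'.real a ha).trans (h.real a ha),
    fun hd => (h'.pos hd).trans (h.pos hd)⟩

theorem Frame.mono {c d : Prog} {s s' : Memory} (h : Frame c s s')
    (hn : ∀ a, d.writesNat a = false → c.writesNat a = false)
    (hr : ∀ a, d.writesReal a = false → c.writesReal a = false)
    (hd : d.draws = false → c.draws = false) : Frame d s s' :=
  ⟨fun a ha => h.nat a (hn a ha), fun a ha => h.real a (hr a ha), fun hp => h.pos (hd hp)⟩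

theorem writeEntry_of_ne {V : Type*} (f : ℕ → ℕ → ℕ → V) {a a' : ℕ} (i j : ℕ) (v : V)
    (h : a' ≠ a) : writeEntry f a i j v a' = f a' := by
  funext x y
  simp [writeEntry, h]

theorem writeEntry_self {V : Type*} (f : ℕ → ℕ → ℕ → V) (a i j : ℕ) (v : V) :
    writeEntry f a i j v a i j = v := by
  simp [writeEntry]

theorem writeEntry_apply {V : Type*} (f : ℕ → ℕ → ℕ → V) (a i j : ℕ) (v : V) (x y : ℕ) :
    writeEntry f a i j v a x y = if x = i ∧ y = j then v else f a x y := by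
  simp [writeEntry]

/-- The arrays a program writes are read off from its syntax, so the preservation of all other
arrays is settled by computation, that is, by `rfl`. -/
theorem Exec.frame {ω : ℕ → unitInterval} {c : Prog} {s s' : Memory} {t : ℕ}
    (h : Exec ω c s t s') : Frame c s s' := by
  induction h with
  | skip s => exact Frame.refl _ _
  | setNat s a i j x =>
    refine ⟨fun b hb => ?_, fun b _ => rfl, fun _ => rfl⟩
    exact writeEntry_of_ne _ _ _ _ (by simpa [Prog.writesNat] using hb)
  | setReal s a i j x =>
    refine ⟨fun b _ => rfl, fun b hb => ?_, fun _ => rfl⟩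
    exact writeEntry_of_ne _ _ _ _ (by simpa [Prog.writesReal] using hb)
  | draw s a i j =>
    refine ⟨fun b _ => rfl, fun b hb => ?_, fun h => by simp [Prog.draws] at h⟩
    exact writeEntry_of_ne _ _ _ _ (by simpa [Prog.writesReal] using hb)
  | seq _ _ ih₁ ih₂ =>
    refine Frame.trans (ih₁.mono ?_ ?_ ?_) (ih₂.mono ?_ ?_ ?_) <;>
      simp +contextual [Prog.writesNat, Prog.writesReal, Prog.draws]
  | iteTrue _ _ ih =>
    refine ih.mono ?_ ?_ ?_ <;>
      simp +contextual [Prog.writesNat, Prog.writesReal, Prog.draws]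
  | iteFalse _ _ ih =>
    refine ih.mono ?_ ?_ ?_ <;>
      simp +contextual [Prog.writesNat, Prog.writesReal, Prog.draws]
  | loopTrue _ _ _ ih₁ ih₂ =>
    refine Frame.trans (ih₁.mono ?_ ?_ ?_) ih₂ <;>
      simp +contextual [Prog.writesNat, Prog.writesReal, Prog.draws]
  | loopFalse _ => exact Frame.refl _ _

/-- The program `c`, started in `s`, halts within `T` steps in a memory that satisfies `Q`. -/
def Runs (ω : ℕ → unitInterval) (c : Prog) (s : Memory) (T : ℕ) (Q : Memory → Prop) : Prop :=
  ∃ t ≤ T, ∃ s', Exec ω c s t s' ∧ Q s'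

namespace Runs

variable {ω : ℕ → unitInterval} {c d : Prog} {s : Memory} {T U : ℕ} {Q Q' : Memory → Prop}

theorem mono (h : Runs ω c s T Q) (hT : T ≤ U) (hQ : ∀ s', Frame c s s' → Q s' → Q' s') :
    Runs ω c s U Q' := by
  obtain ⟨t, ht, s', he, hq⟩ := h
  exact ⟨t, ht.trans hT, s', he, hQ s' he.frame hq⟩

theorem skip (h : Q s) : Runs ω .skip s 1 Q := ⟨1, le_rfl, s, .skip s, h⟩

theorem setNat {a : ℕ} {i j x : NExp}
    (h : Q { s with nat := writeEntry s.nat a (i.eval s) (j.eval s) (x.eval s) }) :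
    Runs ω (.setNat a i j x) s 1 Q :=
  ⟨1, le_rfl, _, .setNat s a i j x, h⟩

theorem setReal {a : ℕ} {i j : NExp} {x : RExp}
    (h : Q { s with real := writeEntry s.real a (i.eval s) (j.eval s) (x.eval s) }) :
    Runs ω (.setReal a i j x) s 1 Q :=
  ⟨1, le_rfl, _, .setReal s a i j x, h⟩

theorem draw {a : ℕ} {i j : NExp}
    (h : Q { s with
      real := writeEntry s.real a (i.eval s) (j.eval s) (ω s.pos : ℝ), pos := s.pos + 1 }) :
    Runs ω (.draw a i j) s 1 Q :=
  ⟨1, le_rfl, _, .draw s a i j, h⟩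

theorem seq (h : Runs ω c s T Q) (h' : ∀ s', Frame c s s' → Q s' → Runs ω d s' U Q') :
    Runs ω (.seq c d) s (T + U) Q' := by
  obtain ⟨t, ht, s', he, hq⟩ := h
  obtain ⟨u, hu, s'', he', hq'⟩ := h' s' he.frame hq
  exact ⟨t + u, add_le_add ht hu, s'', .seq he he', hq'⟩

theorem ite {b : BExp} (h : b.eval s → Runs ω c s T Q) (h' : ¬ b.eval s → Runs ω d s T Q) :
    Runs ω (.ite b c d) s (T + 1) Q := by
  by_cases hb : b.eval s
  · obtain ⟨t, ht, s', he, hq⟩ := h hb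
    exact ⟨t + 1, by omega, s', .iteTrue hb he, hq⟩
  · obtain ⟨t, ht, s', he, hq⟩ := h' hb
    exact ⟨t + 1, by omega, s', .iteFalse hb he, hq⟩

/-- The budget is one test and one body for each of the `K` iterations, plus the final failing test.
Steps may use the frame relative to the initial memory, so the invariant need not mention untouched
arrays. -/
theorem loop {b : BExp} {K : ℕ} (Inv : ℕ → Memory → Prop) (h0 : Inv 0 s)
    (hstep : ∀ k < K, ∀ s', Frame (.loop b c) s s' → Inv k s' →
      b.eval s' ∧ Runs ω c s' T (Inv (k + 1)))
    (hend : ∀ s', Frame (.loop b c) s s' → Inv K s' → ¬ b.eval s') :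
    Runs ω (.loop b c) s (K * (T + 1) + 1) (Inv K) := by
  -- Induction on the number `r` of remaining iterations.
  have key : ∀ r k s', k + r = K → Frame (.loop b c) s s' → Inv k s' →
      Runs ω (.loop b c) s' (r * (T + 1) + 1) (Inv K) := by
    intro r
    induction r with
    | zero =>
      intro k s' hk hf hi
      obtain rfl : k = K := by omega
      exact ⟨1, by omega, s', .loopFalse (hend s' hf hi), hi⟩
    | succ r ih =>
      intro k s' hk hf hi
      obtain ⟨hb, t, ht, s'', he, hi'⟩ := hstep k (by omega) s' hf hi
      have hf' : Frame (.loop b c) s s'' := hf.trans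
        (he.frame.mono (fun _ h => h) (fun _ h => h) fun h => h)
      obtain ⟨u, hu, s₃, he', hq⟩ := ih (k + 1) s'' (by omega) hf' hi'
      refine ⟨t + u + 1, ?_, s₃, .loopTrue hb he he', hq⟩
      rw [Nat.succ_mul]
      omega
  exact key K 0 s (by omega) (Frame.refl _ _) h0

end Runs

/-! ## Counting loops -/

/-- The entry `(0, 0)` of an integer array. -/
abbrev nvar (a : ℕ) : NExp := .get a (.lit 0) (.lit 0)

/-- The entry `(0, 0)` of a real array. -/
abbrev rvar (a : ℕ) : RExp := .get a (.lit 0) (.lit 0)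

/-- Assignment to the entry `(0, 0)` of an integer array. -/
abbrev setNvar (a : ℕ) (x : NExp) : Prog := .setNat a (.lit 0) (.lit 0) x

/-- Assignment to the entry `(0, 0)` of a real array. -/
abbrev setRvar (a : ℕ) (x : RExp) : Prog := .setReal a (.lit 0) (.lit 0) x

/-- Repeat `c` while the counter `i` runs from `0` to `bd - 1`. -/
def forLoop (i : ℕ) (bd : NExp) (c : Prog) : Prog :=
  .seq (setNvar i (.lit 0))
    (.loop (.not (.nle bd (nvar i))) (.seq c (setNvar i (.add (nvar i) (.lit 1)))))

namespace Runs

variable {ω : ℕ → unitInterval} {s : Memory} {T : ℕ}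

/-- Each iteration pays for its test and the increment besides the body; initialization and the last
test add 2. The invariant is required after the increment, since it may refer to the integer memory.
-/
theorem forLoop {i : ℕ} {bd : NExp} {c : Prog} {K : ℕ} (Inv : ℕ → Memory → Prop)
    (hi : c.writesNat i = false)
    (hbd : ∀ s', Frame (forLoop i bd c) s s' → bd.eval s' = K)
    (h0 : Inv 0 { s with nat := writeEntry s.nat i 0 0 0 })
    (hstep : ∀ k < K, ∀ s', Frame (_root_.forLoop i bd c) s s' → s'.nat i 0 0 = k → Inv k s' →
      Runs ω c s' T fun s'' => Inv (k + 1) { s'' with nat := writeEntry s''.nat i 0 0 (k + 1) }) :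
    Runs ω (_root_.forLoop i bd c) s (K * (T + 2) + 2) (Inv K) := by
  have hfr : ∀ s₁ s', Frame (setNvar i (.lit 0)) s s₁ →
      Frame (.loop (.not (.nle bd (nvar i))) (.seq c (setNvar i (.add (nvar i) (.lit 1))))) s₁ s' →
      Frame (_root_.forLoop i bd c) s s' := by
    intro s₁ s' h1 h2
    refine Frame.trans (h1.mono ?_ ?_ ?_) (h2.mono ?_ ?_ ?_) <;>
      simp +contextual [_root_.forLoop, Prog.writesNat, Prog.writesReal, Prog.draws]
  have hmain := Runs.seq (ω := ω) (c := setNvar i (.lit 0)) (s := s)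
    (d := .loop (.not (.nle bd (nvar i))) (.seq c (setNvar i (.add (nvar i) (.lit 1)))))
    (Q := fun s₁ => Inv 0 s₁ ∧ s₁.nat i 0 0 = 0) (Q' := Inv K) (T := 1)
    (U := K * ((T + 1) + 1) + 1) ?_ ?_
  · exact hmain.mono (by ring_nf; omega) fun _ _ h => h
  · exact Runs.setNat ⟨h0, writeEntry_self _ _ _ _ _⟩
  · intro s₁ hf₁ hi₁
    refine (Runs.loop (fun k s' => Inv k s' ∧ s'.nat i 0 0 = k) hi₁ ?_ ?_).mono le_rfl
      fun _ _ h => h.1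
    · intro k hk s' hf hs'
      refine ⟨?_, ?_⟩
      · change ¬ bd.eval s' ≤ s'.nat i 0 0
        rw [hbd s' (hfr s₁ s' hf₁ hf), hs'.2]
        omega
      · refine Runs.seq (hstep k hk s' (hfr s₁ s' hf₁ hf) hs'.2 hs'.1) fun s'' hf' hi' => ?_
        have hk' : s''.nat i 0 0 = k := by rw [hf'.nat i hi, hs'.2]
        refine Runs.setNat ?_
        simp only [NExp.eval, hk']
        exact ⟨hi', writeEntry_self _ _ _ _ _⟩
    · intro s' hf hs'
      change ¬ ¬ bd.eval s' ≤ s'.nat i 0 0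
      rw [hbd s' (hfr s₁ s' hf₁ hf), hs'.2]
      exact not_not.2 le_rfl

/-- A loop that repeatedly updates one entry of a real array. -/
theorem cellLoop {i a : ℕ} {bd I J : NExp} {x : RExp} {K I₀ J₀ : ℕ} (v : ℕ → ℝ)
    (hbd : ∀ s', Frame (_root_.forLoop i bd (.setReal a I J x)) s s' → bd.eval s' = K)
    (hI : ∀ s', Frame (_root_.forLoop i bd (.setReal a I J x)) s s' → I.eval s' = I₀)
    (hJ : ∀ s', Frame (_root_.forLoop i bd (.setReal a I J x)) s s' → J.eval s' = J₀)
    (hv : s.real a I₀ J₀ = v 0)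
    (hx : ∀ k < K, ∀ s', Frame (_root_.forLoop i bd (.setReal a I J x)) s s' → s'.nat i 0 0 = k →
      s'.real a I₀ J₀ = v k → x.eval s' = v (k + 1)) :
    Runs ω (_root_.forLoop i bd (.setReal a I J x)) s (K * 3 + 2) fun s' =>
      s'.real a I₀ J₀ = v K ∧ ∀ p q, ¬(p = I₀ ∧ q = J₀) → s'.real a p q = s.real a p q := by
  refine Runs.forLoop (T := 1) (fun k s' => s'.real a I₀ J₀ = v k ∧
    ∀ p q, ¬(p = I₀ ∧ q = J₀) → s'.real a p q = s.real a p q) rfl hbd ⟨hv, fun _ _ _ => rfl⟩ ?_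
  intro k hk s' hf hik hs'
  refine Runs.setReal ?_
  simp only [hI s' hf, hJ s' hf, hx k hk s' hf hik hs'.1, writeEntry_apply]
  refine ⟨by simp, fun p q hpq => ?_⟩
  rw [if_neg hpq]
  exact hs'.2 p q hpq

/-- A loop that fills a segment of a row of a real array. -/
theorem fillLoop {i a : ℕ} {bd I J : NExp} {x : RExp} {K I₀ J₀ : ℕ} (v : ℕ → ℝ)
    (hbd : ∀ s', Frame (_root_.forLoop i bd (.setReal a I J x)) s s' → bd.eval s' = K)
    (hI : ∀ s', Frame (_root_.forLoop i bd (.setReal a I J x)) s s' → I.eval s' = I₀)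
    (hJ : ∀ s', Frame (_root_.forLoop i bd (.setReal a I J x)) s s' →
      J.eval s' = J₀ + s'.nat i 0 0)
    (hx : ∀ k < K, ∀ s', Frame (_root_.forLoop i bd (.setReal a I J x)) s s' → s'.nat i 0 0 = k →
      s'.real a I₀ (J₀ + k) = s.real a I₀ (J₀ + k) → x.eval s' = v k) :
    Runs ω (_root_.forLoop i bd (.setReal a I J x)) s (K * 3 + 2) fun s' =>
      (∀ k < K, s'.real a I₀ (J₀ + k) = v k) ∧
      ∀ p q, ¬(p = I₀ ∧ J₀ ≤ q ∧ q < J₀ + K) → s'.real a p q = s.real a p q := by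
  refine Runs.forLoop (T := 1) (fun k s' => (∀ k' < k, s'.real a I₀ (J₀ + k') = v k') ∧
    ∀ p q, ¬(p = I₀ ∧ J₀ ≤ q ∧ q < J₀ + k) → s'.real a p q = s.real a p q) rfl hbd
    ⟨fun _ h => by omega, fun _ _ _ => rfl⟩ ?_
  intro k hk s' hf hik hs'
  refine Runs.setReal ?_
  have hval := hx k hk s' hf hik (hs'.2 _ _ (by omega))
  simp only [hI s' hf, hJ s' hf, hik, hval, writeEntry_apply]
  refine ⟨fun k' hk' => ?_, fun p q hpq => ?_⟩
  · rcases Nat.lt_succ_iff_lt_or_eq.1 hk' with h | rfl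
    · rw [if_neg (by omega), hs'.1 k' h]
    · simp
  · rw [if_neg (by omega)]
    exact hs'.2 p q (by omega)

/-- A loop that fills the first row of an integer array. -/
theorem natFillLoop {i a : ℕ} (hia : i ≠ a) {bd : NExp} {x : NExp} {K : ℕ} (v : ℕ → ℕ)
    (hbd : ∀ s', Frame (_root_.forLoop i bd (.setNat a (.lit 0) (nvar i) x)) s s' →
      bd.eval s' = K)
    (hx : ∀ k < K, ∀ s', Frame (_root_.forLoop i bd (.setNat a (.lit 0) (nvar i) x)) s s' →
      s'.nat i 0 0 = k → s'.nat a 0 k = s.nat a 0 k → x.eval s' = v k) :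
    Runs ω (_root_.forLoop i bd (.setNat a (.lit 0) (nvar i) x)) s (K * 3 + 2) fun s' =>
      ∀ k < K, s'.nat a 0 k = v k := by
  refine (Runs.forLoop (T := 1) (fun k s' => (∀ k' < k, s'.nat a 0 k' = v k') ∧
    ∀ q, k ≤ q → s'.nat a 0 q = s.nat a 0 q) (by simpa [Prog.writesNat] using hia) hbd
    ⟨fun _ h => by omega, fun q _ => ?_⟩ ?_).mono le_rfl fun _ _ h => h.1
  · simp only [writeEntry_of_ne s.nat 0 0 0 hia.symm]
  intro k hk s' hf hik hs'
  refine Runs.setNat ?_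
  have hval := hx k hk s' hf hik (hs'.2 _ le_rfl)
  simp only [NExp.eval, hik, hval, writeEntry_of_ne _ 0 0 (k + 1) hia.symm, writeEntry_apply]
  refine ⟨fun k' hk' => ?_, fun q hq => ?_⟩
  · rcases Nat.lt_succ_iff_lt_or_eq.1 hk' with h | rfl
    · rw [if_neg (by omega), hs'.1 k' h]
    · simp
  · rw [if_neg (by omega)]
    exact hs'.2 q (by omega)

end Runs

namespace Runs

variable {ω : ℕ → unitInterval} {s : Memory}

theorem setNvar {a v : ℕ} {x : NExp} (h : x.eval s = v) :
    Runs ω (_root_.setNvar a x) s 1 fun s' => s'.nat a 0 0 = v :=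
  Runs.setNat (by simp [NExp.eval, writeEntry_self, h])

theorem setRvar {a : ℕ} {v : ℝ} {x : RExp} (h : x.eval s = v) :
    Runs ω (_root_.setRvar a x) s 1 fun s' => s'.real a 0 0 = v :=
  Runs.setReal (by simp [NExp.eval, writeEntry_self, h])

/-- Sequential composition within a budget of `B` steps. -/
theorem step {c d : Prog} {T B : ℕ} {Q Q' : Memory → Prop} (h : Runs ω c s T Q) (hT : T ≤ B)
    (h' : ∀ s', Frame c s s' → Q s' → Runs ω d s' (B - T) Q') : Runs ω (.seq c d) s B Q' :=
  (h.seq h').mono (by omega) fun _ _ h => h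

end Runs

/-! ## The exponential mechanism as a program -/

/-- Select an index below `R` with the weights of real array `19`, into integer array `5`. -/
def sampleProg (R : NExp) : Prog :=
  .seq (setRvar 20 (.lit 0)) <|
  .seq (forLoop 4 R (setRvar 20 (.add (rvar 20) (.get 19 (.lit 0) (nvar 4))))) <|
  .seq (.draw 21 (.lit 0) (.lit 0)) <|
  .seq (setRvar 21 (.mul (rvar 21) (rvar 20))) <|
  .seq (setNvar 5 (.lit 0)) <|
  .seq (setRvar 22 (.get 19 (.lit 0) (.lit 0))) <|
  .loop (.and (.not (.nle R (.add (nvar 5) (.lit 1)))) (.not (.rle (rvar 21) (rvar 22)))) <|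
  .seq (setNvar 5 (.add (nvar 5) (.lit 1)))
    (setRvar 22 (.add (rvar 22) (.get 19 (.lit 0) (nvar 5))))

/-- The loop stops at the selected index by `selectIndex_eq_iff`. Exactly one random real is drawn,
which keeps the draw counter aligned with the number of selections. -/
theorem runs_sampleProg {ω : ℕ → unitInterval} {s : Memory} {R : NExp} {r : ℕ} {w : ℕ → ℝ}
    (hR : ∀ s' : Memory, s'.nat 0 = s.nat 0 → R.eval s' = r) (hr : 0 < r) (hw : ∀ k, 0 < w k)
    (hmem : ∀ k < r, s.real 19 0 k = w k) :
    Runs ω (sampleProg R) s (6 * r + 10) fun s' =>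
      s'.nat 5 0 0 = selectIndex w r (ω s.pos) ∧ s'.pos = s.pos + 1 := by
  have hw0 : ∀ k, 0 ≤ w k := fun k => (hw k).le
  have hsel := selectIndex_lt hw0 hr (ω s.pos)
  unfold sampleProg
  refine Runs.step (Runs.setRvar (v := 0) ?_) (by omega) fun s₁ f₁ h₁ => ?_
  · simp [RExp.eval]
  refine Runs.step (Runs.cellLoop (K := r) (I₀ := 0) (J₀ := 0)
    (fun k => ∑ i ∈ Finset.range k, w i) ?_ (fun _ _ => rfl) (fun _ _ => rfl) (by simpa using h₁)
    ?_) (by omega) fun s₂ f₂ h₂ => ?_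
  · intro s' f
    exact hR s' ((f.nat 0 rfl).trans (f₁.nat 0 rfl))
  · intro k hk s' f hi hv
    simp only [RExp.eval, NExp.eval, hv, hi, f.real 19 rfl, f₁.real 19 rfl, hmem k hk]
    rw [Finset.sum_range_succ]
  have p₂ : s₂.pos = s.pos := (f₂.pos rfl).trans (f₁.pos rfl)
  refine Runs.step (Q := fun s' => s'.real 21 0 0 = ω s.pos ∧ s'.pos = s.pos + 1)
    (Runs.draw (by simp [NExp.eval, writeEntry_self, p₂])) (by omega) fun s₃ f₃ h₃ => ?_
  refine Runs.step (Runs.setRvar (v := ω s.pos * ∑ i ∈ Finset.range r, w i) ?_)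
    (by omega) fun s₄ f₄ h₄ => ?_
  · simp [RExp.eval, NExp.eval, h₃.1, f₃.real 20 rfl, h₂.1]
  refine Runs.step (Runs.setNvar (v := 0) rfl) (by omega) fun s₅ f₅ h₅ => ?_
  refine Runs.step (Runs.setRvar (v := w 0) ?_) (by omega) fun s₆ f₆ h₆ => ?_
  · simp only [RExp.eval, NExp.eval, f₅.real 19 rfl, f₄.real 19 rfl, f₃.real 19 rfl,
      f₂.real 19 rfl, f₁.real 19 rfl, hmem 0 hr]
  have n₆ : s₆.nat 0 = s.nat 0 := by
    rw [f₆.nat 0 rfl, f₅.nat 0 rfl, f₄.nat 0 rfl, f₃.nat 0 rfl, f₂.nat 0 rfl, f₁.nat 0 rfl]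
  have w₆ : s₆.real 19 = s.real 19 := by
    rw [f₆.real 19 rfl, f₅.real 19 rfl, f₄.real 19 rfl, f₃.real 19 rfl, f₂.real 19 rfl,
      f₁.real 19 rfl]
  have u₆ : s₆.real 21 0 0 = ω s.pos * ∑ i ∈ Finset.range r, w i := by
    rw [f₆.real 21 rfl, f₅.real 21 rfl, h₄]
  have p₆ : s₆.pos = s.pos + 1 := by rw [f₆.pos rfl, f₅.pos rfl, f₄.pos rfl, h₃.2]
  obtain ⟨hs1, hs2⟩ := (selectIndex_eq_iff hw0 (R := r) (u := ω s.pos)).1 rfl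
  refine (Runs.loop (T := 2) (K := selectIndex w r (ω s.pos)) (fun k s' => s'.nat 5 0 0 = k ∧
    s'.real 22 0 0 = ∑ i ∈ Finset.range (k + 1), w i) ?_ ?_ ?_).mono (by omega) ?_
  · exact ⟨by rw [f₆.nat 5 rfl, h₅], by simp [h₆]⟩
  · intro k hk s' f hinv
    refine ⟨?_, ?_⟩
    · change ¬ R.eval s' ≤ s'.nat 5 0 0 + 1 ∧ ¬ s'.real 21 0 0 ≤ s'.real 22 0 0
      rw [hR s' ((f.nat 0 rfl).trans n₆), hinv.1, hinv.2, f.real 21 rfl, u₆, not_le, not_le]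
      exact hs2 k hk
    · refine Runs.step (Runs.setNvar (v := k + 1) ?_) (by omega) fun s'' f' h' => ?_
      · simp only [NExp.eval, hinv.1]
      · refine (Runs.setRvar (v := ∑ i ∈ Finset.range (k + 1 + 1), w i) ?_).mono (by omega) ?_
        · simp only [RExp.eval, NExp.eval, h', f'.real 22 rfl, f'.real 19 rfl, f.real 19 rfl, w₆,
            hinv.2, hmem (k + 1) (by omega)]
          rw [Finset.sum_range_succ _ (k + 1)]
        · intro s₃ f₃ h₃
          exact ⟨by rw [f₃.nat 5 rfl, h'], h₃⟩
  · intro s' f hinv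
    change ¬ (¬ R.eval s' ≤ s'.nat 5 0 0 + 1 ∧ ¬ s'.real 21 0 0 ≤ s'.real 22 0 0)
    rw [hR s' ((f.nat 0 rfl).trans n₆), hinv.1, hinv.2, f.real 21 rfl, u₆]
    tauto
  · intro s' f hinv
    exact ⟨hinv.1, by rw [f.pos rfl, p₆]⟩

/-! ## Preprocessing -/

/-- A further nested loop raises the degree of the step count by one and its coefficient by at most
4. -/
theorem loop_cost_le {K T B a p : ℕ} (hB : 1 ≤ B) (hK : K ≤ B) (hT : T ≤ a * B ^ p) :
    K * (T + 2) + 2 ≤ (a + 4) * B ^ (p + 1) := by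
  have h1 : 1 ≤ B ^ (p + 1) := Nat.one_le_pow _ _ hB
  have h2 : B ≤ B ^ (p + 1) := Nat.le_self_pow (by omega) B
  calc K * (T + 2) + 2 ≤ B * (a * B ^ p + 2) + 2 := by gcongr
    _ = a * B ^ (p + 1) + 2 * B + 2 := by ring
    _ ≤ _ := by nlinarith

/-- The number of coordinates. -/
abbrev expDim : NExp := .get 0 (.lit 0) (.lit 0)

/-- Twice the number of coordinates. -/
abbrev expDim2 : NExp := .add expDim expDim

/-- The number of points of the universe. -/
abbrev expCard : NExp := .get 0 (.lit 0) (.lit 1)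

/-- The number of records. -/
abbrev expSize : NExp := .get 0 (.lit 0) (.lit 2)

/-- The privacy parameter. -/
abbrev expRho : RExp := .get 0 (.lit 0) (.lit 0)

/-- The error parameter. -/
abbrev expAlpha : RExp := .get 0 (.lit 0) (.lit 1)

/-- The maximum of two real numbers. -/
abbrev expMax (x y : RExp) : RExp :=
  .div (.add (.add x y) (.sqrt (.mul (.sub x y) (.sub x y)))) (.lit 2)

/-- max(x, y) = (x + y + |x - y|)/2, with the absolute value written as the square root of a square.
-/
theorem eval_expMax (s : Memory) (x y : RExp) :
    (expMax x y).eval s = max (x.eval s) (y.eval s) := by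
  simp only [RExp.eval]
  rw [Real.sqrt_mul_self_eq_abs, Rat.cast_ofNat]
  rcases le_total (x.eval s) (y.eval s) with h | h
  · rw [abs_of_nonpos (sub_nonpos.2 h), max_eq_right h]
    ring
  · rw [abs_of_nonneg (sub_nonneg.2 h), max_eq_left h]
    ring

/-- The memory holds the instance `P` with `m` coordinates and the records `u`. -/
structure HasInput (P : Chain) (m : ℕ) (u : ℕ → ℕ) (s : Memory) : Prop where
  dim : s.nat 0 0 0 = m
  card : s.nat 0 0 1 = P.N
  size : s.nat 0 0 2 = P.n
  data : ∀ d < P.n, s.nat 1 0 d = u d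
  rho : s.real 0 0 0 = P.ρ
  alpha : s.real 0 0 1 = P.α
  dim2 : P.M = m + m

/-- The memory holds also the tables of the points and of the distances, and the radius. -/
structure HasTables (P : Chain) (m : ℕ) (u : ℕ → ℕ) (s : Memory) : Prop
    extends HasInput P m u s where
  point : ∀ i < P.N, ∀ k < P.M, s.real 3 i k = P.z i k
  dist : ∀ i < P.N, ∀ l < P.N, s.real 4 i l = rowDist P.z P.M i l
  radius : s.real 5 0 0 = P.radius

theorem HasInput.congr {P : Chain} {m : ℕ} {u : ℕ → ℕ} {s s' : Memory} (h : HasInput P m u s)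
    (h0 : s'.nat 0 = s.nat 0) (h1 : s'.nat 1 = s.nat 1) (h2 : s'.real 0 = s.real 0) :
    HasInput P m u s' :=
  ⟨by rw [h0, h.dim], by rw [h0, h.card], by rw [h0, h.size], by rw [h1]; exact h.data,
    by rw [h2, h.rho], by rw [h2, h.alpha], h.dim2⟩

theorem HasTables.congr {P : Chain} {m : ℕ} {u : ℕ → ℕ} {s s' : Memory} (h : HasTables P m u s)
    (h0 : s'.nat 0 = s.nat 0) (h1 : s'.nat 1 = s.nat 1) (h2 : s'.real 0 = s.real 0)
    (h3 : s'.real 3 = s.real 3) (h4 : s'.real 4 = s.real 4) (h5 : s'.real 5 = s.real 5) :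
    HasTables P m u s' :=
  ⟨h.toHasInput.congr h0 h1 h2, by rw [h3]; exact h.point, by rw [h4]; exact h.dist,
    by rw [h5, h.radius]⟩

/-- Store the points and their negatives in real array `3`. -/
def pointsProg : Prog :=
  forLoop 2 expCard <|
  .seq (forLoop 3 expDim (.setReal 3 (nvar 2) (nvar 3) (.get 1 (nvar 2) (nvar 3))))
    (forLoop 3 expDim (.setReal 3 (nvar 2) (.add expDim (nvar 3))
      (.sub (.lit 0) (.get 1 (nvar 2) (nvar 3)))))

/-- Store the distances of the points in real array `4`. -/
def distProg : Prog :=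
  forLoop 2 expCard <| forLoop 3 expCard <|
  .seq (.setReal 4 (nvar 2) (nvar 3) (.lit 0)) <|
  forLoop 4 expDim2 <| .setReal 4 (nvar 2) (nvar 3) <|
    expMax (.get 4 (nvar 2) (nvar 3)) (.sub (.get 3 (nvar 2) (nvar 4)) (.get 3 (nvar 3) (nvar 4)))

/-- Store the radius in real array `5`. -/
def radiusProg : Prog :=
  .seq (setRvar 5 (.lit 0)) <|
  forLoop 2 expCard (setRvar 5 (expMax (rvar 5) (.get 4 (nvar 2) (.lit 0))))

/-- Compute the tables of the points and of the distances, and the radius. -/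
def tablesProg : Prog := .seq pointsProg (.seq distProg radiusProg)

/-- Store the first point of the universe in the output. -/
def initOutputProg : Prog :=
  forLoop 3 expDim (.setReal 2 (.lit 0) (nvar 3) (.get 3 (.lit 0) (nvar 3)))

/-! ### Correctness and step counts of the preprocessing. -/

section Tables

variable {ω : ℕ → unitInterval} {s : Memory} {P : Chain} {m B : ℕ} {u : ℕ → ℕ}

theorem runs_pointsProg (h : HasInput P m u s) (hB : 1 ≤ B) (hm : m ≤ B) (hN : P.N ≤ B)
    (hz1 : ∀ i < P.N, ∀ j < m, s.real 1 i j = P.z i j)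
    (hz2 : ∀ i < P.N, ∀ j < m, -s.real 1 i j = P.z i (m + j)) :
    Runs ω pointsProg s (14 * B ^ 2) fun s' => ∀ i < P.N, ∀ k < P.M, s'.real 3 i k = P.z i k := by
  refine (Runs.forLoop (T := 10 * B) (K := P.N)
    (fun k s' => ∀ i < k, ∀ k < P.M, s'.real 3 i k = P.z i k) rfl ?_ ?_ ?_).mono ?_
    fun _ _ h => h
  · intro s' f
    simp only [NExp.eval, f.nat 0 rfl, h.card]
  · intro i hi
    omega
  · intro i hi s' f hsi inv
    have hdim : ∀ s'', s''.nat 0 = s'.nat 0 → expDim.eval s'' = m := fun s'' h' => by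
      simp only [NExp.eval, h', f.nat 0 rfl, h.dim]
    refine Runs.step (Runs.fillLoop (K := m) (I₀ := i) (J₀ := 0) (fun j => P.z i j) ?_ ?_ ?_ ?_)
      (by omega) fun s₁ f₁ h₁ => (Runs.fillLoop (K := m) (I₀ := i) (J₀ := m)
        (fun j => P.z i (m + j)) ?_ ?_ ?_ ?_).mono (by omega) ?_
    · exact fun s'' f' => hdim s'' (f'.nat 0 rfl)
    · exact fun s'' f' => by simp only [NExp.eval, f'.nat 2 rfl, hsi]
    · exact fun s'' f' => by simp [NExp.eval]
    · intro j hj s'' f' hsj _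
      simp only [RExp.eval, NExp.eval, hsj, f'.nat 2 rfl, hsi, f'.real 1 rfl, f.real 1 rfl]
      exact hz1 i hi j hj
    · exact fun s'' f' => hdim s'' ((f'.nat 0 rfl).trans (f₁.nat 0 rfl))
    · exact fun s'' f' => by simp only [NExp.eval, f'.nat 2 rfl, f₁.nat 2 rfl, hsi]
    · intro s'' f'
      simp only [NExp.eval, f'.nat 0 rfl, f₁.nat 0 rfl, f.nat 0 rfl, h.dim]
    · intro j hj s'' f' hsj _
      simp only [RExp.eval, NExp.eval, hsj, f'.nat 2 rfl, f₁.nat 2 rfl, hsi, f'.real 1 rfl,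
        f₁.real 1 rfl, f.real 1 rfl, Rat.cast_zero, zero_sub]
      exact hz2 i hi j hj
    · intro s₂ f₂ h₂ i' hi' k hk
      rw [h.dim2] at hk
      rcases Nat.lt_succ_iff_lt_or_eq.1 hi' with hlt | rfl
      · change s₂.real 3 i' k = _
        rw [h₂.2 _ _ (by omega), h₁.2 _ _ (by omega)]
        exact inv i' hlt k (by rw [h.dim2]; exact hk)
      · change s₂.real 3 i' k = _
        rcases lt_or_ge k m with hkm | hkm
        · rw [h₂.2 _ _ (by omega)]
          simpa using h₁.1 k hkm
        · have := h₂.1 (k - m) (by omega)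
          rwa [Nat.add_sub_cancel' hkm] at this
  · exact loop_cost_le (a := 10) (p := 1) hB hN (by simp)

theorem runs_distProg (h : HasInput P m u s) (hB : 1 ≤ B) (hM : P.M ≤ B) (hN : P.N ≤ B)
    (hz : ∀ i < P.N, ∀ k < P.M, s.real 3 i k = P.z i k) :
    Runs ω distProg s (14 * B ^ 3) fun s' =>
      ∀ i < P.N, ∀ l < P.N, s'.real 4 i l = rowDist P.z P.M i l := by
  refine (Runs.forLoop (T := 10 * B ^ 2) (K := P.N)
    (fun k s' => ∀ i < k, ∀ l < P.N, s'.real 4 i l = rowDist P.z P.M i l) rfl ?_ ?_ ?_).mono ?_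
    fun _ _ h => h
  · intro s' f
    simp only [NExp.eval, f.nat 0 rfl, h.card]
  · intro i hi
    omega
  · intro i hi s' f hsi inv
    refine (Runs.forLoop (T := 6 * B) (K := P.N) (fun k s'' =>
      (∀ l < k, s''.real 4 i l = rowDist P.z P.M i l) ∧
      ∀ i' < i, ∀ l, s''.real 4 i' l = s'.real 4 i' l) rfl ?_ ?_ ?_).mono ?_ ?_
    · intro s'' f'
      simp only [NExp.eval, f'.nat 0 rfl, f.nat 0 rfl, h.card]
    · exact ⟨fun l hl => by omega, fun _ _ _ => rfl⟩
    · intro l hl s₁ f₁ hsl inv₁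
      refine Runs.step (Q := fun s' => s'.real 4 i l = 0 ∧
        ∀ p q, ¬(p = i ∧ q = l) → s'.real 4 p q = s₁.real 4 p q)
        (Runs.setReal ?_) (by omega) fun s₂ f₂ h₂ => ?_
      · simp only [NExp.eval, RExp.eval, f₁.nat 2 rfl, hsi, hsl, Rat.cast_zero, writeEntry_apply]
        exact ⟨by simp, fun p q hpq => if_neg hpq⟩
      refine (Runs.cellLoop (K := P.M) (I₀ := i) (J₀ := l)
        (runMax fun k => P.z i k - P.z l k) ?_ ?_ ?_ h₂.1 ?_).mono (by omega) ?_
      · intro s₃ f₃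
        simp only [NExp.eval, f₃.nat 0 rfl, f₂.nat 0 rfl, f₁.nat 0 rfl, f.nat 0 rfl, h.dim, h.dim2]
      · intro s₃ f₃
        simp only [NExp.eval, f₃.nat 2 rfl, f₂.nat 2 rfl, f₁.nat 2 rfl, hsi]
      · intro s₃ f₃
        simp only [NExp.eval, f₃.nat 3 rfl, f₂.nat 3 rfl, hsl]
      · intro k hk s₃ f₃ hsk hv
        rw [eval_expMax]
        simp only [RExp.eval, NExp.eval, f₃.nat 2 rfl, f₂.nat 2 rfl, f₁.nat 2 rfl, hsi,
          f₃.nat 3 rfl, f₂.nat 3 rfl, hsl, hsk, hv, f₃.real 3 rfl, f₂.real 3 rfl, f₁.real 3 rfl,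
          f.real 3 rfl, hz i hi k hk, hz l hl k hk]
        rfl
      · intro s₃ f₃ h₃
        refine ⟨fun l' hl' => ?_, fun i' hi' l' => ?_⟩
        · change s₃.real 4 i l' = _
          rcases Nat.lt_succ_iff_lt_or_eq.1 hl' with hlt | rfl
          · rw [h₃.2 _ _ (by omega), h₂.2 _ _ (by omega), inv₁.1 l' hlt]
          · exact h₃.1
        · change s₃.real 4 i' l' = _
          rw [h₃.2 _ _ (by omega), h₂.2 _ _ (by omega), inv₁.2 i' hi' l']
    · exact loop_cost_le (a := 6) (p := 1) hB hN (by simp)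
    · intro s'' f' h' i' hi' l hl
      change s''.real 4 i' l = _
      rcases Nat.lt_succ_iff_lt_or_eq.1 hi' with hlt | rfl
      · rw [h'.2 i' hlt l, inv i' hlt l hl]
      · exact h'.1 l hl
  · exact loop_cost_le (a := 10) (p := 2) hB hN le_rfl

theorem runs_radiusProg (h : HasInput P m u s) (hP : 0 < P.N) (hB : 1 ≤ B) (hN : P.N ≤ B)
    (hd : ∀ i < P.N, ∀ l < P.N, s.real 4 i l = rowDist P.z P.M i l) :
    Runs ω radiusProg s (6 * B) fun s' => s'.real 5 0 0 = P.radius := by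
  refine Runs.step (Runs.setRvar (v := 0) ?_) (by omega) fun s₁ f₁ h₁ => ?_
  · simp [RExp.eval]
  refine (Runs.cellLoop (K := P.N) (I₀ := 0) (J₀ := 0)
    (runMax fun i => rowDist P.z P.M i 0) ?_ (fun _ _ => rfl) (fun _ _ => rfl) h₁ ?_).mono
    (by omega) fun _ _ h => h.1
  · intro s' f
    simp only [NExp.eval, f.nat 0 rfl, f₁.nat 0 rfl, h.card]
  · intro k hk s' f hsk hv
    rw [eval_expMax]
    simp only [RExp.eval, NExp.eval, hv, hsk, f.real 4 rfl, f₁.real 4 rfl, hd k hk 0 hP]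
    rfl

theorem runs_tablesProg (h : HasInput P m u s) (hP : 0 < P.N) (hB : 1 ≤ B) (hM : P.M ≤ B)
    (hN : P.N ≤ B) (hz1 : ∀ i < P.N, ∀ j < m, s.real 1 i j = P.z i j)
    (hz2 : ∀ i < P.N, ∀ j < m, -s.real 1 i j = P.z i (m + j)) :
    Runs ω tablesProg s (34 * B ^ 3) (HasTables P m u) := by
  have h12 : B ≤ B ^ 3 := Nat.le_self_pow (by omega) B
  have h23 : B ^ 2 ≤ B ^ 3 := Nat.pow_le_pow_right hB (by omega)
  have hm : m ≤ B := by have := h.dim2; omega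
  refine Runs.step (runs_pointsProg h hB hm hN hz1 hz2) (by omega) fun s₁ f₁ h₁ => ?_
  have i₁ := h.congr (f₁.nat 0 rfl) (f₁.nat 1 rfl) (f₁.real 0 rfl)
  refine Runs.step (runs_distProg i₁ hB hM hN h₁) (by omega) fun s₂ f₂ h₂ => ?_
  have i₂ := i₁.congr (f₂.nat 0 rfl) (f₂.nat 1 rfl) (f₂.real 0 rfl)
  refine (runs_radiusProg i₂ hP hB hN h₂).mono (by omega) fun s₃ f₃ h₃ => ?_
  exact ⟨i₂.congr (f₃.nat 0 rfl) (f₃.nat 1 rfl) (f₃.real 0 rfl),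
    by rw [f₃.real 3 rfl, f₂.real 3 rfl]; exact h₁, by rw [f₃.real 4 rfl]; exact h₂, h₃⟩

theorem runs_initOutputProg (h : HasTables P m u s) (hP : 0 < P.N) :
    Runs ω initOutputProg s (3 * m + 2) fun s' => ∀ j < m, s'.real 2 0 j = P.z 0 j := by
  refine (Runs.fillLoop (K := m) (I₀ := 0) (J₀ := 0) (fun j => P.z 0 j) ?_ (fun _ _ => rfl) ?_
    ?_).mono (by omega) fun s' f h' j hj => by simpa using h'.1 j hj
  · intro s' f
    simp only [NExp.eval, f.nat 0 rfl, h.dim]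
  · intro s' f
    simp [NExp.eval]
  · intro j hj s' f hsj _
    simp only [RExp.eval, NExp.eval, hsj, f.real 3 rfl]
    exact h.point 0 hP j (by rw [h.dim2]; omega)

end Tables

/-! ## Greedy nets as a program -/

/-- Store the map to the centers of the net whose scale is in real array `6` in integer
array `7`. -/
def netProg : Prog :=
  forLoop 2 expCard <|
  .seq (.setNat 7 (.lit 0) (nvar 2) (nvar 2)) <|
  forLoop 4 (nvar 2) <|
  .ite (.and (.and (.nle (.get 7 (.lit 0) (nvar 4)) (nvar 4))
      (.nle (nvar 4) (.get 7 (.lit 0) (nvar 4)))) (.rle (.get 4 (nvar 2) (nvar 4)) (rvar 6)))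
    (.setNat 7 (.lit 0) (nvar 2) (nvar 4)) .skip

/-- A scan that overwrites entry `i` at every suitable center keeps the last one, as in
`scanCenters`. It reads only entries below `i`, which are already final. -/
theorem runs_netProg {ω : ℕ → unitInterval} {s : Memory} {P : Chain} {m B : ℕ} {u : ℕ → ℕ} {t : ℝ}
    (h : HasTables P m u s) (hB : 1 ≤ B) (hN : P.N ≤ B) (ht : s.real 6 0 0 = t) :
    Runs ω netProg s (12 * B ^ 2) fun s' =>
      ∀ i < P.N, s'.nat 7 0 i = netMap (rowDist P.z P.M) t i := by
  set c := netMap (rowDist P.z P.M) t with hc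
  refine (Runs.forLoop (T := 7 * B) (K := P.N) (fun k s' => ∀ i < k, s'.nat 7 0 i = c i) rfl
    ?_ ?_ ?_).mono ?_ fun _ _ h => h
  · intro s' f
    simp only [NExp.eval, f.nat 0 rfl, h.card]
  · intro i hi
    omega
  · intro i hi s' f hsi inv
    refine Runs.step (Q := fun s₁ => s₁.nat 7 0 i = i ∧ ∀ l < i, s₁.nat 7 0 l = c l)
      (Runs.setNat ?_) (by omega) fun s₁ f₁ h₁ => ?_
    · simp only [NExp.eval, hsi, writeEntry_apply]
      exact ⟨by simp, fun l hl => by rw [if_neg (by omega), inv l hl]⟩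
    refine (Runs.forLoop (T := 2) (K := i) (fun k s₂ =>
      s₂.nat 7 0 i = scanCenters (rowDist P.z P.M) t c i k ∧ ∀ l < i, s₂.nat 7 0 l = c l) rfl
      ?_ ?_ ?_).mono (by omega) ?_
    · intro s₂ f₂
      simp only [NExp.eval, f₂.nat 2 rfl, f₁.nat 2 rfl, hsi]
    · simp only [writeEntry_of_ne s₁.nat 0 0 0 (show (7 : ℕ) ≠ 4 by omega)]
      exact h₁
    · intro l hl s₂ f₂ hsl inv₂
      have hcond : BExp.eval s₂ (.and (.and (.nle (.get 7 (.lit 0) (nvar 4)) (nvar 4))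
          (.nle (nvar 4) (.get 7 (.lit 0) (nvar 4)))) (.rle (.get 4 (nvar 2) (nvar 4)) (rvar 6))) ↔
          c l = l ∧ rowDist P.z P.M i l ≤ t := by
        simp only [BExp.eval, NExp.eval, RExp.eval, hsl, inv₂.2 l hl, f₂.nat 2 rfl, f₁.nat 2 rfl,
          hsi, f₂.real 4 rfl, f₁.real 4 rfl, f.real 4 rfl, h.dist i hi l (hl.trans hi),
          f₂.real 6 rfl, f₁.real 6 rfl, f.real 6 rfl, ht]
        rw [← le_antisymm_iff]
      refine Runs.ite (fun hb => Runs.setNat ?_) fun hb => Runs.skip ?_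
      · have hb' := hcond.1 hb
        simp only [NExp.eval, f₂.nat 2 rfl, f₁.nat 2 rfl, hsi, hsl,
          writeEntry_of_ne _ 0 0 (l + 1) (show (7 : ℕ) ≠ 4 by omega), writeEntry_apply, scanCenters]
        refine ⟨by simp [hb'], fun l' hl' => ?_⟩
        rw [if_neg (by omega)]
        exact inv₂.2 l' hl'
      · have hb' := mt hcond.2 hb
        simp only [writeEntry_of_ne _ 0 0 (l + 1) (show (7 : ℕ) ≠ 4 by omega), scanCenters]
        rw [if_neg hb']
        exact inv₂
    · intro s₂ f₂ h₂ i' hi'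
      simp only [writeEntry_of_ne _ 0 0 (i + 1) (show (7 : ℕ) ≠ 2 by omega)]
      rcases Nat.lt_succ_iff_lt_or_eq.1 hi' with hlt | rfl
      · exact h₂.2 i' hlt
      · rw [h₂.1, hc, ← netMap_eq]
  · exact (loop_cost_le (a := 7) (p := 1) hB hN (by simp)).trans (by gcongr; omega)

/-! ## Noisy histograms as a program -/

/-- The number of options for a count. -/
abbrev expSize1 : NExp := .add expSize (.lit 1)

/-- Count the records equal to point `i`, where `i` is in integer array `2`. -/
def countProg : Prog :=
  .seq (setRvar 23 (.lit 0)) <|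
  forLoop 4 expSize <| setRvar 23 <| .add (rvar 23) <| .cast <|
    .sub (.lit 1) (.add (.sub (.get 1 (.lit 0) (nvar 4)) (nvar 2))
      (.sub (nvar 2) (.get 1 (.lit 0) (nvar 4))))

/-- Store the weights of the candidates for a count in real array `19`. -/
def countWeightsProg : Prog :=
  forLoop 3 expSize1 <| .setReal 19 (.lit 0) (nvar 3) <| .exp <| .sub (.lit 0) <|
    .mul (.sqrt expRho) <| .sqrt <| .mul (.sub (.cast (nvar 3)) (rvar 23))
      (.sub (.cast (nvar 3)) (rvar 23))

/-- Add the contribution of point `i` to the output. -/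
def histUpdateProg : Prog :=
  forLoop 3 expDim <| .setReal 2 (.lit 0) (nvar 3) <| .add (.get 2 (.lit 0) (nvar 3)) <|
    .mul (.div (.cast (nvar 5)) (.cast expSize))
      (.sub (.get 3 (nvar 2) (nvar 3)) (.get 3 (.lit 0) (nvar 3)))

/-- Output the mean of a noisy histogram of the records. -/
def histProg : Prog :=
  .seq initOutputProg <| forLoop 2 expCard <|
  .seq countProg <| .seq countWeightsProg <| .seq (sampleProg expSize1) histUpdateProg

/-! ### Correctness and step counts of the histogram program. -/

section Hist

variable {ω : ℕ → unitInterval} {s : Memory} {P : Chain} {m B : ℕ} {u : ℕ → ℕ}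

theorem runs_countProg (h : HasInput P m u s) {i : ℕ} (hi : s.nat 2 0 0 = i) :
    Runs ω countProg s (3 * P.n + 3) fun s' => s'.real 23 0 0 = P.count u i := by
  refine Runs.step (Runs.setRvar (v := 0) ?_) (by omega) fun s₁ f₁ h₁ => ?_
  · simp [RExp.eval]
  refine (Runs.cellLoop (K := P.n) (I₀ := 0) (J₀ := 0)
    (fun k => ∑ d ∈ Finset.range k, if u d = i then (1 : ℝ) else 0) ?_ (fun _ _ => rfl)
    (fun _ _ => rfl) (by simpa using h₁) ?_).mono (by omega) ?_
  · intro s' f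
    simp only [NExp.eval, f.nat 0 rfl, f₁.nat 0 rfl, h.size]
  · intro k hk s' f hsk hv
    simp only [RExp.eval, NExp.eval, hv, hsk, f.nat 1 rfl, f₁.nat 1 rfl, h.data k hk, f.nat 2 rfl,
      f₁.nat 2 rfl, hi]
    rw [Finset.sum_range_succ]
    congr 1
    -- In truncated arithmetic 1 - ((x - i) + (i - x)) is the indicator of x = i.
    split_ifs with hui
    · simp [hui]
    · have : 1 - (u k - i + (i - u k)) = 0 := by omega
      rw [this, Nat.cast_zero]
  · intro s' f h'
    rw [h'.1, P.count_cast]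

theorem runs_countWeightsProg (h : HasInput P m u s) {i : ℕ} (hc : s.real 23 0 0 = P.count u i)
    (κ : ℕ → ℕ) :
    Runs ω countWeightsProg s (3 * P.n + 5) fun s' =>
      ∀ k < P.n + 1, s'.real 19 0 k = Real.exp (P.histLogit u κ i k) := by
  refine (Runs.fillLoop (K := P.n + 1) (I₀ := 0) (J₀ := 0)
    (fun k => Real.exp (P.histLogit u κ i k)) ?_ (fun _ _ => rfl) ?_ ?_).mono (by omega)
    fun s' f h' j hj => by simpa using h'.1 j hj
  · intro s' f
    simp only [NExp.eval, f.nat 0 rfl, h.size]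
  · intro s' f
    simp [NExp.eval]
  · intro k hk s' f hsk _
    simp only [RExp.eval, NExp.eval, hsk, f.real 23 rfl, hc, f.real 0 rfl, h.rho,
      Rat.cast_zero, zero_sub, Chain.histLogit]
    rw [Real.sqrt_mul_self_eq_abs]

theorem runs_histUpdateProg (h : HasTables P m u s) (hP : 0 < P.N) {i k : ℕ} (hi : i < P.N)
    (hsi : s.nat 2 0 0 = i) (hsk : s.nat 5 0 0 = k) :
    Runs ω histUpdateProg s (3 * m + 2) fun s' => ∀ j < m, s'.real 2 0 j =
      s.real 2 0 j + (k : ℝ) / P.n * (P.z i j - P.z 0 j) := by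
  refine (Runs.fillLoop (K := m) (I₀ := 0) (J₀ := 0)
    (fun j => s.real 2 0 j + (k : ℝ) / P.n * (P.z i j - P.z 0 j)) ?_ (fun _ _ => rfl) ?_
    ?_).mono (by omega) fun s' f h' j hj => by simpa using h'.1 j hj
  · intro s' f
    simp only [NExp.eval, f.nat 0 rfl, h.dim]
  · intro s' f
    simp [NExp.eval]
  · intro j hj s' f hsj hv
    have hjM : j < P.M := by rw [h.dim2]; omega
    rw [zero_add] at hv
    simp only [RExp.eval, NExp.eval, hsj, hv, f.nat 5 rfl, hsk, f.nat 0 rfl, h.size, f.nat 2 rfl,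
      hsi, f.real 3 rfl, h.point i hi j hjM, h.point 0 hP j hjM]

theorem runs_histProg (h : HasTables P m u s) (hP : 0 < P.N) (hB : 1 ≤ B) (hM : P.M ≤ B)
    (hN : P.N ≤ B) (hn : P.n ≤ B) (hpos : s.pos = 0) :
    Runs ω histProg s (60 * B ^ 2) fun s' => ∀ j < m, s'.real 2 0 j =
      P.histOutput P.N (selectionSeq (P.histLogit u) (P.n + 1) ω) j := by
  set κ := selectionSeq (P.histLogit u) (P.n + 1) ω with hκ
  have hm : m ≤ B := by have := h.dim2; omega
  have h12 : B ≤ B ^ 2 := Nat.le_self_pow (by omega) B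
  refine Runs.step (runs_initOutputProg h hP) (by omega) fun s₁ f₁ h₁ => ?_
  have i₁ := h.congr (f₁.nat 0 rfl) (f₁.nat 1 rfl) (f₁.real 0 rfl) (f₁.real 3 rfl) (f₁.real 4 rfl)
    (f₁.real 5 rfl)
  refine (Runs.forLoop (T := 46 * B) (K := P.N) (fun i s' =>
    (∀ j < m, s'.real 2 0 j = P.histOutput i κ j) ∧ s'.pos = i) rfl ?_ ?_ ?_).mono ?_
    fun _ _ h => h.1
  · intro s' f
    simp only [NExp.eval, f.nat 0 rfl, i₁.card]
  · refine ⟨fun j hj => ?_, by rw [f₁.pos rfl, hpos]⟩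
    rw [Chain.histOutput, Finset.sum_range_zero, add_zero]
    exact h₁ j hj
  · intro i hi s₂ f₂ hsi inv
    have i₂ := i₁.congr (f₂.nat 0 rfl) (f₂.nat 1 rfl) (f₂.real 0 rfl) (f₂.real 3 rfl)
      (f₂.real 4 rfl) (f₂.real 5 rfl)
    refine Runs.step (runs_countProg i₂.toHasInput hsi) (by omega) fun s₃ f₃ h₃ => ?_
    have i₃ := i₂.congr (f₃.nat 0 rfl) (f₃.nat 1 rfl) (f₃.real 0 rfl) (f₃.real 3 rfl)
      (f₃.real 4 rfl) (f₃.real 5 rfl)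
    refine Runs.step (runs_countWeightsProg i₃.toHasInput h₃ κ) (by omega) fun s₄ f₄ h₄ => ?_
    have i₄ := i₃.congr (f₄.nat 0 rfl) (f₄.nat 1 rfl) (f₄.real 0 rfl) (f₄.real 3 rfl)
      (f₄.real 4 rfl) (f₄.real 5 rfl)
    refine Runs.step (runs_sampleProg (r := P.n + 1)
      (w := fun k => Real.exp (P.histLogit u κ i k)) ?_ (Nat.succ_pos _) (fun _ => Real.exp_pos _)
      h₄) (by omega) fun s₅ f₅ h₅ => ?_
    · intro s' h0
      simp only [NExp.eval, h0, i₄.size]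
    have i₅ := i₄.congr (f₅.nat 0 rfl) (f₅.nat 1 rfl) (f₅.real 0 rfl) (f₅.real 3 rfl)
      (f₅.real 4 rfl) (f₅.real 5 rfl)
    have p₄ : s₄.pos = i := by rw [f₄.pos rfl, f₃.pos rfl, inv.2]
    -- Before point `i` exactly `i` random reals have been used, so the draw is the one that defines
    -- selection number `i`.
    have hk : s₅.nat 5 0 0 = κ i := by
      rw [h₅.1, p₄, hκ, selectionSeq_eq (P.histLogit_adapted u), ← hκ]
    refine (runs_histUpdateProg i₅ hP hi (k := κ i) ?_ hk).mono (by omega) fun s₆ f₆ h₆ => ?_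
    · rw [f₅.nat 2 rfl, f₄.nat 2 rfl, f₃.nat 2 rfl, hsi]
    · refine ⟨fun j hj => ?_, ?_⟩
      · change s₆.real 2 0 j = _
        rw [h₆ j hj, f₅.real 2 rfl, f₄.real 2 rfl, f₃.real 2 rfl, inv.1 j hj, Chain.histOutput,
          Chain.histOutput, Finset.sum_range_succ, add_assoc]
      · change s₆.pos = i + 1
        rw [f₆.pos rfl, h₅.2, p₄]
  · have := loop_cost_le (K := P.N) (T := 46 * B) (a := 46) (p := 1) hB hN (by simp)
    have h1 : (46 + 4) * B ^ (1 + 1) = 50 * B ^ 2 := by ring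
    omega

end Hist

/-! ## Chaining as a program -/

/-- The displacement of point `i` in coordinate `k`. -/
abbrev expDisp (i k : NExp) : RExp := .sub (.get 3 i k) (.get 3 (.get 7 (.lit 0) i) k)

/-- Store the indicator of the centers in real array `8`. -/
def centersProg : Prog :=
  forLoop 2 expCard <| .setReal 8 (.lit 0) (nvar 2) <| .cast <|
    .sub (.lit 1) (.sub (nvar 2) (.get 7 (.lit 0) (nvar 2)))

/-- Store the number of centers in real array `9`. -/
def numCentersProg : Prog :=
  .seq (setRvar 9 (.lit 0)) <|
  forLoop 2 expCard <| setRvar 9 (.add (rvar 9) (.get 8 (.lit 0) (nvar 2)))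

/-- Store the average displacement of the records in real array `10`. -/
def avgDispProg : Prog :=
  forLoop 3 expDim2 <|
  .seq (.setReal 10 (.lit 0) (nvar 3) (.lit 0)) <|
  .seq (forLoop 4 expSize <| .setReal 10 (.lit 0) (nvar 3) <|
    .add (.get 10 (.lit 0) (nvar 3)) (expDisp (.get 9 (.lit 0) (nvar 4)) (nvar 3))) <|
  .setReal 10 (.lit 0) (nvar 3) (.div (.get 10 (.lit 0) (nvar 3)) (.cast expSize))

/-- Compute the parameters of a level. -/
def paramsProg : Prog :=
  .seq (setRvar 13 (.div (.mul (.mul (.mul (.lit 64) (.mul (rvar 7) (rvar 7)))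
    (.mul (rvar 6) (rvar 6))) (.log (rvar 9))) (.mul expAlpha expAlpha))) <|
  .seq (setRvar 14 (.div expAlpha (.mul (.mul (.lit 8) (rvar 7)) (.mul (rvar 6) (rvar 6))))) <|
  setRvar 15 (.div (.mul (.cast expSize) (.sqrt (.div expRho (.mul (rvar 7) (rvar 13)))))
    (.mul (.lit 2) (rvar 6)))

/-- Set the gains and the accumulated estimates to `0`. -/
def clearProg : Prog :=
  .seq (forLoop 2 expCard (.setReal 11 (.lit 0) (nvar 2) (.lit 0))) <|
  .seq (forLoop 3 expDim2 (.setReal 12 (.lit 0) (nvar 3) (.lit 0))) <|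
  setNvar 6 (.lit 0)

/-- Store the weights of the points in real array `16` and their total in real array `17`. -/
def mwWeightsProg : Prog :=
  .seq (forLoop 2 expCard <| .setReal 16 (.lit 0) (nvar 2) <|
    .mul (.get 8 (.lit 0) (nvar 2)) (.exp (.mul (rvar 14) (.get 11 (.lit 0) (nvar 2))))) <|
  .seq (setRvar 17 (.lit 0)) <|
  forLoop 2 expCard <| setRvar 17 (.add (rvar 17) (.get 16 (.lit 0) (nvar 2)))

/-- Compute the current estimate, accumulate it in real array `12`, and store the weights of the
selection in real array `19`. -/
def estimateProg : Prog :=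
  forLoop 3 expDim2 <|
  .seq (.setReal 18 (.lit 0) (nvar 3) (.lit 0)) <|
  .seq (forLoop 4 expCard <| .setReal 18 (.lit 0) (nvar 3) <| .add (.get 18 (.lit 0) (nvar 3)) <|
    .mul (.get 16 (.lit 0) (nvar 4)) (expDisp (nvar 4) (nvar 3))) <|
  .seq (.setReal 18 (.lit 0) (nvar 3) (.div (.get 18 (.lit 0) (nvar 3)) (rvar 17))) <|
  .seq (.setReal 12 (.lit 0) (nvar 3)
    (.add (.get 12 (.lit 0) (nvar 3)) (.get 18 (.lit 0) (nvar 3)))) <|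
  .setReal 19 (.lit 0) (nvar 3) (.exp (.mul (rvar 15)
    (.sub (.get 10 (.lit 0) (nvar 3)) (.get 18 (.lit 0) (nvar 3)))))

/-- Update the gains. -/
def gainProg : Prog :=
  forLoop 2 expCard <| .setReal 11 (.lit 0) (nvar 2) <|
    .add (.get 11 (.lit 0) (nvar 2)) (expDisp (nvar 2) (nvar 5))

/-- One round of a level. -/
def roundProg : Prog :=
  .seq mwWeightsProg <| .seq estimateProg <| .seq (sampleProg expDim2) <| .seq gainProg <|
  setNvar 6 (.add (nvar 6) (.lit 1))

/-- Add the average estimate of a level to the output. -/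
def addOutputProg : Prog :=
  forLoop 3 expDim <| .setReal 2 (.lit 0) (nvar 3) <|
    .add (.get 2 (.lit 0) (nvar 3)) (.div (.get 12 (.lit 0) (nvar 3)) (.cast (nvar 6)))

/-- Round the records to the centers. -/
def roundDataProg : Prog :=
  forLoop 4 expSize <| .setNat 9 (.lit 0) (nvar 4) (.get 7 (.lit 0) (.get 9 (.lit 0) (nvar 4)))

/-- The rounds of a level. -/
def roundsProg : Prog := .loop (.not (.rle (rvar 13) (.cast (nvar 6)))) roundProg

/-- Prepare the rounds of a level. -/
def setupProg : Prog :=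
  .seq centersProg <| .seq numCentersProg <| .seq (setRvar 6 (.mul (.lit 2) (rvar 6))) <|
  .seq netProg <| .seq avgDispProg <| .seq paramsProg clearProg

/-- One level of chaining. -/
def levelProg : Prog :=
  .seq setupProg <| .seq roundsProg <| .seq addOutputProg roundDataProg

/-- Round the records to the centers of the first net. -/
def initDataProg : Prog :=
  forLoop 4 expSize <| .setNat 9 (.lit 0) (nvar 4) (.get 7 (.lit 0) (.get 1 (.lit 0) (nvar 4)))

/-- Prepare the levels. -/
def initProg : Prog :=
  .seq initOutputProg <|
  .seq (setRvar 7 (.add (.lit 2)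
    (.mul (.lit 2) (.log (.div (.mul (.lit 2) (rvar 5)) expAlpha))))) <|
  .seq (setRvar 6 (.div expAlpha (.lit 2))) <| .seq netProg initDataProg

/-- Chaining. -/
def chainProg : Prog := .seq initProg (.loop (.not (.rle (rvar 5) (rvar 6))) levelProg)

/-- The memory is ready for the rounds of level `l`. -/
structure LevelReady (P : Chain) (m : ℕ) (u : ℕ → ℕ) (l : ℕ) (s : Memory) : Prop
    extends HasTables P m u s where
  center : ∀ i < P.N, s.nat 7 0 i = P.center (l + 1) i
  rounded : ∀ d < P.n, s.nat 9 0 d = P.rounding l (u d)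
  isCenter : ∀ i < P.N, s.real 8 0 i = P.isCenter l i
  avgDisp : ∀ k < P.M, s.real 10 0 k = P.avgDisp u l k
  roundsBound : s.real 13 0 0 = P.roundsBound l
  rate : s.real 14 0 0 = P.rate l
  invTemp : s.real 15 0 0 = P.invTemp l

/-! ### Correctness and step counts of the parts of a level. -/

section Level

variable {ω : ℕ → unitInterval} {s : Memory} {P : Chain} {m B : ℕ} {u : ℕ → ℕ} {l : ℕ}

theorem LevelReady.congr {s' : Memory} (h : LevelReady P m u l s)
    (h0 : s'.nat 0 = s.nat 0) (h1 : s'.nat 1 = s.nat 1) (h2 : s'.real 0 = s.real 0)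
    (h3 : s'.real 3 = s.real 3) (h4 : s'.real 4 = s.real 4) (h5 : s'.real 5 = s.real 5)
    (h6 : s'.nat 7 = s.nat 7) (h7 : s'.nat 9 = s.nat 9) (h8 : s'.real 8 = s.real 8)
    (h9 : s'.real 10 = s.real 10) (h10 : s'.real 13 = s.real 13) (h11 : s'.real 14 = s.real 14)
    (h12 : s'.real 15 = s.real 15) : LevelReady P m u l s' :=
  ⟨h.toHasTables.congr h0 h1 h2 h3 h4 h5, by rw [h6]; exact h.center, by rw [h7]; exact h.rounded,
    by rw [h8]; exact h.isCenter, by rw [h9]; exact h.avgDisp, by rw [h10, h.roundsBound],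
    by rw [h11, h.rate], by rw [h12, h.invTemp]⟩

theorem HasInput.eval_dim2 (h : HasInput P m u s) {s' : Memory} (h0 : s'.nat 0 = s.nat 0) :
    expDim2.eval s' = P.M := by
  simp only [NExp.eval, h0, h.dim, h.dim2]

theorem HasInput.eval_card (h : HasInput P m u s) {s' : Memory} (h0 : s'.nat 0 = s.nat 0) :
    expCard.eval s' = P.N := by
  simp only [NExp.eval, h0, h.card]

theorem HasInput.eval_size (h : HasInput P m u s) {s' : Memory} (h0 : s'.nat 0 = s.nat 0) :
    expSize.eval s' = P.n := by
  simp only [NExp.eval, h0, h.size]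

theorem runs_centersProg (h : HasInput P m u s)
    (hc : ∀ i < P.N, s.nat 7 0 i = P.center l i) :
    Runs ω centersProg s (3 * P.N + 2) fun s' => ∀ i < P.N, s'.real 8 0 i = P.isCenter l i := by
  refine (Runs.fillLoop (K := P.N) (I₀ := 0) (J₀ := 0) (P.isCenter l) ?_ (fun _ _ => rfl) ?_
    ?_).mono (by omega) fun s' f h' i hi => by simpa using h'.1 i hi
  · exact fun s' f => h.eval_card (f.nat 0 rfl)
  · intro s' f
    simp [NExp.eval]
  · intro i hi s' f hsi _
    simp only [RExp.eval, NExp.eval, hsi, f.nat 7 rfl, hc i hi, Chain.isCenter]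
    -- Since centers never exceed their index, the truncated difference 1 - (i - center) is the
    -- indicator of center = i.
    have hle := P.center_le l i
    split_ifs with hci
    · rw [hci]
      simp
    · have : 1 - (i - P.center l i) = 0 := by omega
      rw [this, Nat.cast_zero]

theorem runs_numCentersProg (h : HasInput P m u s)
    (hb : ∀ i < P.N, s.real 8 0 i = P.isCenter l i) :
    Runs ω numCentersProg s (3 * P.N + 3) fun s' => s'.real 9 0 0 = P.numCenters l := by
  refine Runs.step (Runs.setRvar (v := 0) ?_) (by omega) fun s₁ f₁ h₁ => ?_
  · simp [RExp.eval]
  refine (Runs.cellLoop (K := P.N) (I₀ := 0) (J₀ := 0)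
    (fun k => ∑ i ∈ Finset.range k, P.isCenter l i) ?_ (fun _ _ => rfl)
    (fun _ _ => rfl) (by simpa using h₁) ?_).mono (by omega) fun _ _ h' => h'.1
  · exact fun s' f => h.eval_card ((f.nat 0 rfl).trans (f₁.nat 0 rfl))
  · intro k hk s' f hsk hv
    simp only [RExp.eval, NExp.eval, hv, hsk, f.real 8 rfl, f₁.real 8 rfl, hb k hk]
    rw [Finset.sum_range_succ]

theorem eval_expDisp (h : HasTables P m u s) (hc : ∀ i < P.N, s.nat 7 0 i = P.center (l + 1) i)
    {s' : Memory} (h3 : s'.real 3 = s.real 3) (h7 : s'.nat 7 = s.nat 7) {x y : NExp} {i k : ℕ}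
    (hx : x.eval s' = i) (hy : y.eval s' = k) (hi : i < P.N) (hk : k < P.M) :
    (expDisp x y).eval s' = P.disp l i k := by
  simp only [RExp.eval, NExp.eval, hx, hy, h3, h7, hc i hi, h.point i hi k hk,
    h.point _ ((P.center_le _ _).trans_lt hi) k hk, Chain.disp]

theorem runs_avgDispProg (h : HasTables P m u s) (hB : 1 ≤ B) (hM : P.M ≤ B) (hn : P.n ≤ B)
    (hu : ∀ d < P.n, u d < P.N)
    (hc : ∀ i < P.N, s.nat 7 0 i = P.center (l + 1) i)
    (ha : ∀ d < P.n, s.nat 9 0 d = P.rounding l (u d)) :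
    Runs ω avgDispProg s (11 * B ^ 2) fun s' =>
      ∀ k < P.M, s'.real 10 0 k = P.avgDisp u l k := by
  refine (Runs.forLoop (T := 7 * B) (K := P.M) (fun k s' =>
    ∀ k' < k, s'.real 10 0 k' = P.avgDisp u l k') rfl ?_ ?_ ?_).mono
    (loop_cost_le (a := 7) (p := 1) hB hM (by simp)) fun _ _ h => h
  · exact fun s' f => h.eval_dim2 (f.nat 0 rfl)
  · intro k hk
    omega
  · intro k hk s₁ f₁ hsk inv
    refine Runs.step (Q := fun s' => s'.real 10 0 k = 0 ∧
      ∀ k' < k, s'.real 10 0 k' = P.avgDisp u l k') (Runs.setReal ?_) (by omega)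
      fun s₂ f₂ h₂ => ?_
    · simp only [RExp.eval, NExp.eval, hsk, Rat.cast_zero, writeEntry_apply]
      exact ⟨by simp, fun k' hk' => by rw [if_neg (by omega), inv k' hk']⟩
    refine Runs.step (Runs.cellLoop (K := P.n) (I₀ := 0) (J₀ := k)
      (fun j => ∑ d ∈ Finset.range j, P.disp l (P.rounding l (u d)) k) ?_ (fun _ _ => rfl) ?_
      (by simpa using h₂.1) ?_) (by omega) fun s₃ f₃ h₃ => ?_
    · exact fun s' f => h.eval_size ((f.nat 0 rfl).trans ((f₂.nat 0 rfl).trans (f₁.nat 0 rfl)))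
    · intro s' f
      simp only [NExp.eval, f.nat 3 rfl, f₂.nat 3 rfl, hsk]
    · intro d hd s' f hsd hv
      have hk' : (nvar 3).eval s' = k := by simp only [NExp.eval, f.nat 3 rfl, f₂.nat 3 rfl, hsk]
      have hd' : (NExp.get 9 (.lit 0) (nvar 4)).eval s' = P.rounding l (u d) := by
        simp only [NExp.eval, hsd, f.nat 9 rfl, f₂.nat 9 rfl, f₁.nat 9 rfl, ha d hd]
      have hdisp := eval_expDisp h hc (s' := s')
        ((f.real 3 rfl).trans ((f₂.real 3 rfl).trans (f₁.real 3 rfl)))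
        ((f.nat 7 rfl).trans ((f₂.nat 7 rfl).trans (f₁.nat 7 rfl))) hd' hk'
        (P.rounding_spec l (hu d hd)).1 hk
      rw [RExp.eval, hdisp, RExp.eval, hk', NExp.eval, hv, Finset.sum_range_succ]
    · refine (Runs.setReal (Q := fun s' => ∀ k' < k + 1, s'.real 10 0 k' = P.avgDisp u l k')
        ?_).mono (by omega) fun _ _ h' => h'
      intro k' hk'
      simp only [RExp.eval, NExp.eval, f₃.nat 3 rfl, f₂.nat 3 rfl, hsk, f₃.nat 0 rfl, f₂.nat 0 rfl,
        f₁.nat 0 rfl, h.size, h₃.1, writeEntry_apply]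
      rcases Nat.lt_succ_iff_lt_or_eq.1 hk' with hlt | rfl
      · rw [if_neg (by omega), h₃.2 _ _ (by omega), h₂.2 k' hlt]
      · simp [Chain.avgDisp]

theorem runs_paramsProg (h : HasInput P m u s) (h7 : s.real 7 0 0 = P.depth)
    (h6 : s.real 6 0 0 = P.scale (l + 1)) (h9 : s.real 9 0 0 = P.numCenters l) :
    Runs ω paramsProg s 3 fun s' => s'.real 13 0 0 = P.roundsBound l ∧
      s'.real 14 0 0 = P.rate l ∧ s'.real 15 0 0 = P.invTemp l := by
  refine Runs.step (Runs.setRvar (v := P.roundsBound l) ?_) (by omega) fun s₁ f₁ h₁ => ?_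
  · simp [RExp.eval, NExp.eval, h7, h6, h9, h.alpha, Chain.roundsBound]
  refine Runs.step (Runs.setRvar (v := P.rate l) ?_) (by omega) fun s₂ f₂ h₂ => ?_
  · simp [RExp.eval, NExp.eval, f₁.real 7 rfl, f₁.real 6 rfl, f₁.real 0 rfl, h7, h6, h.alpha,
      Chain.rate]
  refine (Runs.setRvar (v := P.invTemp l) ?_).mono (by omega) fun s₃ f₃ h₃ => ?_
  · simp [RExp.eval, NExp.eval, f₂.real 7 rfl, f₁.real 7 rfl, f₂.real 6 rfl, f₁.real 6 rfl,
      f₂.real 0 rfl, f₁.real 0 rfl, f₂.real 13 rfl, h₁, f₂.nat 0 rfl, f₁.nat 0 rfl, h7, h6, h.rho,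
      h.size, Chain.invTemp]
  · exact ⟨by rw [f₃.real 13 rfl, f₂.real 13 rfl, h₁], by rw [f₃.real 14 rfl, h₂], h₃⟩

theorem runs_clearProg (h : HasInput P m u s) :
    Runs ω clearProg s (3 * P.N + 3 * P.M + 5) fun s' => (∀ i < P.N, s'.real 11 0 i = 0) ∧
      (∀ k < P.M, s'.real 12 0 k = 0) ∧ s'.nat 6 0 0 = 0 := by
  refine Runs.step (Runs.fillLoop (K := P.N) (I₀ := 0) (J₀ := 0) (fun _ => 0) ?_
    (fun _ _ => rfl) ?_ ?_) (by omega) fun s₁ f₁ h₁ => ?_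
  · exact fun s' f => h.eval_card (f.nat 0 rfl)
  · intro s' f
    simp [NExp.eval]
  · intro i hi s' f _ _
    simp [RExp.eval]
  refine Runs.step (Runs.fillLoop (K := P.M) (I₀ := 0) (J₀ := 0) (fun _ => 0) ?_
    (fun _ _ => rfl) ?_ ?_) (by omega) fun s₂ f₂ h₂ => ?_
  · exact fun s' f => h.eval_dim2 ((f.nat 0 rfl).trans (f₁.nat 0 rfl))
  · intro s' f
    simp [NExp.eval]
  · intro i hi s' f _ _
    simp [RExp.eval]
  refine (Runs.setNvar (v := 0) rfl).mono (by omega) fun s₃ f₃ h₃ => ?_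
  refine ⟨fun i hi => ?_, fun k hk => ?_, h₃⟩
  · rw [f₃.real 11 rfl, f₂.real 11 rfl]
    simpa using h₁.1 i hi
  · rw [f₃.real 12 rfl]
    simpa using h₂.1 k hk

theorem runs_mwWeightsProg (h : LevelReady P m u l s) {g : ℕ → ℝ}
    (hg : ∀ i < P.N, s.real 11 0 i = g i) :
    Runs ω mwWeightsProg s (6 * P.N + 5) fun s' =>
      (∀ i < P.N, s'.real 16 0 i = P.isCenter l i * Real.exp (P.rate l * g i)) ∧
      s'.real 17 0 0 = mwTotal P.N (P.isCenter l) (P.rate l) g := by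
  refine Runs.step (Runs.fillLoop (K := P.N) (I₀ := 0) (J₀ := 0)
    (fun i => P.isCenter l i * Real.exp (P.rate l * g i)) ?_
    (fun _ _ => rfl) ?_ ?_) (by omega) fun s₁ f₁ h₁ => ?_
  · exact fun s' f => h.eval_card (f.nat 0 rfl)
  · intro s' f
    simp [NExp.eval]
  · intro i hi s' f hsi _
    simp only [RExp.eval, NExp.eval, hsi, f.real 8 rfl, f.real 11 rfl, f.real 14 rfl, h.rate,
      h.isCenter i hi, hg i hi]
  have h₁' : ∀ i < P.N, s₁.real 16 0 i = P.isCenter l i * Real.exp (P.rate l * g i) :=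
    fun i hi => by simpa using h₁.1 i hi
  refine Runs.step (Runs.setRvar (v := 0) ?_) (by omega) fun s₂ f₂ h₂ => ?_
  · simp [RExp.eval]
  refine (Runs.cellLoop (K := P.N) (I₀ := 0) (J₀ := 0)
    (fun k => ∑ i ∈ Finset.range k, P.isCenter l i * Real.exp (P.rate l * g i)) ?_
    (fun _ _ => rfl) (fun _ _ => rfl) (by simpa using h₂) ?_).mono (by omega) fun s₃ f₃ h₃ => ?_
  · exact fun s' f => h.eval_card ((f.nat 0 rfl).trans ((f₂.nat 0 rfl).trans (f₁.nat 0 rfl)))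
  · intro k hk s' f hsk hv
    simp only [RExp.eval, NExp.eval, hv, hsk, f.real 16 rfl, f₂.real 16 rfl, h₁' k hk]
    rw [Finset.sum_range_succ]
  · exact ⟨fun i hi => by rw [f₃.real 16 rfl, f₂.real 16 rfl, h₁' i hi], h₃.1⟩

theorem runs_estimateProg (h : LevelReady P m u l s) (hB : 1 ≤ B) (hM : P.M ≤ B) (hN : P.N ≤ B)
    {g acc y : ℕ → ℝ} (hacc : ∀ k < P.M, s.real 12 0 k = acc k)
    (hw : ∀ i < P.N, s.real 16 0 i = P.isCenter l i * Real.exp (P.rate l * g i))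
    (hZ : s.real 17 0 0 = mwTotal P.N (P.isCenter l) (P.rate l) g)
    (hy : ∀ k, y k = mwMean P.N (P.isCenter l) (P.disp l) (P.rate l) g k) :
    Runs ω estimateProg s (13 * B ^ 2) fun s' =>
      (∀ k < P.M, s'.real 12 0 k = acc k + y k) ∧
      ∀ k < P.M, s'.real 19 0 k = Real.exp (P.invTemp l * (P.avgDisp u l k - y k)) := by
  refine (Runs.forLoop (T := 9 * B) (K := P.M) (fun k s' =>
    (∀ k' < k, s'.real 12 0 k' = acc k' + y k' ∧
      s'.real 19 0 k' = Real.exp (P.invTemp l * (P.avgDisp u l k' - y k'))) ∧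
    -- The accumulator is updated in place, so entries not yet visited must be known to be
    -- unchanged.
    ∀ k', k ≤ k' → s'.real 12 0 k' = s.real 12 0 k') rfl ?_ ?_ ?_).mono ?_ ?_
  · exact fun s' f => h.eval_dim2 (f.nat 0 rfl)
  · exact ⟨fun k hk => by omega, fun _ _ => rfl⟩
  · intro k hk s₁ f₁ hsk inv
    refine Runs.step (Q := fun s' => s'.real 18 0 k = 0) (Runs.setReal ?_) (by omega)
      fun s₂ f₂ h₂ => ?_
    · simp only [RExp.eval, NExp.eval, hsk, Rat.cast_zero, writeEntry_self]
    refine Runs.step (Runs.cellLoop (K := P.N) (I₀ := 0) (J₀ := k)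
      (fun j => ∑ i ∈ Finset.range j, P.isCenter l i * Real.exp (P.rate l * g i) * P.disp l i k)
      ?_ (fun _ _ => rfl) ?_ (by simpa using h₂) ?_) (by omega) fun s₃ f₃ h₃ => ?_
    · exact fun s' f => h.eval_card ((f.nat 0 rfl).trans ((f₂.nat 0 rfl).trans (f₁.nat 0 rfl)))
    · intro s' f
      simp only [NExp.eval, f.nat 3 rfl, f₂.nat 3 rfl, hsk]
    · intro i hi s' f hsi hv
      have hk' : (nvar 3).eval s' = k := by simp only [NExp.eval, f.nat 3 rfl, f₂.nat 3 rfl, hsk]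
      have hi' : (nvar 4).eval s' = i := hsi
      have hdisp := eval_expDisp h.toHasTables h.center (s' := s')
        ((f.real 3 rfl).trans ((f₂.real 3 rfl).trans (f₁.real 3 rfl)))
        ((f.nat 7 rfl).trans ((f₂.nat 7 rfl).trans (f₁.nat 7 rfl))) hi' hk' hi hk
      rw [RExp.eval, RExp.eval, RExp.eval, RExp.eval, hdisp, hk', hi', NExp.eval, hv,
        f.real 16 rfl, f₂.real 16 rfl, f₁.real 16 rfl, hw i hi, Finset.sum_range_succ]
    have k₃ : s₃.nat 3 0 0 = k := by rw [f₃.nat 3 rfl, f₂.nat 3 rfl, hsk]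
    refine Runs.step (Q := fun s' => s'.real 18 0 k = y k) (Runs.setReal ?_) (by omega)
      fun s₄ f₄ h₄ => ?_
    · simp only [RExp.eval, NExp.eval, k₃, h₃.1, f₃.real 17 rfl, f₂.real 17 rfl, f₁.real 17 rfl, hZ,
        writeEntry_self, hy, mwMean]
    have k₄ : s₄.nat 3 0 0 = k := by rw [f₄.nat 3 rfl, k₃]
    have r₄ : s₄.real 12 = s₁.real 12 := by rw [f₄.real 12 rfl, f₃.real 12 rfl, f₂.real 12 rfl]
    refine Runs.step (Q := fun s' => s'.real 12 0 k = acc k + y k ∧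
      ∀ k', k' ≠ k → s'.real 12 0 k' = s₁.real 12 0 k') (Runs.setReal ?_) (by omega)
      fun s₅ f₅ h₅ => ?_
    · simp only [RExp.eval, NExp.eval, k₄, h₄, r₄, inv.2 k le_rfl, hacc k hk, writeEntry_apply]
      exact ⟨by simp, fun k' hk' => if_neg (by omega)⟩
    have k₅ : s₅.nat 3 0 0 = k := by rw [f₅.nat 3 rfl, k₄]
    refine (Runs.setReal (Q := fun s' => s'.real 12 = s₅.real 12 ∧
      s'.real 19 0 k = Real.exp (P.invTemp l * (P.avgDisp u l k - y k)) ∧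
      ∀ k', k' ≠ k → s'.real 19 0 k' = s₁.real 19 0 k') ?_).mono (by omega) ?_
    · have r₅ : s₅.real 19 = s₁.real 19 := by
        rw [f₅.real 19 rfl, f₄.real 19 rfl, f₃.real 19 rfl, f₂.real 19 rfl]
      have l₅ : s₅.real 15 0 0 = P.invTemp l := by
        rw [f₅.real 15 rfl, f₄.real 15 rfl, f₃.real 15 rfl, f₂.real 15 rfl, f₁.real 15 rfl,
          h.invTemp]
      have q₅ : s₅.real 10 0 k = P.avgDisp u l k := by
        rw [f₅.real 10 rfl, f₄.real 10 rfl, f₃.real 10 rfl, f₂.real 10 rfl, f₁.real 10 rfl,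
          h.avgDisp k hk]
      simp only [RExp.eval, NExp.eval, k₅, l₅, q₅, f₅.real 18 rfl, h₄, r₅, writeEntry_apply]
      exact ⟨writeEntry_of_ne _ _ _ _ (by omega), by simp, fun k' hk' => if_neg (by omega)⟩
    · intro s₆ f₆ h₆
      refine ⟨fun k' hk' => ?_, fun k' hk' => ?_⟩
      · change s₆.real 12 0 k' = _ ∧ s₆.real 19 0 k' = _
        rcases Nat.lt_succ_iff_lt_or_eq.1 hk' with hlt | rfl
        · rw [h₆.1, h₅.2 k' hlt.ne, h₆.2.2 k' hlt.ne]
          exact inv.1 k' hlt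
        · exact ⟨by rw [h₆.1, h₅.1], h₆.2.1⟩
      · change s₆.real 12 0 k' = _
        rw [h₆.1, h₅.2 k' (by omega), inv.2 k' (by omega)]
  · exact loop_cost_le (a := 9) (p := 1) hB hM (by simp)
  · exact fun s' _ h' => ⟨fun k hk => (h'.1 k hk).1, fun k hk => (h'.1 k hk).2⟩

theorem runs_gainProg (h : LevelReady P m u l s) {g : ℕ → ℝ} {k : ℕ} (hk : k < P.M)
    (hg : ∀ i < P.N, s.real 11 0 i = g i) (h5 : s.nat 5 0 0 = k) :
    Runs ω gainProg s (3 * P.N + 2) fun s' => ∀ i < P.N, s'.real 11 0 i = g i + P.disp l i k := by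
  refine (Runs.fillLoop (K := P.N) (I₀ := 0) (J₀ := 0) (fun i => g i + P.disp l i k) ?_
    (fun _ _ => rfl) ?_ ?_).mono (by omega) fun s' f h' i hi => by simpa using h'.1 i hi
  · exact fun s' f => h.eval_card (f.nat 0 rfl)
  · intro s' f
    simp [NExp.eval]
  · intro i hi s' f hsi hv
    have hk' : (nvar 5).eval s' = k := by simp only [NExp.eval, f.nat 5 rfl, h5]
    have hi' : (nvar 2).eval s' = i := hsi
    rw [zero_add] at hv
    rw [RExp.eval, eval_expDisp h.toHasTables h.center (f.real 3 rfl) (f.nat 7 rfl) hi' hk' hi hk,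
      RExp.eval, hi', NExp.eval, hv, hg i hi]

end Level

/-! ### Correctness and step counts of rounds, levels and the whole chaining program. -/

section ChainRun

variable {ω : ℕ → unitInterval} {s : Memory} {P : Chain} {m B : ℕ} {u : ℕ → ℕ} {l : ℕ}

/-- The state of the rounds of level `l` after `t` rounds with the selections `κ`. -/
structure RoundState (P : Chain) (κ : ℕ → ℕ) (l t : ℕ) (s : Memory) : Prop where
  gain : ∀ i < P.N, s.real 11 0 i = gain (P.disp l) (fun s' => κ (P.offset l + s')) t i
  total : ∀ k < P.M, s.real 12 0 k = ∑ s' ∈ Finset.range t, P.estimate κ l s' k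
  round : s.nat 6 0 0 = t
  pos : s.pos = P.offset l + t

theorem runs_roundProg (h : LevelReady P m u l s) (hP : P.Valid) (hB : 1 ≤ B) (hM : P.M ≤ B)
    (hN : P.N ≤ B) {t : ℕ} (ht : t < P.rounds l)
    (hs : RoundState P (selectionSeq (P.logit u) P.M ω) l t s) :
    Runs ω roundProg s (46 * B ^ 2)
      (RoundState P (selectionSeq (P.logit u) P.M ω) l (t + 1)) := by
  set κ := selectionSeq (P.logit u) P.M ω with hκ
  have h12 : B ≤ B ^ 2 := Nat.le_self_pow (by omega) B
  refine Runs.step (runs_mwWeightsProg h hs.gain) (by omega) fun s₁ f₁ h₁ => ?_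
  have i₁ := h.congr (f₁.nat 0 rfl) (f₁.nat 1 rfl) (f₁.real 0 rfl) (f₁.real 3 rfl) (f₁.real 4 rfl)
    (f₁.real 5 rfl) (f₁.nat 7 rfl) (f₁.nat 9 rfl) (f₁.real 8 rfl) (f₁.real 10 rfl) (f₁.real 13 rfl)
    (f₁.real 14 rfl) (f₁.real 15 rfl)
  refine Runs.step (runs_estimateProg i₁ hB hM hN (y := P.estimate κ l t)
    (acc := fun k => ∑ s' ∈ Finset.range t, P.estimate κ l s' k) ?_ h₁.1 h₁.2 fun k => rfl)
    (by omega) fun s₂ f₂ h₂ => ?_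
  · rw [f₁.real 12 rfl]
    exact hs.total
  have i₂ := i₁.congr (f₂.nat 0 rfl) (f₂.nat 1 rfl) (f₂.real 0 rfl) (f₂.real 3 rfl) (f₂.real 4 rfl)
    (f₂.real 5 rfl) (f₂.nat 7 rfl) (f₂.nat 9 rfl) (f₂.real 8 rfl) (f₂.real 10 rfl) (f₂.real 13 rfl)
    (f₂.real 14 rfl) (f₂.real 15 rfl)
  have hlogit : ∀ k, P.logit u κ (P.offset l + t) k =
      P.invTemp l * (P.avgDisp u l k - P.estimate κ l t k) := fun k => by
    rw [Chain.logit, P.levelOf_offset_add ht, Nat.add_sub_cancel_left]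
  refine Runs.step (runs_sampleProg (r := P.M)
    (w := fun k => Real.exp (P.logit u κ (P.offset l + t) k)) ?_ hP.M_pos
    (fun _ => Real.exp_pos _) fun k hk => ?_) (by omega) fun s₃ f₃ h₃ => ?_
  · exact fun s' h0 => i₂.eval_dim2 h0
  · rw [h₂.2 k hk]
    simp only [hlogit]
  have i₃ := i₂.congr (f₃.nat 0 rfl) (f₃.nat 1 rfl) (f₃.real 0 rfl) (f₃.real 3 rfl) (f₃.real 4 rfl)
    (f₃.real 5 rfl) (f₃.nat 7 rfl) (f₃.nat 9 rfl) (f₃.real 8 rfl) (f₃.real 10 rfl) (f₃.real 13 rfl)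
    (f₃.real 14 rfl) (f₃.real 15 rfl)
  have p₂ : s₂.pos = P.offset l + t := by rw [f₂.pos rfl, f₁.pos rfl, hs.pos]
  have hsel : s₃.nat 5 0 0 = κ (P.offset l + t) := by
    rw [h₃.1, p₂, hκ, selectionSeq_eq (P.logit_adapted u), ← hκ]
  have hlt : κ (P.offset l + t) < P.M := by
    rw [hκ, selectionSeq_eq (P.logit_adapted u)]
    exact selectIndex_lt (fun k => (Real.exp_pos _).le) hP.M_pos _
  refine Runs.step (runs_gainProg i₃ hlt
    (g := gain (P.disp l) (fun s' => κ (P.offset l + s')) t) ?_ hsel) (by omega) fun s₄ f₄ h₄ => ?_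
  · rw [f₃.real 11 rfl, f₂.real 11 rfl, f₁.real 11 rfl]
    exact hs.gain
  refine (Runs.setNvar (v := t + 1) ?_).mono (by omega) fun s₅ f₅ h₅ => ?_
  · simp only [NExp.eval, f₄.nat 6 rfl, f₃.nat 6 rfl, f₂.nat 6 rfl, f₁.nat 6 rfl, hs.round]
  · refine ⟨fun i hi => ?_, fun k hk => ?_, h₅, ?_⟩
    · rw [f₅.real 11 rfl, h₄ i hi, _root_.gain, _root_.gain, Finset.sum_range_succ]
    · rw [f₅.real 12 rfl, f₄.real 12 rfl, f₃.real 12 rfl, h₂.1 k hk, Finset.sum_range_succ]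
    · rw [f₅.pos rfl, f₄.pos rfl, h₃.2, p₂, add_assoc]

theorem runs_roundsProg (h : LevelReady P m u l s) (hP : P.Valid) (hB : 1 ≤ B) (hM : P.M ≤ B)
    (hN : P.N ≤ B) {R : ℕ} (hR : P.rounds l ≤ R)
    (hs : RoundState P (selectionSeq (P.logit u) P.M ω) l 0 s) :
    Runs ω roundsProg s (47 * (R * B ^ 2) + 1)
      (RoundState P (selectionSeq (P.logit u) P.M ω) l (P.rounds l)) := by
  have hb : ∀ t s', Frame roundsProg s s' →
      RoundState P (selectionSeq (P.logit u) P.M ω) l t s' →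
      ((BExp.not (.rle (rvar 13) (.cast (nvar 6)))).eval s' ↔ t < P.rounds l) := by
    intro t s' f hs'
    simp only [BExp.eval, RExp.eval, NExp.eval, hs'.round, f.real 13 rfl, h.roundsBound, not_le]
    -- The program never computes a ceiling: comparing the counter with the real bound runs the loop
    -- exactly `P.rounds l` times.
    exact Nat.lt_ceil.symm
  refine (Runs.loop (RoundState P (selectionSeq (P.logit u) P.M ω) l) (T := 46 * B ^ 2) hs
    (fun t ht s' f hs' => ⟨(hb t s' f hs').2 ht, ?_⟩) fun s' f hs' =>
      mt (hb _ s' f hs').1 (lt_irrefl _)).mono ?_ fun _ _ h => h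
  · refine runs_roundProg (h.congr ?_ ?_ ?_ ?_ ?_ ?_ ?_ ?_ ?_ ?_ ?_ ?_ ?_) hP hB hM hN ht hs'
    all_goals first | exact f.nat _ rfl | exact f.real _ rfl
  · have h1 : 1 ≤ B ^ 2 := Nat.one_le_pow _ _ hB
    calc P.rounds l * (46 * B ^ 2 + 1) + 1 ≤ R * (46 * B ^ 2 + B ^ 2) + 1 := by gcongr
      _ = _ := by ring

/-- The order matters: array `7` holds the centers of level `l` until the indicators and their
number have been stored, and only then is it overwritten with the net of level `l + 1`, which
defines the displacements. -/
theorem runs_setupProg (h : HasTables P m u s) (hB : 1 ≤ B) (hM : P.M ≤ B)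
    (hN : P.N ≤ B) (hn : P.n ≤ B) (hu : ∀ d < P.n, u d < P.N)
    (hc : ∀ i < P.N, s.nat 7 0 i = P.center l i)
    (ha : ∀ d < P.n, s.nat 9 0 d = P.rounding l (u d))
    (h6 : s.real 6 0 0 = P.scale l) (h7 : s.real 7 0 0 = P.depth) (hpos : s.pos = P.offset l)
    (κ : ℕ → ℕ) :
    Runs ω setupProg s (49 * B ^ 2) fun s' => LevelReady P m u l s' ∧ RoundState P κ l 0 s' ∧
      s'.real 6 0 0 = P.scale (l + 1) := by
  have h12 : B ≤ B ^ 2 := Nat.le_self_pow (by omega) B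
  refine Runs.step (runs_centersProg h.toHasInput hc) (by omega) fun s₁ f₁ h₁ => ?_
  have i₁ := h.congr (f₁.nat 0 rfl) (f₁.nat 1 rfl) (f₁.real 0 rfl) (f₁.real 3 rfl) (f₁.real 4 rfl)
    (f₁.real 5 rfl)
  refine Runs.step (runs_numCentersProg i₁.toHasInput h₁) (by omega) fun s₂ f₂ h₂ => ?_
  have i₂ := i₁.congr (f₂.nat 0 rfl) (f₂.nat 1 rfl) (f₂.real 0 rfl) (f₂.real 3 rfl) (f₂.real 4 rfl)
    (f₂.real 5 rfl)
  refine Runs.step (Runs.setRvar (v := P.scale (l + 1)) ?_) (by omega) fun s₃ f₃ h₃ => ?_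
  · simp [RExp.eval, NExp.eval, f₂.real 6 rfl, f₁.real 6 rfl, h6, Chain.scale_succ]
  have i₃ := i₂.congr (f₃.nat 0 rfl) (f₃.nat 1 rfl) (f₃.real 0 rfl) (f₃.real 3 rfl) (f₃.real 4 rfl)
    (f₃.real 5 rfl)
  refine Runs.step (runs_netProg i₃ hB hN h₃) (by omega) fun s₄ f₄ h₄ => ?_
  have i₄ := i₃.congr (f₄.nat 0 rfl) (f₄.nat 1 rfl) (f₄.real 0 rfl) (f₄.real 3 rfl) (f₄.real 4 rfl)
    (f₄.real 5 rfl)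
  have a₄ : s₄.nat 9 = s.nat 9 := by rw [f₄.nat 9 rfl, f₃.nat 9 rfl, f₂.nat 9 rfl, f₁.nat 9 rfl]
  refine Runs.step (runs_avgDispProg i₄ hB hM hn hu h₄ (by rw [a₄]; exact ha)) (by omega)
    fun s₅ f₅ h₅ => ?_
  have i₅ := i₄.congr (f₅.nat 0 rfl) (f₅.nat 1 rfl) (f₅.real 0 rfl) (f₅.real 3 rfl) (f₅.real 4 rfl)
    (f₅.real 5 rfl)
  have e₅ : s₅.real 6 0 0 = P.scale (l + 1) := by rw [f₅.real 6 rfl, f₄.real 6 rfl, h₃]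
  refine Runs.step (runs_paramsProg (l := l) i₅.toHasInput ?_ e₅ ?_) (by omega) fun s₆ f₆ h₆ => ?_
  · rw [f₅.real 7 rfl, f₄.real 7 rfl, f₃.real 7 rfl, f₂.real 7 rfl, f₁.real 7 rfl, h7]
  · rw [f₅.real 9 rfl, f₄.real 9 rfl, f₃.real 9 rfl, h₂]
  have i₆ := i₅.congr (f₆.nat 0 rfl) (f₆.nat 1 rfl) (f₆.real 0 rfl) (f₆.real 3 rfl) (f₆.real 4 rfl)
    (f₆.real 5 rfl)
  refine (runs_clearProg i₆.toHasInput).mono (by omega) fun s₇ f₇ h₇ => ?_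
  have i₇ := i₆.congr (f₇.nat 0 rfl) (f₇.nat 1 rfl) (f₇.real 0 rfl) (f₇.real 3 rfl) (f₇.real 4 rfl)
    (f₇.real 5 rfl)
  refine ⟨⟨i₇, ?_, ?_, ?_, ?_, ?_, ?_, ?_⟩, ⟨fun i hi => ?_, fun k hk => ?_, h₇.2.2, ?_⟩, ?_⟩
  · rw [f₇.nat 7 rfl, f₆.nat 7 rfl, f₅.nat 7 rfl]
    exact h₄
  · rw [f₇.nat 9 rfl, f₆.nat 9 rfl, f₅.nat 9 rfl, a₄]
    exact ha
  · rw [f₇.real 8 rfl, f₆.real 8 rfl, f₅.real 8 rfl, f₄.real 8 rfl, f₃.real 8 rfl, f₂.real 8 rfl]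
    exact h₁
  · rw [f₇.real 10 rfl, f₆.real 10 rfl]
    exact h₅
  · rw [f₇.real 13 rfl, h₆.1]
  · rw [f₇.real 14 rfl, h₆.2.1]
  · rw [f₇.real 15 rfl, h₆.2.2]
  · rw [h₇.1 i hi, _root_.gain, Finset.sum_range_zero]
  · rw [h₇.2.1 k hk, Finset.sum_range_zero]
  · rw [f₇.pos rfl, f₆.pos rfl, f₅.pos rfl, f₄.pos rfl, f₃.pos rfl, f₂.pos rfl, f₁.pos rfl, hpos,
      add_zero]
  · rw [f₇.real 6 rfl, f₆.real 6 rfl, e₅]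

theorem runs_addOutputProg (h : HasInput P m u s) {κ : ℕ → ℕ}
    (hs : RoundState P κ l (P.rounds l) s) (hout : ∀ j < m, s.real 2 0 j = P.output l κ j) :
    Runs ω addOutputProg s (3 * m + 2) fun s' => ∀ j < m, s'.real 2 0 j = P.output (l + 1) κ j := by
  refine (Runs.fillLoop (K := m) (I₀ := 0) (J₀ := 0) (P.output (l + 1) κ) ?_ (fun _ _ => rfl) ?_
    ?_).mono (by omega) fun s' f h' j hj => by simpa using h'.1 j hj
  · intro s' f
    simp only [NExp.eval, f.nat 0 rfl, h.dim]
  · intro s' f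
    simp [NExp.eval]
  · intro j hj s' f hsj hv
    rw [zero_add] at hv
    simp only [RExp.eval, NExp.eval, hsj, hv, f.real 12 rfl, f.nat 6 rfl, hs.round, hout j hj,
      hs.total j (by rw [h.dim2]; omega)]
    rw [Chain.output, Chain.output, Finset.sum_range_succ, add_assoc]

theorem runs_roundDataProg (h : HasInput P m u s) (hu : ∀ d < P.n, u d < P.N)
    (hc : ∀ i < P.N, s.nat 7 0 i = P.center (l + 1) i)
    (ha : ∀ d < P.n, s.nat 9 0 d = P.rounding l (u d)) :
    Runs ω roundDataProg s (3 * P.n + 2) fun s' =>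
      ∀ d < P.n, s'.nat 9 0 d = P.rounding (l + 1) (u d) := by
  refine (Runs.natFillLoop (K := P.n) (by omega) (fun d => P.rounding (l + 1) (u d)) ?_ ?_).mono
    (by omega) fun _ _ h => h
  · exact fun s' f => h.eval_size (f.nat 0 rfl)
  · intro d hd s' f hsd hv
    simp only [NExp.eval, hsd, hv, ha d hd, f.nat 7 rfl, hc _ (P.rounding_spec l (hu d hd)).1]
    rfl

/-- The state of chaining before level `l` with the selections `κ`. -/
structure ChainState (P : Chain) (m : ℕ) (u κ : ℕ → ℕ) (l : ℕ) (s : Memory) : Prop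
    extends HasTables P m u s where
  center : ∀ i < P.N, s.nat 7 0 i = P.center l i
  rounded : ∀ d < P.n, s.nat 9 0 d = P.rounding l (u d)
  scale : s.real 6 0 0 = P.scale l
  depth : s.real 7 0 0 = P.depth
  output : ∀ j < m, s.real 2 0 j = P.output l κ j
  pos : s.pos = P.offset l

theorem runs_levelProg (hP : P.Valid) (hB : 1 ≤ B) (hM : P.M ≤ B)
    (hN : P.N ≤ B) (hn : P.n ≤ B) (hu : ∀ d < P.n, u d < P.N) {R : ℕ} (hR : P.rounds l ≤ R)
    (h : ChainState P m u (selectionSeq (P.logit u) P.M ω) l s) :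
    Runs ω levelProg s (60 * B ^ 2 + 47 * (R * B ^ 2))
      (ChainState P m u (selectionSeq (P.logit u) P.M ω) (l + 1)) := by
  have h12 : B ≤ B ^ 2 := Nat.le_self_pow (by omega) B
  have hm : m ≤ B := by have := h.dim2; omega
  refine Runs.step (runs_setupProg h.toHasTables hB hM hN hn hu h.center h.rounded h.scale h.depth
    h.pos (selectionSeq (P.logit u) P.M ω)) (by omega) fun s₁ f₁ h₁ => ?_
  refine Runs.step (runs_roundsProg h₁.1 hP hB hM hN hR h₁.2.1) (by omega) fun s₂ f₂ h₂ => ?_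
  have i₂ := h₁.1.toHasTables.congr (f₂.nat 0 rfl) (f₂.nat 1 rfl) (f₂.real 0 rfl) (f₂.real 3 rfl)
    (f₂.real 4 rfl) (f₂.real 5 rfl)
  refine Runs.step (runs_addOutputProg i₂.toHasInput h₂ ?_) (by omega) fun s₃ f₃ h₃ => ?_
  · rw [f₂.real 2 rfl, f₁.real 2 rfl]
    exact h.output
  have i₃ := i₂.congr (f₃.nat 0 rfl) (f₃.nat 1 rfl) (f₃.real 0 rfl) (f₃.real 3 rfl) (f₃.real 4 rfl)
    (f₃.real 5 rfl)
  refine (runs_roundDataProg i₃.toHasInput hu (l := l) ?_ ?_).mono (by omega) fun s₄ f₄ h₄ => ?_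
  · rw [f₃.nat 7 rfl, f₂.nat 7 rfl]
    exact h₁.1.center
  · rw [f₃.nat 9 rfl, f₂.nat 9 rfl]
    exact h₁.1.rounded
  · refine ⟨i₃.congr (f₄.nat 0 rfl) (f₄.nat 1 rfl) (f₄.real 0 rfl) (f₄.real 3 rfl)
      (f₄.real 4 rfl) (f₄.real 5 rfl), ?_, h₄, ?_, ?_, ?_, ?_⟩
    · rw [f₄.nat 7 rfl, f₃.nat 7 rfl, f₂.nat 7 rfl]
      exact h₁.1.center
    · rw [f₄.real 6 rfl, f₃.real 6 rfl, f₂.real 6 rfl, h₁.2.2]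
    · rw [f₄.real 7 rfl, f₃.real 7 rfl, f₂.real 7 rfl, f₁.real 7 rfl, h.depth]
    · rw [f₄.real 2 rfl]
      exact h₃
    · rw [f₄.pos rfl, f₃.pos rfl, h₂.pos, Chain.offset_succ]

theorem runs_initProg (h : HasTables P m u s) (hP : P.Valid) (hB : 1 ≤ B) (hM : P.M ≤ B)
    (hN : P.N ≤ B) (hn : P.n ≤ B) (hu : ∀ d < P.n, u d < P.N) (hpos : s.pos = 0) (κ : ℕ → ℕ) :
    Runs ω initProg s (24 * B ^ 2) (ChainState P m u κ 0) := by
  have h12 : B ≤ B ^ 2 := Nat.le_self_pow (by omega) B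
  have hm : m ≤ B := by have := h.dim2; omega
  refine Runs.step (runs_initOutputProg h hP.N_pos) (by omega) fun s₁ f₁ h₁ => ?_
  refine Runs.step (Runs.setRvar (v := P.depth) ?_) (by omega) fun s₂ f₂ h₂ => ?_
  · simp [RExp.eval, NExp.eval, f₁.real 5 rfl, f₁.real 0 rfl, h.radius, h.alpha, Chain.depth]
  refine Runs.step (Runs.setRvar (v := P.scale 0) ?_) (by omega) fun s₃ f₃ h₃ => ?_
  · simp [RExp.eval, NExp.eval, f₂.real 0 rfl, f₁.real 0 rfl, h.alpha, Chain.scale]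
  have i₃ := h.congr (s' := s₃) ((f₃.nat 0 rfl).trans ((f₂.nat 0 rfl).trans (f₁.nat 0 rfl)))
    ((f₃.nat 1 rfl).trans ((f₂.nat 1 rfl).trans (f₁.nat 1 rfl)))
    ((f₃.real 0 rfl).trans ((f₂.real 0 rfl).trans (f₁.real 0 rfl)))
    ((f₃.real 3 rfl).trans ((f₂.real 3 rfl).trans (f₁.real 3 rfl)))
    ((f₃.real 4 rfl).trans ((f₂.real 4 rfl).trans (f₁.real 4 rfl)))
    ((f₃.real 5 rfl).trans ((f₂.real 5 rfl).trans (f₁.real 5 rfl)))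
  refine Runs.step (runs_netProg i₃ hB hN h₃) (by omega) fun s₄ f₄ h₄ => ?_
  have i₄ := i₃.congr (f₄.nat 0 rfl) (f₄.nat 1 rfl) (f₄.real 0 rfl) (f₄.real 3 rfl) (f₄.real 4 rfl)
    (f₄.real 5 rfl)
  refine (Runs.natFillLoop (K := P.n) (by omega) (fun d => P.rounding 0 (u d)) ?_ ?_).mono
    (by omega) fun s₅ f₅ h₅ => ?_
  · exact fun s' f => i₄.eval_size (f.nat 0 rfl)
  · intro d hd s' f hsd hv
    simp only [NExp.eval, hsd, f.nat 1 rfl, i₄.data d hd, f.nat 7 rfl, h₄ _ (hu d hd)]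
    rfl
  · refine ⟨i₄.congr (f₅.nat 0 rfl) (f₅.nat 1 rfl) (f₅.real 0 rfl) (f₅.real 3 rfl)
      (f₅.real 4 rfl) (f₅.real 5 rfl), ?_, h₅, ?_, ?_, fun j hj => ?_, ?_⟩
    · rw [f₅.nat 7 rfl]
      exact h₄
    · rw [f₅.real 6 rfl, f₄.real 6 rfl, h₃]
    · rw [f₅.real 7 rfl, f₄.real 7 rfl, f₃.real 7 rfl, h₂]
    · rw [f₅.real 2 rfl, f₄.real 2 rfl, f₃.real 2 rfl, f₂.real 2 rfl, h₁ j hj, Chain.output,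
        Finset.sum_range_zero, add_zero]
    · rw [f₅.pos rfl, f₄.pos rfl, f₃.pos rfl, f₂.pos rfl, f₁.pos rfl, hpos, Chain.offset,
        Finset.sum_range_zero]

theorem runs_chainProg (h : HasTables P m u s) (hP : P.Valid) (hB : 1 ≤ B) (hM : P.M ≤ B)
    (hN : P.N ≤ B) (hn : P.n ≤ B) (hu : ∀ d < P.n, u d < P.N) (hpos : s.pos = 0) {L R : ℕ}
    (hL : P.levels ≤ L) (hR : ∀ l < P.levels, P.rounds l ≤ R) :
    Runs ω chainProg s (25 * B ^ 2 + L * (61 * B ^ 2 + 47 * (R * B ^ 2))) fun s' =>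
      ∀ j < m, s'.real 2 0 j = P.output P.levels (selectionSeq (P.logit u) P.M ω) j := by
  have h1 : 1 ≤ B ^ 2 := Nat.one_le_pow _ _ hB
  refine Runs.step (runs_initProg h hP hB hM hN hn hu hpos (selectionSeq (P.logit u) P.M ω))
    (by omega) fun s₁ f₁ h₁ => ?_
  have hb : ∀ l s', ChainState P m u (selectionSeq (P.logit u) P.M ω) l s' →
      ((BExp.not (.rle (rvar 5) (rvar 6))).eval s' ↔ l < P.levels) := by
    intro l s' hs'
    simp only [BExp.eval, RExp.eval, NExp.eval, hs'.radius, hs'.scale, not_le]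
    exact (hP.lt_levels_iff l).symm
  refine (Runs.loop (ChainState P m u (selectionSeq (P.logit u) P.M ω))
    (T := 60 * B ^ 2 + 47 * (R * B ^ 2)) h₁ (fun l hl s' _ hs' => ⟨(hb l s' hs').2 hl,
      runs_levelProg hP hB hM hN hn hu (hR l hl) hs'⟩) fun s' _ hs' =>
        mt (hb _ s' hs').1 (lt_irrefl _)).mono ?_ fun s' _ hs' => hs'.output
  have h2 : P.levels * (60 * B ^ 2 + 47 * (R * B ^ 2) + 1) ≤
      L * (61 * B ^ 2 + 47 * (R * B ^ 2)) := Nat.mul_le_mul hL (by omega)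
  omega

end ChainRun

/-! ## The cost of chaining -/

namespace Chain

variable {P : Chain}

theorem numCenters_le (P : Chain) (l : ℕ) : P.numCenters l ≤ P.N := by
  calc P.numCenters l ≤ ∑ _i ∈ Finset.range P.N, (1 : ℝ) := by
        refine Finset.sum_le_sum fun i _ => ?_
        rw [isCenter]
        split_ifs <;> norm_num
    _ = P.N := by simp

theorem Valid.depth_le (hP : P.Valid) (h : 0 < P.levels) (hr : P.radius ≤ P.α * P.N) :
    P.depth ≤ 6 * P.N := by
  have hN : (1 : ℝ) ≤ P.N := Nat.one_le_cast.2 hP.N_pos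
  have h0 : 0 < P.radius := (hP.scale_pos 0).trans (scale_lt_radius h)
  have h1 : 2 * P.radius / P.α ≤ 2 * P.N := by
    rw [div_le_iff₀ hP.α_pos]
    linarith
  have h2 := Real.log_le_self (div_nonneg (mul_nonneg two_pos.le h0.le) hP.α_pos.le)
  rw [depth]
  linarith

theorem Valid.levels_le (hP : P.Valid) (hr : P.radius ≤ P.α * P.N) : P.levels ≤ 6 * P.N := by
  rcases Nat.eq_zero_or_pos P.levels with h | h
  · omega
  · have := (hP.levels_cast_le_depth h).trans (hP.depth_le h hr)
    exact_mod_cast this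

/-- The scale of a level is below the radius, so radius ≤ αN cancels both powers of α. The factors
depth² ≤ 36N², scale² ≤ 4α²N² and log ≤ N give 64·36·4 = 9216 and the exponent 5. -/
theorem Valid.rounds_le (hP : P.Valid) (hr : P.radius ≤ P.α * P.N) {l : ℕ} (hl : l < P.levels) :
    P.rounds l ≤ 9216 * P.N ^ 5 := by
  have hα := hP.α_pos
  have hlev : 0 < P.levels := by omega
  have h2 := hP.two_le_numCenters hl
  have hd := hP.depth_le hlev hr
  have hd0 : 0 ≤ P.depth := by linarith [hP.two_le_depth hl]
  have hs : P.scale (l + 1) ≤ 2 * (P.α * P.N) := by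
    rw [scale_succ]
    linarith [scale_lt_radius hl]
  have hs0 := (hP.scale_pos (l + 1)).le
  have hlog : Real.log (P.numCenters l) ≤ P.N :=
    (Real.log_le_self (by linarith)).trans (P.numCenters_le l)
  have hlog0 : 0 ≤ Real.log (P.numCenters l) := by linarith [hP.half_le_log_numCenters hl]
  rw [rounds, Nat.ceil_le, roundsBound, div_le_iff₀ (mul_pos hα hα)]
  push_cast
  calc 64 * (P.depth * P.depth) * (P.scale (l + 1) * P.scale (l + 1)) * Real.log (P.numCenters l)
      ≤ 64 * ((6 * P.N) * (6 * P.N)) * ((2 * (P.α * P.N)) * (2 * (P.α * P.N))) * P.N := by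
        gcongr
    _ = 9216 * (P.N : ℝ) ^ 5 * (P.α * P.α) := by ring

end Chain

/-! ## The main program -/

/-- Output the center of the cube. -/
def halfProg : Prog := forLoop 3 expDim (.setReal 2 (.lit 0) (nvar 3) (.lit (1 / 2)))

/-- Output the center of the cube, the mean of a noisy histogram, or the result of chaining. -/
def mainProg : Prog :=
  .ite (.rle (.lit (1 / 2)) expAlpha) halfProg <| .seq tablesProg <|
  .ite (.rle (.mul expAlpha (.cast expCard)) (rvar 5)) histProg chainProg

/-- The output of the main program. -/
noncomputable def mainOutput (P : Chain) (u : ℕ → ℕ) (ω : ℕ → unitInterval) (j : ℕ) : ℝ :=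
  open scoped Classical in
  if 1 / 2 ≤ P.α then 1 / 2
  else if P.α * P.N ≤ P.radius then
    P.histOutput P.N (selectionSeq (P.histLogit u) (P.n + 1) ω) j
  else P.output P.levels (selectionSeq (P.logit u) P.M ω) j

theorem runs_mainProg {ω : ℕ → unitInterval} {s : Memory} {P : Chain} {m B : ℕ} {u : ℕ → ℕ}
    (h : HasInput P m u s) (hP : P.Valid) (hB : 1 ≤ B) (hM : P.M ≤ B)
    (hN : P.N ≤ B) (hn : P.n ≤ B) (hu : ∀ d < P.n, u d < P.N) (hpos : s.pos = 0)
    (hz1 : ∀ i < P.N, ∀ j < m, s.real 1 i j = P.z i j)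
    (hz2 : ∀ i < P.N, ∀ j < m, -s.real 1 i j = P.z i (m + j)) :
    Runs ω mainProg s (2600000 * B ^ 8) fun s' => ∀ j < m, s'.real 2 0 j = mainOutput P u ω j := by
  have hm : m ≤ B := by have := h.dim2; omega
  have h18 : B ≤ B ^ 8 := Nat.le_self_pow (by omega) B
  have h28 : B ^ 2 ≤ B ^ 8 := Nat.pow_le_pow_right hB (by omega)
  have h38 : B ^ 3 ≤ B ^ 8 := Nat.pow_le_pow_right hB (by omega)
  have h08 : 1 ≤ B ^ 8 := Nat.one_le_pow _ _ hB
  have hc : BExp.eval s (.rle (.lit (1 / 2)) expAlpha) ↔ 1 / 2 ≤ P.α := by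
    simp [BExp.eval, RExp.eval, NExp.eval, h.alpha]
  refine (Runs.ite (T := 2600000 * B ^ 8 - 1) (fun hb => ?_) fun hb => ?_).mono (by omega)
    fun _ _ h => h
  · rw [hc] at hb
    refine (Runs.fillLoop (K := m) (I₀ := 0) (J₀ := 0) (fun _ => 1 / 2) ?_ (fun _ _ => rfl) ?_
      ?_).mono (by omega) fun s' f h' j hj => ?_
    · exact fun s' f => by simp only [NExp.eval, f.nat 0 rfl, h.dim]
    · exact fun s' f => by simp [NExp.eval]
    · exact fun j hj s' f _ _ => by simp [RExp.eval]
    · rw [mainOutput, if_pos hb]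
      simpa using h'.1 j hj
  rw [hc] at hb
  refine Runs.step (runs_tablesProg h hP.N_pos hB hM hN hz1 hz2) (by omega) fun s₁ f₁ h₁ => ?_
  have hpos₁ : s₁.pos = 0 := by rw [f₁.pos rfl, hpos]
  have hc₁ : BExp.eval s₁ (.rle (.mul expAlpha (.cast expCard)) (rvar 5)) ↔
      P.α * P.N ≤ P.radius := by
    simp [BExp.eval, RExp.eval, NExp.eval, h₁.alpha, h₁.card, h₁.radius]
  refine (Runs.ite (T := 2600000 * B ^ 8 - 2 - 34 * B ^ 3) (fun hb₁ => ?_) fun hb₁ => ?_).mono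
    (by omega) fun _ _ h => h
  · rw [hc₁] at hb₁
    refine (runs_histProg h₁ hP.N_pos hB hM hN hn hpos₁).mono (by omega) fun s' _ h' j hj => ?_
    rw [h' j hj, mainOutput, if_neg hb, if_pos hb₁]
  · rw [hc₁] at hb₁
    have hr := (not_le.1 hb₁).le
    refine (runs_chainProg h₁ hP hB hM hN hn hu hpos₁ (hP.levels_le hr)
      fun l hl => hP.rounds_le hr hl).mono ?_ fun s' _ h' j hj => ?_
    -- The dominant term is levels × rounds × cost of a round, with coefficient 6·47·9216 = 2598912
    -- and degree 1 + 5 + 2; the slack up to 2600000 absorbs the lower-order terms.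
    · have h3 : 6 * P.N * (61 * B ^ 2 + 47 * (9216 * P.N ^ 5 * B ^ 2)) ≤
          6 * B * (61 * B ^ 2 + 47 * (9216 * B ^ 5 * B ^ 2)) := by gcongr
      have h4 : 6 * B * (61 * B ^ 2 + 47 * (9216 * B ^ 5 * B ^ 2)) =
          366 * B ^ 3 + 2598912 * B ^ 8 := by ring
      omega
    · rw [h' j hj, mainOutput, if_neg hb, if_neg hb₁]

/-! ## The mean point problem as an instance of chaining -/

section Instance

variable {m n : ℕ} {X : Finset (Fin m → ℝ)}

/-- Coordinate `j` of the point with index `i`. -/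
noncomputable def pointEntry (e : Fin X.card ≃ X) (i j : ℕ) : ℝ :=
  if h : i < X.card ∧ j < m then (e ⟨i, h.1⟩ : Fin m → ℝ) ⟨j, h.2⟩ else 0

/-- The instance of chaining for the universe `X`. -/
noncomputable def meanChain (e : Fin X.card ≃ X) (n : ℕ) (ρ α : ℝ) : Chain where
  N := X.card
  M := m + m
  n := n
  z i k := if k < m then pointEntry e i k else -pointEntry e i (k - m)
  α := α
  ρ := ρ

/-- The index of record `d`. -/
def recordIndex (e : Fin X.card ≃ X) (D : Fin n → X) (d : ℕ) : ℕ :=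
  if h : d < n then (e.symm (D ⟨d, h⟩) : ℕ) else 0

variable {e : Fin X.card ≃ X} {ρ α : ℝ}

theorem recordIndex_fin (e : Fin X.card ≃ X) (D : Fin n → X) (d : Fin n) :
    recordIndex e D d = (e.symm (D d) : ℕ) := by
  rw [recordIndex, dif_pos d.2]

theorem recordIndex_lt (e : Fin X.card ≃ X) (D : Fin n → X) {d : ℕ} (hd : d < n) :
    recordIndex e D d < X.card := by
  rw [recordIndex, dif_pos hd]
  exact (e.symm (D ⟨d, hd⟩)).2

theorem pointEntry_fin (e : Fin X.card ≃ X) (i : Fin X.card) (j : Fin m) :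
    pointEntry e i j = (e i : Fin m → ℝ) j := by
  rw [pointEntry, dif_pos ⟨i.2, j.2⟩]

theorem meanChain_valid (hm : 2 ≤ m) (hn : 1 ≤ n) (hρ : 0 < ρ) (hα : 0 < α) (D : Fin n → X) :
    (meanChain e n ρ α).Valid where
  N_pos := Finset.card_pos.2 ⟨_, (D ⟨0, hn⟩).2⟩
  M_pos := by
    change 0 < m + m
    omega
  n_pos := hn
  α_pos := hα
  ρ_pos := hρ
  neg k hk := by
    change k < m + m at hk
    change ∃ k' < m + m, _
    rcases lt_or_ge k m with h | h
    · refine ⟨k + m, by omega, fun i => ?_⟩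
      simp only [meanChain]
      rw [if_neg (by omega), if_pos h, Nat.add_sub_cancel]
    · refine ⟨k - m, by omega, fun i => ?_⟩
      simp only [meanChain]
      rw [if_pos (by omega), if_neg (by omega), neg_neg]

theorem meanChain_z_fin (i : Fin X.card) (j : Fin m) :
    (meanChain e n ρ α).z i j = (e i : Fin m → ℝ) j := by
  rw [meanChain]
  simp only
  rw [if_pos j.2, pointEntry_fin]

theorem dataMean_apply (D : Fin n → X) (j : Fin m) :
    dataMean D j =
      (∑ d ∈ Finset.range n, (meanChain e n ρ α).z (recordIndex e D d) j) / n := by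
  rw [dataMean, Finset.sum_range, Pi.smul_apply, Finset.sum_apply, smul_eq_mul, inv_mul_eq_div]
  congr 1
  refine Finset.sum_congr rfl fun d _ => ?_
  rw [recordIndex_fin, meanChain_z_fin, Equiv.apply_symm_apply]

/-- Both mechanisms see the data only through sums over records. Such sums ignore the order, so
after undoing the permutation only the replaced record contributes. -/
theorem Neighboring.sum_sub_sum {D D' : Fin n → X} (h : Neighboring D D') (e : Fin X.card ≃ X) :
    ∃ i i', ∀ φ : ℕ → ℝ, ∑ d ∈ Finset.range n, φ (recordIndex e D d) -
      ∑ d ∈ Finset.range n, φ (recordIndex e D' d) = φ i - φ i' := by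
  obtain ⟨σ, i, hi⟩ := h
  refine ⟨recordIndex e D i, recordIndex e D' (σ i), fun φ => ?_⟩
  rw [Finset.sum_range, Finset.sum_range,
    ← Equiv.sum_comp σ fun d : Fin n => φ (recordIndex e D' d),
    ← Finset.sum_sub_distrib]
  refine Finset.sum_eq_single i (fun j _ hj => ?_) fun hi => absurd (Finset.mem_univ i) hi
  rw [recordIndex_fin, recordIndex_fin, hi j hj, sub_self]

theorem hasInput_inputMemory (e : Fin X.card ≃ X) (ρ α : ℝ) (D : Fin n → X) :
    HasInput (meanChain e n ρ α) m (recordIndex e D) (inputMemory e ρ α D) where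
  dim := by simp [inputMemory]
  card := by simp [inputMemory, meanChain]
  size := by simp [inputMemory, meanChain]
  data d hd := by
    change d < n at hd
    simp [inputMemory, recordIndex, hd]
  rho := by simp [inputMemory, meanChain]
  alpha := by simp [inputMemory, meanChain]
  dim2 := rfl

theorem runs_mainProg_inputMemory (hm : 2 ≤ m) (hn : 1 ≤ n) (hρ : 0 < ρ) (hα : 0 < α)
    (D : Fin n → X) (ω : ℕ → unitInterval) :
    Runs ω mainProg (inputMemory e ρ α D) (2600000 * (2 * (m + X.card + n)) ^ 8) fun s' =>
      ∀ j < m, s'.real 2 0 j = mainOutput (meanChain e n ρ α) (recordIndex e D) ω j := by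
  refine runs_mainProg (hasInput_inputMemory e ρ α D) (meanChain_valid hm hn hρ hα D) (by omega)
    ?_ ?_ ?_ (fun d hd => recordIndex_lt e D hd) rfl ?_ ?_
  · change m + m ≤ _
    omega
  · change X.card ≤ _
    omega
  · change n ≤ _
    omega
  · intro i hi j hj
    change i < X.card at hi
    simp [inputMemory, meanChain, pointEntry, hi, hj]
  · intro i hi j hj
    change i < X.card at hi
    simp [inputMemory, meanChain, pointEntry, hi, hj]

theorem answer_mainProg (hm : 2 ≤ m) (hn : 1 ≤ n) (hρ : 0 < ρ) (hα : 0 < α)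
    (D : Fin n → X) (ω : ℕ → unitInterval) :
    answer mainProg e ρ α D ω =
      fun j : Fin m => mainOutput (meanChain e n ρ α) (recordIndex e D) ω j := by
  obtain ⟨t, -, s', he, hs'⟩ := runs_mainProg_inputMemory (e := e) hm hn hρ hα D ω
  ext j
  rw [answer, he.finalMemory_eq, hs' j j.2]

theorem haltsWithin_mainProg (hm : 2 ≤ m) (hn : 1 ≤ n) (hρ : 0 < ρ) (hα : 0 < α)
    (D : Fin n → X) (ω : ℕ → unitInterval) {k : ℕ} (hk : 2600000 * 2 ^ 8 ≤ k) :
    HaltsWithin ω mainProg (inputMemory e ρ α D) (k * (m + X.card + n) ^ k) := by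
  obtain ⟨t, ht, s', he, -⟩ := runs_mainProg_inputMemory (e := e) hm hn hρ hα D ω
  refine ⟨t, ht.trans ?_, s', he⟩
  rw [mul_pow, ← mul_assoc]
  exact Nat.mul_le_mul hk (Nat.pow_le_pow_right (by omega) (by omega))

/-! ### Measurability and privacy -/

theorem answer_mainProg_of_half_le (hm : 2 ≤ m) (hn : 1 ≤ n) (hρ : 0 < ρ) (hα : 1 / 2 ≤ α)
    (D : Fin n → X) (ω : ℕ → unitInterval) :
    answer mainProg e ρ α D ω = fun _ => 1 / 2 := by
  rw [answer_mainProg hm hn hρ (by linarith)]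
  ext j
  exact if_pos hα

theorem answer_mainProg_of_le_radius (hm : 2 ≤ m) (hn : 1 ≤ n) (hρ : 0 < ρ) (hα : 0 < α)
    (hα' : ¬ 1 / 2 ≤ α) (hr : α * X.card ≤ (meanChain e n ρ α).radius)
    (D : Fin n → X) (ω : ℕ → unitInterval) :
    answer mainProg e ρ α D ω = fun j : Fin m => (meanChain e n ρ α).histOutput X.card
      (selections ((meanChain e n ρ α).histLogit (recordIndex e D)) (n + 1) ω X.card) j := by
  rw [answer_mainProg hm hn hρ hα]
  ext j
  refine (if_neg hα').trans ((if_pos hr).trans ?_)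
  rw [Chain.histOutput, Chain.histOutput]
  congr 1
  refine Finset.sum_congr rfl fun i hi => ?_
  rw [selections_apply_of_lt _ _ _ (Finset.mem_range.1 hi)]
  rfl

theorem answer_mainProg_of_radius_lt (hm : 2 ≤ m) (hn : 1 ≤ n) (hρ : 0 < ρ) (hα : 0 < α)
    (hα' : ¬ 1 / 2 ≤ α) (hr : ¬ α * X.card ≤ (meanChain e n ρ α).radius)
    (D : Fin n → X) (ω : ℕ → unitInterval) :
    answer mainProg e ρ α D ω = fun j : Fin m =>
      (meanChain e n ρ α).output (meanChain e n ρ α).levels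
      (selections ((meanChain e n ρ α).logit (recordIndex e D)) (m + m) ω
        ((meanChain e n ρ α).offset (meanChain e n ρ α).levels)) j := by
  rw [answer_mainProg hm hn hρ hα]
  ext j
  refine (if_neg hα').trans ((if_neg hr).trans ?_)
  exact ((meanChain e n ρ α).output_congr
    (fun i hi => selections_apply_of_lt _ _ _ hi) j).symm

theorem measurable_answer_mainProg (hm : 2 ≤ m) (hn : 1 ≤ n) (hρ : 0 < ρ) (hα : 0 < α)
    (D : Fin n → X) : Measurable (answer mainProg e ρ α D) := by
  by_cases h1 : 1 / 2 ≤ α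
  · rw [show answer mainProg e ρ α D = fun _ _ => 1 / 2 from
      funext (answer_mainProg_of_half_le hm hn hρ h1 D)]
    exact measurable_const
  by_cases h2 : α * X.card ≤ (meanChain e n ρ α).radius
  · exact (answer_law_of_selections (Nat.succ_pos n)
      (W := fun D => (meanChain e n ρ α).histLogit (recordIndex e D)) (T := X.card)
      (G := fun h (j : Fin m) => (meanChain e n ρ α).histOutput X.card h j)
      ((meanChain e n ρ α).histLogit_adapted _)
      (answer_mainProg_of_le_radius hm hn hρ hα h1 h2 D)).1
  · exact (answer_law_of_selections (show 0 < m + m by omega)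
      (W := fun D => (meanChain e n ρ α).logit (recordIndex e D))
      (T := (meanChain e n ρ α).offset (meanChain e n ρ α).levels)
      (G := fun h (j : Fin m) => (meanChain e n ρ α).output (meanChain e n ρ α).levels h j)
      ((meanChain e n ρ α).logit_adapted _)
      (answer_mainProg_of_radius_lt hm hn hρ hα h1 h2 D)).1

theorem isZCDP_mainProg (hm : 2 ≤ m) (hn : 1 ≤ n) (hρ : 0 < ρ) (hα : 0 < α) :
    IsZCDP ρ (answerLaw mainProg (n := n) e ρ α) := by
  by_cases h1 : 1 / 2 ≤ α
  · exact isZCDP_of_selections one_pos (W := fun _ _ _ _ => 0) (T := 0)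
      (G := fun _ _ => 1 / 2) (fun _ _ _ _ _ => rfl)
      (fun D => answer_mainProg_of_half_le hm hn hρ h1 D)
      fun D D' _ => ⟨fun _ => 0, fun h t ht => by omega, by simpa using hρ.le⟩
  by_cases h2 : α * X.card ≤ (meanChain e n ρ α).radius
  · refine isZCDP_of_selections (Nat.succ_pos n)
      (W := fun D => (meanChain e n ρ α).histLogit (recordIndex e D)) (T := X.card)
      (G := fun h (j : Fin m) => (meanChain e n ρ α).histOutput X.card h j)
      (fun D => (meanChain e n ρ α).histLogit_adapted _)
      (answer_mainProg_of_le_radius hm hn hρ hα h1 h2) fun D D' hDD' => ?_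
    obtain ⟨h3, h4⟩ := Chain.hist_privacy (P := meanChain e n ρ α) hρ.le (hDD'.sum_sub_sum e)
    exact ⟨_, fun h t _ k _ => h3 h t k, h4⟩
  · refine isZCDP_of_selections (show 0 < m + m by omega)
      (W := fun D => (meanChain e n ρ α).logit (recordIndex e D))
      (T := (meanChain e n ρ α).offset (meanChain e n ρ α).levels)
      (G := fun h (j : Fin m) => (meanChain e n ρ α).output (meanChain e n ρ α).levels h j)
      (fun D => (meanChain e n ρ α).logit_adapted _)
      (answer_mainProg_of_radius_lt hm hn hρ hα h1 h2) fun D D' hDD' => ?_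
    have hP := meanChain_valid (e := e) hm hn hρ hα D
    exact ⟨_, fun h t _ k hk => hP.abs_logit_sub_le (hDD'.sum_sub_sum e) h t hk, hP.sum_sq_le⟩

end Instance

/-! ## Accuracy of chaining -/

namespace Chain

variable {P : Chain}

/-- The error budget: α/2 for rounding and α/4 for regret make up 3α/4, and the selection gaps, at
most α/(4·depth) per level, add up to at most α/4. -/
theorem Valid.sum_error_le (hP : P.Valid) :
    3 / 4 * P.α + ∑ τ ∈ Finset.range (P.offset P.levels),
      P.α / (4 * P.depth) / P.rounds (P.levelOf τ) ≤ P.α := by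
  have hα := hP.α_pos
  rw [P.sum_offset]
  have h1 : ∀ l ∈ Finset.range P.levels, ∑ s ∈ Finset.range (P.rounds l),
      P.α / (4 * P.depth) / P.rounds (P.levelOf (P.offset l + s)) ≤ P.α / (4 * P.depth) := by
    intro l hl
    have hl' := Finset.mem_range.1 hl
    have hT : (0 : ℝ) < P.rounds l :=
      (zero_lt_one.trans_le (hP.one_le_roundsBound hl')).trans_le (hP.rounds_bounds hl').1
    rw [Finset.sum_congr rfl fun s hs => by rw [P.levelOf_offset_add (Finset.mem_range.1 hs)],
      Finset.sum_const, Finset.card_range, nsmul_eq_mul, mul_div_cancel₀ _ hT.ne']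
  have h2 := Finset.sum_le_sum h1
  rw [Finset.sum_const, Finset.card_range, nsmul_eq_mul] at h2
  have h3 := hP.levels_mul_le
  linarith

/-- As α < 1/2, log(1/α) exceeds log 2, hence 2 ≤ 3·log(1/α); the summands 2, 2·log 2 and 2·log(1/α)
of the bound account for 3 + 2 + 2. -/
theorem Valid.depth_le_log (hP : P.Valid) (h : 0 < P.levels) (hr : P.radius ≤ 1)
    (hα : P.α < 1 / 2) : P.depth ≤ 7 * Real.log (1 / P.α) := by
  have hα0 := hP.α_pos
  have h0 : 0 < P.radius := (hP.scale_pos 0).trans (scale_lt_radius h)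
  have h1 : Real.log (2 * P.radius / P.α) ≤ Real.log 2 + Real.log (1 / P.α) := by
    rw [← Real.log_mul two_ne_zero (by positivity)]
    refine Real.log_le_log (by positivity) ?_
    rw [mul_one_div]
    gcongr
    linarith
  have h2 : Real.log 2 ≤ Real.log (1 / P.α) := by
    refine Real.log_le_log two_pos ?_
    rw [le_div_iff₀ hα0]
    linarith
  rw [depth]
  linarith [Real.log_two_gt_d9]

theorem Valid.depth_pow_le (hP : P.Valid) (h : 0 < P.levels) (hr : P.radius ≤ 1)
    (hα : P.α < 1 / 2) :
    P.depth ^ 2 * √P.depth ≤ 147 * Real.log (1 / P.α) ^ (5 / 2 : ℝ) := by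
  have h1 := hP.depth_le_log h hr hα
  have hd : 0 < P.depth := two_pos.trans_le (hP.two_le_depth h)
  set L := Real.log (1 / P.α) with hL
  have hL0 : 0 < L := by linarith
  have h2 : L ^ (5 / 2 : ℝ) = L ^ 2 * √L := by
    rw [Real.sqrt_eq_rpow, ← Real.rpow_natCast, ← Real.rpow_add hL0]
    norm_num
  have h3 : √P.depth ≤ 3 * √L := by
    refine (Real.sqrt_le_sqrt h1).trans ?_
    rw [Real.sqrt_mul (by norm_num)]
    refine mul_le_mul_of_nonneg_right ?_ (Real.sqrt_nonneg _)
    rw [Real.sqrt_le_left (by norm_num)]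
    norm_num
  rw [h2]
  calc P.depth ^ 2 * √P.depth ≤ (7 * L) ^ 2 * (3 * √L) := by gcongr
    _ = 147 * (L ^ 2 * √L) := by ring

end Chain

section Accuracy

variable {m n : ℕ} {X : Finset (Fin m → ℝ)} {e : Fin X.card ≃ X} {ρ α : ℝ}

/-! ### Separation numbers -/

theorem packingNumber_le_card (X : Finset (Fin m → ℝ)) (ε : ℝ≥0) :
    Metric.packingNumber ε (X : Set (Fin m → ℝ)) ≤ X.card := by
  refine (Metric.packingNumber_le_encard_self _).trans_eq ?_
  exact Set.encard_coe_eq_coe_finsetCard X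

theorem packingNumber_ne_top (X : Finset (Fin m → ℝ)) (ε : ℝ≥0) :
    Metric.packingNumber ε (X : Set (Fin m → ℝ)) ≠ ⊤ :=
  ne_top_of_le_ne_top (ENat.natCast_ne_top _) (packingNumber_le_card X ε)

theorem sepInf_le_card (X : Finset (Fin m → ℝ)) (t : ℝ) : sepInf X t ≤ X.card :=
  ENat.toNat_le_of_le_natCast (packingNumber_le_card X _)

theorem card_le_sepInf {ι : Type*} {S : Finset ι} {f : ι → Fin m → ℝ} {t : ℝ} (ht : 0 ≤ t)
    (hf : ∀ i ∈ S, f i ∈ X) (hsep : ∀ i ∈ S, ∀ j ∈ S, i ≠ j → t < dist (f i) (f j)) :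
    S.card ≤ sepInf X t := by
  have hinj : Set.InjOn f S := fun i hi j hj hij => by
    by_contra hne
    have := hsep i hi j hj hne
    rw [hij, dist_self] at this
    linarith
  have hs : Metric.IsSeparated (t.toNNReal : ℝ≥0∞) (f '' S) := by
    rintro _ ⟨i, hi, rfl⟩ _ ⟨j, hj, rfl⟩ hne
    rw [edist_dist]
    exact (ENNReal.ofReal_lt_ofReal_iff_of_nonneg ht).2
      (hsep i hi j hj fun h => hne (by rw [h]))
  have h1 := hs.encard_le_packingNumber (A := (X : Set (Fin m → ℝ)))
    (by rintro _ ⟨i, hi, rfl⟩; exact hf i hi)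
  rw [hinj.encard_image, Set.encard_coe_eq_coe_finsetCard] at h1
  have h2 := ENat.toNat_le_toNat h1 (packingNumber_ne_top X _)
  simpa [sepInf] using h2

theorem dist_le_one {x y : Fin m → ℝ} (hx : ∀ j, x j ∈ Set.Icc (0 : ℝ) 1)
    (hy : ∀ j, y j ∈ Set.Icc (0 : ℝ) 1) : dist x y ≤ 1 := by
  refine (dist_pi_le_iff zero_le_one).2 fun j => ?_
  simpa using Real.dist_le_of_mem_Icc (hx j) (hy j)

theorem sepInf_le_one (hX : ∀ x ∈ X, ∀ j, x j ∈ Set.Icc (0 : ℝ) 1) {t : ℝ} (ht : 1 ≤ t) :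
    sepInf X t ≤ 1 := by
  obtain ⟨C, hC, -, hs, hcard⟩ :=
    Metric.exists_set_encard_eq_packingNumber (packingNumber_ne_top X t.toNNReal)
  have hsub : C.Subsingleton := by
    intro x hx y hy
    by_contra hne
    have h1 : (t.toNNReal : ℝ≥0∞) < edist x y := hs hx hy hne
    rw [edist_dist] at h1
    have h2 := (ENNReal.ofReal_lt_ofReal_iff_of_nonneg (zero_le_one.trans ht)).1 h1
    linarith [dist_le_one (hX x (hC hx)) (hX y (hC hy))]
  refine ENat.toNat_le_of_le_natCast ?_
  rw [← hcard]
  exact Set.encard_le_one_iff_subsingleton.2 hsub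

/-- A real supremum dominates its terms only if the family is bounded. Here √(log |X|) is a bound:
for t ≥ 1 the terms vanish, because the cube has diameter at most 1, and for t ≤ 1 the separation
number is at most |X|. -/
theorem le_iSup_sepInf (hX : ∀ x ∈ X, ∀ j, x j ∈ Set.Icc (0 : ℝ) 1) {a t : ℝ} (ha : 0 ≤ a)
    (ht : a ≤ t) : t ^ 2 * √(Real.log (sepInf X t)) ≤
      ⨆ t : Set.Ici a, (t : ℝ) ^ 2 * √(Real.log (sepInf X t)) := by
  refine le_ciSup (f := fun t : Set.Ici a => (t : ℝ) ^ 2 * √(Real.log (sepInf X t)))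
    ⟨√(Real.log X.card), ?_⟩ ⟨t, ht⟩
  rintro _ ⟨⟨t, ht⟩, rfl⟩
  have ht0 : 0 ≤ t := ha.trans ht
  simp only
  rcases le_total 1 t with h | h
  · have h1 : Real.log (sepInf X t) = 0 := by
      have := sepInf_le_one hX h
      interval_cases sepInf X t <;> simp
    rw [h1, Real.sqrt_zero, mul_zero]
    exact Real.sqrt_nonneg _
  · have h1 : √(Real.log (sepInf X t)) ≤ √(Real.log X.card) := by
      refine Real.sqrt_le_sqrt ?_
      rcases Nat.eq_zero_or_pos (sepInf X t) with h0 | h0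
      · rw [h0, Nat.cast_zero, Real.log_zero]
        exact Real.log_natCast_nonneg _
      · exact Real.log_le_log (Nat.cast_pos.2 h0) (Nat.cast_le.2 (sepInf_le_card X t))
    have h2 : t ^ 2 ≤ 1 := pow_le_one₀ ht0 h
    exact (mul_le_of_le_one_left (Real.sqrt_nonneg _) h2).trans h1

/-! ### The radius and the centers -/

theorem rowDist_le_dist {i l : ℕ} (hi : i < X.card) (hl : l < X.card) :
    rowDist (meanChain e n ρ α).z (m + m) i l ≤
      dist (e ⟨i, hi⟩ : Fin m → ℝ) (e ⟨l, hl⟩ : Fin m → ℝ) := by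
  refine runMax_le dist_nonneg fun k hk => ?_
  have h : ∀ j : Fin m, |(e ⟨i, hi⟩ : Fin m → ℝ) j - (e ⟨l, hl⟩ : Fin m → ℝ) j| ≤
      dist (e ⟨i, hi⟩ : Fin m → ℝ) (e ⟨l, hl⟩ : Fin m → ℝ) := fun j => by
    rw [← Real.dist_eq]
    exact dist_le_pi_dist _ _ j
  rcases lt_or_ge k m with hkm | hkm
  · refine le_trans (le_of_eq ?_) ((le_abs_self _).trans (h ⟨k, hkm⟩))
    simp [meanChain, pointEntry, hkm, hi, hl]
  · refine le_trans (le_of_eq ?_) ((neg_le_abs _).trans (h ⟨k - m, by omega⟩))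
    have h1 : k - m < m := by omega
    simp [meanChain, pointEntry, hi, hl, not_lt.2 hkm, h1]
    ring

theorem meanChain_radius_le_one (hX : ∀ x ∈ X, ∀ j, x j ∈ Set.Icc (0 : ℝ) 1) :
    (meanChain e n ρ α).radius ≤ 1 := by
  refine runMax_le zero_le_one fun i hi => ?_
  change i < X.card at hi
  exact (rowDist_le_dist hi (by omega)).trans
    (dist_le_one (hX _ (e ⟨i, hi⟩).2) (hX _ (e ⟨0, _⟩).2))

/-- A later center is farther than the scale from every earlier one in `rowDist`, which never
exceeds the sup distance, so the centers form a separated subset of `X`. -/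
theorem numCenters_le_sepInf (hα : 0 < α) (l : ℕ) :
    (meanChain e n ρ α).numCenters l ≤ sepInf X ((meanChain e n ρ α).scale l) := by
  classical
  set P := meanChain e n ρ α with hPdef
  have hs : 0 ≤ P.scale l := by
    rw [Chain.scale]
    change 0 ≤ α / 2 * 2 ^ l
    positivity
  have h1 : P.numCenters l =
      ((Finset.univ.filter fun i : Fin X.card => P.center l i = i).card : ℝ) := by
    rw [Chain.numCenters, Finset.card_filter, Nat.cast_sum]
    change ∑ i ∈ Finset.range X.card, _ = _
    rw [Finset.sum_range]
    refine Finset.sum_congr rfl fun i _ => ?_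
    rw [Chain.isCenter]
    split_ifs <;> simp
  rw [h1, Nat.cast_le]
  have hlt : ∀ i j : Fin X.card, P.center l i = i → P.center l j = j → (j : ℕ) < i →
      P.scale l < dist (e i : Fin m → ℝ) (e j : Fin m → ℝ) := fun i j hi hj hij =>
    (lt_dist_of_centers hi hj hij).trans_le (rowDist_le_dist i.2 j.2)
  refine card_le_sepInf (f := fun i => (e i : Fin m → ℝ)) hs (fun i _ => (e i).2) ?_
  intro i hi j hj hij
  have hi' := (Finset.mem_filter.1 hi).2
  have hj' := (Finset.mem_filter.1 hj).2
  rcases lt_or_gt_of_ne hij with h | h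
  · rw [dist_comm]
    exact hlt j i hj' hi' h
  · exact hlt i j hi' hj' h

end Accuracy

/-! ### The expected error in the three regimes of the main program. -/

section MainError

variable {m n : ℕ} {X : Finset (Fin m → ℝ)} {e : Fin X.card ≃ X} {ρ α : ℝ}

/-- The requirement on the number of records at each level. -/
theorem level_sample_bound (hρ : 0 < ρ) (hα : 0 < α) (hα' : ¬ 1 / 2 ≤ α)
    (hX : ∀ x ∈ X, ∀ j, x j ∈ Set.Icc (0 : ℝ) 1)
    (hn : 100000 * (Real.log m * Real.log (1 / α) ^ (5 / 2 : ℝ) / (α ^ 2 * √ρ)) *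
      (⨆ t : Set.Ici (α / 2), (t : ℝ) ^ 2 * √(Real.log (sepInf X t))) ≤ (n : ℝ))
    (hP : (meanChain e n ρ α).Valid) {l : ℕ} (hl : l < (meanChain e n ρ α).levels) :
    100000 * (Real.log m * Real.log (1 / α) ^ (5 / 2 : ℝ)) *
      ((meanChain e n ρ α).scale l ^ 2 * √(Real.log ((meanChain e n ρ α).numCenters l))) ≤
      n * (α ^ 2 * √ρ) := by
  have hden : 0 < α ^ 2 * √ρ := mul_pos (pow_pos hα 2) (Real.sqrt_pos.2 hρ)
  have hL : 0 ≤ Real.log (1 / α) := by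
    refine Real.log_nonneg ?_
    rw [le_div_iff₀ hα]
    linarith
  have hlm : 0 ≤ Real.log m := Real.log_natCast_nonneg m
  have h1 : (meanChain e n ρ α).scale l ^ 2 * √(Real.log ((meanChain e n ρ α).numCenters l)) ≤
      ⨆ t : Set.Ici (α / 2), (t : ℝ) ^ 2 * √(Real.log (sepInf X t)) := by
    refine le_trans (mul_le_mul_of_nonneg_left (Real.sqrt_le_sqrt ?_) (sq_nonneg _))
      (le_iSup_sepInf hX (half_pos hα).le (hP.scale_ge l))
    exact Real.log_le_log (two_pos.trans_le (hP.two_le_numCenters hl)) (numCenters_le_sepInf hα l)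
  have h2 : 0 ≤ 100000 * (Real.log m * Real.log (1 / α) ^ (5 / 2 : ℝ)) := by positivity
  refine (mul_le_mul_of_nonneg_left h1 h2).trans ?_
  rw [← div_le_iff₀ hden]
  refine le_trans (le_of_eq ?_) hn
  ring

theorem error_of_half_le (hm : 2 ≤ m) (hn : 1 ≤ n) (hρ : 0 < ρ) (hα : 1 / 2 ≤ α)
    (hX : ∀ x ∈ X, ∀ j, x j ∈ Set.Icc (0 : ℝ) 1) (D : Fin n → X) :
    ∫⁻ y, ‖y - dataMean D‖ₑ ∂(answerLaw mainProg e ρ α D) ≤ ENNReal.ofReal α := by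
  have : Nonempty (Fin m) := ⟨⟨0, by omega⟩⟩
  have hn' : (0 : ℝ) < n := Nat.cast_pos.2 hn
  refine (lintegral_error_le_of_selections one_pos (W := fun _ _ _ _ => 0) (T := 0)
    (G := fun _ _ => 1 / 2) (fun _ _ _ _ => rfl) (answer_mainProg_of_half_le hm hn hρ hα D)
    (a := 1 / 2) (g := fun _ _ _ => 0) (fun _ _ _ _ => rfl) (fun h _ => ?_) (B := fun _ => 0)
    fun h t ht => by omega).trans (ENNReal.ofReal_le_ofReal (by simpa using hα))
  rw [Finset.sum_range_zero, add_zero]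
  refine (pi_norm_le_iff_of_nonempty _).2 fun j => ?_
  have h1 : 0 ≤ ∑ d, (D d : Fin m → ℝ) j := Finset.sum_nonneg fun d _ => (hX _ (D d).2 j).1
  have h2 : ∑ d, (D d : Fin m → ℝ) j ≤ n := by
    refine (Finset.sum_le_card_nsmul _ _ 1 fun d _ => (hX _ (D d).2 j).2).trans_eq (by simp)
  have h3 : dataMean D j = (∑ d, (D d : Fin m → ℝ) j) / n := by
    rw [dataMean, Pi.smul_apply, Finset.sum_apply, smul_eq_mul, inv_mul_eq_div]
  have h4 := div_nonneg h1 hn'.le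
  have h5 := (div_le_one hn').2 h2
  rw [Real.norm_eq_abs, Pi.sub_apply, h3, abs_le]
  constructor <;> linarith

theorem error_of_le_radius (hm : 2 ≤ m) (hn : 1 ≤ n) (hρ : 0 < ρ) (hα : 0 < α)
    (hα' : ¬ 1 / 2 ≤ α) (hr : α * X.card ≤ (meanChain e n ρ α).radius)
    (hl : ∀ l < (meanChain e n ρ α).levels,
      100000 * (Real.log m * Real.log (1 / α) ^ (5 / 2 : ℝ)) *
      ((meanChain e n ρ α).scale l ^ 2 * √(Real.log ((meanChain e n ρ α).numCenters l))) ≤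
      n * (α ^ 2 * √ρ)) (D : Fin n → X) :
    ∫⁻ y, ‖y - dataMean D‖ₑ ∂(answerLaw mainProg e ρ α D) ≤ ENNReal.ofReal α := by
  have : Nonempty (Fin m) := ⟨⟨0, by omega⟩⟩
  set P := meanChain e n ρ α with hPdef
  have hP : P.Valid := meanChain_valid hm hn hρ hα D
  have hn' : (0 : ℝ) < n := Nat.cast_pos.2 hn
  have hN : (1 : ℝ) ≤ X.card := Nat.one_le_cast.2 hP.N_pos
  have hsρ := Real.sqrt_pos.2 hρ
  refine (lintegral_error_le_of_selections (Nat.succ_pos n)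
    (W := fun D => P.histLogit (recordIndex e D)) (T := X.card)
    (G := fun h (j : Fin m) => P.histOutput X.card h j) (P.histLogit_adapted _)
    (answer_mainProg_of_le_radius hm hn hρ hα hα' hr D) (a := 0)
    (g := fun _ i k => P.radius / n * |(k : ℝ) - P.count (recordIndex e D) i|)
    (fun _ _ _ _ => rfl) (fun h _ => ?_) (B := fun _ => P.radius / n * (2 / √ρ))
    fun h t ht => ?_).trans (ENNReal.ofReal_le_ofReal ?_)
  · refine (pi_norm_le_iff_of_nonempty _).2 fun j => ?_
    rw [Real.norm_eq_abs, Pi.sub_apply, dataMean_apply (e := e) (ρ := ρ) (α := α)]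
    exact hP.abs_histOutput_sub_le (fun d hd => recordIndex_lt e D hd) h
      (k := j) (j.2.trans_le (Nat.le_add_right m m))
  · exact hP.expected_count_error_le (recordIndex e D) h t
  -- As |X| ≥ 1, the radius is at least α and there is a level. The scale of the last one is at
  -- least half the radius and its net has at least two centers, so the requirement at that level
  -- alone gives 2·radius² ≤ nα²√ρ. Combined with α|X| ≤ radius this bounds the total count error
  -- |X|·2·radius/(n√ρ) by α.
  · have hrα : α ≤ P.radius := by nlinarith
    have hlev : 0 < P.levels := by
      rw [hP.lt_levels_iff, Chain.scale]
      change α / 2 * 2 ^ 0 < _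
      linarith
    have hlast := hl (P.levels - 1) (by omega)
    have hs1 : P.radius ≤ 2 * P.scale (P.levels - 1) := by
      rw [← Chain.scale_succ, Nat.sub_add_cancel hlev]
      exact hP.radius_le_scale_levels
    have hlog : 1 / 2 ≤ √(Real.log (P.numCenters (P.levels - 1))) := by
      refine Real.le_sqrt_of_sq_le ?_
      linarith [hP.half_le_log_numCenters (l := P.levels - 1) (by omega)]
    have hlogm : 1 / 2 ≤ Real.log m := by
      have := Real.log_le_log two_pos (show (2 : ℝ) ≤ m by exact_mod_cast hm)
      linarith [Real.log_two_gt_d9]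
    have hL : 1 / 2 ≤ Real.log (1 / α) := by
      have : (2 : ℝ) ≤ 1 / α := by
        rw [le_div_iff₀ hα]
        linarith
      linarith [Real.log_le_log two_pos this, Real.log_two_gt_d9]
    have hL2 : 1 / 8 ≤ Real.log (1 / α) ^ (5 / 2 : ℝ) := by
      calc (1 / 8 : ℝ) = (1 / 2 : ℝ) ^ (3 : ℝ) := by norm_num
        _ ≤ (1 / 2 : ℝ) ^ (5 / 2 : ℝ) :=
          Real.rpow_le_rpow_of_exponent_ge (by norm_num) (by norm_num) (by norm_num)
        _ ≤ _ := Real.rpow_le_rpow (by norm_num) hL (by norm_num)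
    have hr0 : 0 ≤ P.radius := hα.le.trans hrα
    have h1 : 2 * P.radius ^ 2 ≤ n * (α ^ 2 * √ρ) := by
      refine le_trans ?_ hlast
      calc 2 * P.radius ^ 2 ≤ 100000 * (1 / 2 * (1 / 8)) * ((P.radius / 2) ^ 2 * (1 / 2)) := by
            nlinarith [sq_nonneg P.radius]
        _ ≤ _ := by
          gcongr
          linarith
    rw [zero_add, Finset.sum_const, Finset.card_range, nsmul_eq_mul, div_mul_div_comm,
      ← mul_div_assoc, div_le_iff₀ (mul_pos hn' hsρ)]
    have h2 : α * (X.card * (P.radius * 2)) ≤ α * (α * (n * √ρ)) := by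
      calc α * (X.card * (P.radius * 2)) = α * X.card * (P.radius * 2) := by ring
        _ ≤ P.radius * (P.radius * 2) := by gcongr
        _ = 2 * P.radius ^ 2 := by ring
        _ ≤ _ := h1
        _ = _ := by ring
    exact le_of_mul_le_mul_left h2 hα

theorem error_of_radius_lt (hm : 2 ≤ m) (hn : 1 ≤ n) (hρ : 0 < ρ) (hα : 0 < α)
    (hα' : ¬ 1 / 2 ≤ α) (hr : ¬ α * X.card ≤ (meanChain e n ρ α).radius)
    (hr1 : (meanChain e n ρ α).radius ≤ 1)
    (hl : ∀ l < (meanChain e n ρ α).levels,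
      100000 * (Real.log m * Real.log (1 / α) ^ (5 / 2 : ℝ)) *
      ((meanChain e n ρ α).scale l ^ 2 * √(Real.log ((meanChain e n ρ α).numCenters l))) ≤
      n * (α ^ 2 * √ρ)) (D : Fin n → X) :
    ∫⁻ y, ‖y - dataMean D‖ₑ ∂(answerLaw mainProg e ρ α D) ≤ ENNReal.ofReal α := by
  have : Nonempty (Fin m) := ⟨⟨0, by omega⟩⟩
  set P := meanChain e n ρ α with hPdef
  have hP : P.Valid := meanChain_valid hm hn hρ hα D
  refine (lintegral_error_le_of_selections (show 0 < m + m by omega)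
    (W := fun D => P.logit (recordIndex e D)) (T := P.offset P.levels)
    (G := fun h (j : Fin m) => P.output P.levels h j) (P.logit_adapted _)
    (answer_mainProg_of_radius_lt hm hn hρ hα hα' hr D) (a := 3 / 4 * α)
    (g := P.gap (recordIndex e D)) (P.gap_adapted _) (fun h hh => ?_)
    (B := fun τ => α / (4 * P.depth) / P.rounds (P.levelOf τ))
    fun h τ hτ => ?_).trans (ENNReal.ofReal_le_ofReal hP.sum_error_le)
  · refine (pi_norm_le_iff_of_nonempty _).2 fun j => ?_
    rw [Real.norm_eq_abs, Pi.sub_apply, dataMean_apply (e := e) (ρ := ρ) (α := α)]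
    exact hP.abs_output_sub_le (fun d hd => recordIndex_lt e D hd) hh
      (k := j) (j.2.trans_le (Nat.le_add_right m m))
  · obtain ⟨l, hlL, s, hs, rfl⟩ := P.exists_eq_offset_add hτ
    rw [P.levelOf_offset_add hs]
    refine hP.expected_gap_le (recordIndex e D) h hlL hs (le_trans ?_ (hl l hlL))
    have h1 := hP.depth_pow_le (by omega) hr1 (not_le.1 hα')
    change P.depth ^ 2 * √P.depth ≤ 147 * Real.log (1 / α) ^ (5 / 2 : ℝ) at h1
    have hlm : Real.log ((m + m : ℕ) : ℝ) ≤ 2 * Real.log m := by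
      have hm' : (2 : ℝ) ≤ m := by exact_mod_cast hm
      have : Real.log (m ^ 2 : ℝ) = 2 * Real.log m := by
        rw [Real.log_pow]
        norm_num
      rw [← this]
      refine Real.log_le_log (by push_cast; linarith) ?_
      push_cast
      nlinarith
    have hlm0 : 0 ≤ Real.log ((m + m : ℕ) : ℝ) := Real.log_natCast_nonneg _
    have hlm1 : 0 ≤ Real.log m := Real.log_natCast_nonneg _
    have hq := Real.sqrt_nonneg (Real.log (P.numCenters l))
    have hd0 : 0 ≤ P.depth ^ 2 * √P.depth := mul_nonneg (sq_nonneg _) (Real.sqrt_nonneg _)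
    rw [Chain.scale_succ]
    -- The constant is 64·2² = 256, times 2 for passing from log(2m) to log m, times 147 from the
    -- depth: 75264, below 100000.
    calc 64 * (2 * P.scale l) ^ 2 * Real.log P.M * P.depth ^ 2 *
          (√P.depth * √(Real.log (P.numCenters l)))
        = 256 * (Real.log ((m + m : ℕ) : ℝ) * (P.depth ^ 2 * √P.depth)) *
          (P.scale l ^ 2 * √(Real.log (P.numCenters l))) := by
          change 64 * (2 * P.scale l) ^ 2 * Real.log ((m + m : ℕ) : ℝ) * _ * _ = _
          ring
      _ ≤ 256 * (2 * Real.log m * (147 * Real.log (1 / α) ^ (5 / 2 : ℝ))) *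
          (P.scale l ^ 2 * √(Real.log (P.numCenters l))) := by gcongr
      _ = 75264 * (Real.log m * Real.log (1 / α) ^ (5 / 2 : ℝ)) *
          (P.scale l ^ 2 * √(Real.log (P.numCenters l))) := by ring
      _ ≤ _ := by
          have : 0 ≤ Real.log (1 / α) ^ (5 / 2 : ℝ) := by linarith
          gcongr
          norm_num

theorem errInf_mainProg_le (hm : 2 ≤ m) (hn : 1 ≤ n) (hρ : 0 < ρ) (hα : 0 < α)
    (hX : ∀ x ∈ X, ∀ j, x j ∈ Set.Icc (0 : ℝ) 1)
    (hlarge : 100000 * (Real.log m * Real.log (1 / α) ^ (5 / 2 : ℝ) / (α ^ 2 * √ρ)) *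
      (⨆ t : Set.Ici (α / 2), (t : ℝ) ^ 2 * √(Real.log (sepInf X t))) ≤ (n : ℝ)) :
    errInf (answerLaw mainProg (n := n) e ρ α) ≤ ENNReal.ofReal α := by
  refine iSup_le fun D => ?_
  by_cases h1 : 1 / 2 ≤ α
  · exact error_of_half_le hm hn hρ h1 hX D
  have hl : ∀ l < (meanChain e n ρ α).levels, _ := fun l hl =>
    level_sample_bound hρ hα h1 hX hlarge (meanChain_valid hm hn hρ hα D) hl
  by_cases h2 : α * X.card ≤ (meanChain e n ρ α).radius
  · exact error_of_le_radius hm hn hρ hα h1 h2 hl D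
  · exact error_of_radius_lt hm hn hρ hα h1 h2 (meanChain_radius_le_one hX) hl D

end MainError

theorem theorem4 :
    ∃ (C K : ℝ) (k : ℕ) (c : Prog), 0 < C ∧ 0 < K ∧
      ∀ (m n : ℕ) (X : Finset (Fin m → ℝ)) (e : Fin X.card ≃ X) (ρ α : ℝ),
        2 ≤ m → 1 ≤ n → (∀ x ∈ X, ∀ j, x j ∈ Set.Icc (0 : ℝ) 1) → 0 < ρ → 0 < α → α ≤ 1 →
        -- the program is a randomized algorithm that runs in polynomial time
        (∀ (D : Fin n → X) (ω : ℕ → unitInterval),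
          HaltsWithin ω c (inputMemory e ρ α D) (k * (m + X.card + n) ^ k)) ∧
        (∀ D : Fin n → X, Measurable (answer c e ρ α D)) ∧
        -- it is private
        IsZCDP ρ (answerLaw c (n := n) e ρ α) ∧
        -- it is accurate as soon as the dataset is large enough
        (K * (Real.log m * Real.log (1 / α) ^ (5 / 2 : ℝ) / (α ^ 2 * √ρ)) *
              (⨆ t : Set.Ici (α / C), (t : ℝ) ^ 2 * √(Real.log (sepInf X t))) ≤ (n : ℝ) →
          errInf (answerLaw c (n := n) e ρ α) ≤ ENNReal.ofReal α) := by
  -- C = 2 because the finest net has scale α/2; K = 100000 covers the constant 75264 of chaining;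
  -- and 2^8 enters the time bound because step counts are measured in twice m + |X| + n, to cover
  -- the doubled coordinates.
  refine ⟨2, 100000, 2600000 * 2 ^ 8, mainProg, two_pos, by norm_num,
    fun m n X e ρ α hm hn hX hρ hα _ => ⟨fun D ω => haltsWithin_mainProg hm hn hρ hα D ω le_rfl,
      fun D => measurable_answer_mainProg hm hn hρ hα D, isZCDP_mainProg hm hn hρ hα,
      errInf_mainProg_le hm hn hρ hα hX⟩⟩
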